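/- All $2$-complexes are combinatorial, with attaching maps of $2$-cells that are immersed closed edge paths. A *piece* of a $2$-complex $X$ is a non-trivial path $P\to X$ that factors as $P\to\partial R_1\to X$ and as $P\to\partial R_2\to X$ for $2$-cells $R_1,R_2$ of $X$, such that no homeomorphism $\partial R_1\to\partial R_2$ is compatible with the maps from $P$ and with the attaching maps to $X$. The complex $X$ is $C(4)$ if the attaching map of no $2$-cell is a concatenation of fewer than four pieces. It is $T(4)$ if there is no reduced map $D\to X$ from a disc diagram $D$ that has an internal vertex of valence $3$; here $D \to X$ is reduced if every piece of $D$ is mapped to a piece of the image of $D$ in $X$. The *gallery distance* of two $2$-cells of $X$ is the least number $n$ of terms in a sequence of distinct $2$-cells $F_1,\dots,F_n$ from one to the other in which consecutive closed cells intersect. The *quadrization* $Y$ of $X$ is the bipartite graph on the set of all $0$-cells and $2$-cells of $X$ in which a $0$-cell $v$ and a $2$-cell $F$ are adjacent if and only if $v\in\partial F$. A *flat* in $Y$ is an isometric embedding, for the graph metrics, of the $1$-skeleton of the tiling of the Euclidean plane by unit squares. Let $\mathfrak X'$ be the $2$-complex with $1$-skeleton $(\mathbb R\times\mathbb Z\times\{0\})\cup(\mathbb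 Z\times\mathbb R\times\{1\})\cup(\mathbb Z\times\mathbb Z\times[0,1])$, vertex set $\mathbb Z\times\mathbb Z\times\{0,1\}$, and, for all $i,j\in\mathbb Z$, one $2$-cell attached along the $8$-cycle $$(i,j,0),(i+1,j,0),(i+1,j,1),(i+1,j+1,1),(i+1,j+1,0),(i,j+1,0),(i,j+1,1),(i,j,1).$$ A *quasi-flat plane* is a $C(4)$–$T(4)$ complex that is homeomorphic to a complex obtained from $\mathfrak X'$ by collapsing some (possibly empty) set of edges of the form $\{(i,j)\}\times[0,1]$ to vertices. A *quasi-flat* in $X$ is a subcomplex $E$ of $X$ that is a quasi-flat plane and such that, for any two $2$-cells of $E$, their gallery distance in $E$ equals their gallery distance in $X$. **Lemma.** Let $X$ be a simply connected $C(4)$–$T(4)$ complex in which every $1$-cell is contained in the boundary of at least one $2$-cell. Let $Y$ be the quadrization of $X$ and let $E_Y$ be a flat in $Y$. Let $E$ be the subcomplex of $X$ that consists of all closed $2$-cells of $X$ corresponding to vertices of $E_Y$. Then $E$ is a quasi-flat in $X$. -/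

import Mathlib

universe u v

namespace SmallCancellation

/-! ### Graphs and edge paths -/

/-- A (multi-)graph in the sense of Serre: each `1`-cell is a pair of opposite *darts* `d`, `rev d`
(the `1`-cell with its two orientations).  Loops and multiple edges are allowed.  A dart with
source `v` is the same thing as an end of a `1`-cell at the vertex `v`. -/
structure Graph where
  /-- the vertices -/
  V : Type u
  /-- the darts, i.e. the oriented `1`-cells -/
  Dart : Type u
  src : Dart → V
  rev : Dart → Dart
  rev_rev : ∀ d, rev (rev d) = d
  rev_ne : ∀ d, rev d ≠ d

namespace Graph

/-- The terminal vertex of a dart. -/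
def tgt (G : Graph.{u}) (d : G.Dart) : G.V := G.src (G.rev d)

/-- `G.IsWalk a b p`: the list of darts `p` is an edge path from `a` to `b`
(backtracking is allowed). -/
def IsWalk (G : Graph.{u}) : G.V → G.V → List G.Dart → Prop
  | a, b, [] => a = b
  | a, b, d :: p => G.src d = a ∧ G.IsWalk (G.tgt d) b p

/-- Any two vertices are joined by an edge path. -/
def Connected (G : Graph.{u}) : Prop :=
  ∀ a b : G.V, ∃ p, G.IsWalk a b p

/-- The valence of a vertex: the number of ends of `1`-cells incident to it. -/
noncomputable def valence (G : Graph.{u}) (a : G.V) : ℕ :=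
  Nat.card {d : G.Dart // G.src d = a}

/-- Reversal of darts as a permutation. -/
def revPerm (G : Graph.{u}) : Equiv.Perm G.Dart :=
  ⟨G.rev, G.rev, G.rev_rev, G.rev_rev⟩

/-- Isomorphisms of graphs, i.e. combinatorial homeomorphisms. -/
structure Iso (G : Graph.{u}) (H : Graph.{v}) where
  onV : G.V ≃ H.V
  onDart : G.Dart ≃ H.Dart
  src_onDart : ∀ d, H.src (onDart d) = onV (G.src d)
  rev_onDart : ∀ d, H.rev (onDart d) = onDart (G.rev d)

end Graph

/-- The boundary `∂R` of a polygon `R` with `n ≥ 1` sides.  The dart `(k, true)` is the `k`-th side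
traversed from the vertex `k` to the vertex `k + 1`, and `(k, false)` is the same side traversed
backwards. -/
def polygon (n : ℕ) : Graph.{0} where
  V := ZMod n
  Dart := ZMod n × Bool
  src := fun s => if s.2 then s.1 else s.1 + 1
  rev := fun s => (s.1, !s.2)
  rev_rev := by rintro ⟨k, b⟩; simp
  rev_ne := by rintro ⟨k, b⟩; simp

/-- The dart of `∂R` that follows a given one in its direction of travel. -/
def polygonNext (n : ℕ) (s : (polygon n).Dart) : (polygon n).Dart :=
  (if s.2 then s.1 + 1 else s.1 - 1, s.2)

/-! ### Combinatorial 2-complexes -/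

/-- A combinatorial `2`-complex: a graph (the `1`-skeleton), and a set of `2`-cells, each of which
is a polygon with `len f ≥ 1` sides attached along a closed edge path.  The attaching maps are
immersions: the attaching path has no backtracking, also not at its base point. -/
structure TwoComplex extends Graph.{u} where
  /-- the `2`-cells -/
  Face : Type u
  /-- the number of sides of a `2`-cell -/
  len : Face → ℕ
  len_pos : ∀ f, 0 < len f
  /-- the dart of the `1`-skeleton along which the `k`-th side of the polygon is attached -/
  side : (f : Face) → ZMod (len f) → Dart
  side_chain : ∀ f k, src (side f (k + 1)) = src (rev (side f k))
  side_immersed : ∀ f k, side f (k + 1) ≠ rev (side f k)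

namespace TwoComplex

/-- The attaching map `∂R → X` of a `2`-cell, on darts. -/
def attach (X : TwoComplex.{u}) (f : X.Face) (s : (polygon (X.len f)).Dart) : X.Dart :=
  if s.2 then X.side f s.1 else X.rev (X.side f s.1)

/-- The vertex `a` lies on the boundary of the `2`-cell `f`. -/
def OnBoundary (X : TwoComplex.{u}) (a : X.V) (f : X.Face) : Prop :=
  ∃ k, X.src (X.side f k) = a

/-- The boundary of `f` as a closed edge path that starts at the vertex `k` of the polygon. -/
def boundaryPath (X : TwoComplex.{u}) (f : X.Face) (k : ZMod (X.len f)) : List X.Dart :=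
  (List.range (X.len f)).map fun i : ℕ => X.side f (k + i)

/-- Every `1`-cell is contained in the boundary of at least one `2`-cell. -/
def EveryEdgeInFace (X : TwoComplex.{u}) : Prop :=
  ∀ d : X.Dart, ∃ (f : X.Face) (s : (polygon (X.len f)).Dart), X.attach f s = d

/-! ### Simple connectedness (through the edge path group) -/

/-- `q` arises from `p` by inserting a backtrack or the boundary path of a `2`-cell. -/
def Insertion (X : TwoComplex.{u}) (p q : List X.Dart) : Prop :=
  ∃ l₁ c l₂, p = l₁ ++ l₂ ∧ q = l₁ ++ c ++ l₂ ∧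
    ((∃ d, c = [d, X.rev d]) ∨ ∃ f k, c = X.boundaryPath f k)

/-- Combinatorial homotopy, relative to the end points, of edge paths from `a` to `b`. -/
def Homotopic (X : TwoComplex.{u}) (a b : X.V) : List X.Dart → List X.Dart → Prop :=
  Relation.EqvGen fun p q => X.IsWalk a b p ∧ X.IsWalk a b q ∧ X.Insertion p q

/-- `X` is non-empty, connected, and every closed edge path is null-homotopic. -/
def IsSimplyConnected (X : TwoComplex.{u}) : Prop :=
  Nonempty X.V ∧ X.Connected ∧ ∀ (a : X.V) (p : List X.Dart), X.IsWalk a a p → X.Homotopic a a p []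

/-! ### Pieces and the condition `C(p)` -/

/-- `q` is a lift of the path `p` to the boundary `∂R` of the polygon `R` of the `2`-cell `f`:
the path `p : P → X` factors as `P → ∂R → X` with first map `q`. -/
def IsLift (X : TwoComplex.{u}) (f : X.Face) (q : List (polygon (X.len f)).Dart)
    (p : List X.Dart) : Prop :=
  (∃ a b, (polygon (X.len f)).IsWalk a b q) ∧ q.map (X.attach f) = p

/-- `p` is a piece of the subcomplex that consists of the closed `2`-cells in `A`: a non-trivial
path with factorizations `P → ∂R₁ → X` and `P → ∂R₂ → X` for two (possibly equal) `2`-cells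
`R₁, R₂` in `A`, such that there is no homeomorphism `∂R₁ → ∂R₂` that is compatible with the maps
from `P` and with the attaching maps to `X`. -/
def IsPieceIn (X : TwoComplex.{u}) (A : Set X.Face) (p : List X.Dart) : Prop :=
  p ≠ [] ∧ ∃ f₁ ∈ A, ∃ f₂ ∈ A, ∃ q₁ q₂, X.IsLift f₁ q₁ p ∧ X.IsLift f₂ q₂ p ∧
    ¬ ∃ h : Graph.Iso (polygon (X.len f₁)) (polygon (X.len f₂)),
        q₁.map h.onDart = q₂ ∧ ∀ s, X.attach f₂ (h.onDart s) = X.attach f₁ s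

/-- `p` is a piece of `X`. -/
def IsPiece (X : TwoComplex.{u}) (p : List X.Dart) : Prop :=
  X.IsPieceIn Set.univ p

/-- The small cancellation condition `C(p)`: the attaching map of a `2`-cell is never a
concatenation of fewer than `p` pieces. -/
def IsC (X : TwoComplex.{u}) (p : ℕ) : Prop :=
  ∀ (f : X.Face) (k : ZMod (X.len f)) (l : List (List X.Dart)),
    (∀ c ∈ l, X.IsPiece c) → l.flatten = X.boundaryPath f k → p ≤ l.length

end TwoComplex

/-- A combinatorial map of `2`-complexes: open cells are mapped homeomorphically to open cells.  On
a `2`-cell it is given by an isomorphism of polygons compatible with the attaching maps. -/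
structure Hom (Z : TwoComplex.{v}) (X : TwoComplex.{u}) where
  onV : Z.V → X.V
  onDart : Z.Dart → X.Dart
  onFace : Z.Face → X.Face
  src_onDart : ∀ d, X.src (onDart d) = onV (Z.src d)
  rev_onDart : ∀ d, X.rev (onDart d) = onDart (Z.rev d)
  face_iso : ∀ f, ∃ h : Graph.Iso (polygon (Z.len f)) (polygon (X.len (onFace f))),
    ∀ s, X.attach (onFace f) (h.onDart s) = onDart (Z.attach f s)

/-- A map is reduced if every piece of the source is mapped to a piece of the image. -/
def Hom.IsReduced {Z : TwoComplex.{v}} {X : TwoComplex.{u}} (φ : Hom Z X) : Prop :=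
  ∀ p, Z.IsPiece p → X.IsPieceIn (Set.range φ.onFace) (p.map φ.onDart)

/-! ### Disc diagrams and the condition `T(q)` -/

/-- A disc diagram: a finite contractible `2`-complex with an embedding into the (oriented) plane.
Such an embedding is recorded, as usual, by the counterclockwise cyclic order of the darts around
each vertex.  The `2`-cells together with one further "outer" cell are the faces of a cell
structure on the `2`-sphere. -/
structure DiscDiagram where
  cx : TwoComplex.{0}
  finite_V : Finite cx.V
  finite_Dart : Finite cx.Dart
  finite_Face : Finite cx.Face
  connected : cx.Connected
  /-- the next dart, counterclockwise, with the same source -/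
  rot : Equiv.Perm cx.Dart
  rot_cycles : ∀ a b, rot.SameCycle a b ↔ cx.src a = cx.src b
  /-- the direction in which the polygon of a `2`-cell runs counterclockwise around that cell -/
  ccw : cx.Face → Bool
  /-- walking along the boundary of a `2`-cell with the cell on the left, one turns at the end of
  each dart `d` into the dart that precedes `rev d` in the cyclic order -/
  face_step : ∀ f k, cx.attach f (polygonNext _ (k, ccw f)) =
    rot⁻¹ (cx.rev (cx.attach f (k, ccw f)))
  /-- each dart has at most one `2`-cell on its left, and only once -/
  face_inj : Function.Injective
    fun s : (Σ f : cx.Face, ZMod (cx.len f)) => cx.attach s.1 (s.2, ccw s.1)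
  /-- the darts without a `2`-cell on their left are the boundary of a single outer face -/
  outer_cycle : ∀ a b, (∀ f k, cx.attach f (k, ccw f) ≠ a) → (∀ f k, cx.attach f (k, ccw f) ≠ b) →
    (rot⁻¹ * cx.revPerm).SameCycle a b
  outer_exists : Nonempty cx.Dart → ∃ a, ∀ f k, cx.attach f (k, ccw f) ≠ a
  /-- Euler's formula `V - E + (F + 1) = 2` for the sphere, doubled -/
  euler : 2 * Nat.card cx.V + 2 * Nat.card cx.Face = Nat.card cx.Dart + 2

/-- A vertex is internal if it does not lie on the outer face. -/
def DiscDiagram.IsInternal (D : DiscDiagram) (a : D.cx.V) : Prop :=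
  (∃ d, D.cx.src d = a) ∧ ∀ d, D.cx.src d = a → ∃ f k, D.cx.attach f (k, D.ccw f) = d

namespace TwoComplex

/-- The small cancellation condition `T(q)`: there is no reduced disc diagram in `X` with an internal
vertex of valence strictly between `2` and `q`. -/
def IsT (X : TwoComplex.{u}) (q : ℕ) : Prop :=
  ∀ (D : DiscDiagram) (φ : Hom D.cx X), φ.IsReduced →
    ∀ a, D.IsInternal a → ¬ (2 < D.cx.valence a ∧ D.cx.valence a < q)

/-! ### Gallery distance -/

/-- Two closed `2`-cells intersect.  (A non-empty intersection of two closed `2`-cells contains a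
vertex.) -/
def Meets (X : TwoComplex.{u}) (f g : X.Face) : Prop :=
  ∃ a, X.OnBoundary a f ∧ X.OnBoundary a g

/-- A sequence of distinct `2`-cells from `f` to `g` such that consecutive ones intersect. -/
def IsCellChain (X : TwoComplex.{u}) (f g : X.Face) (l : List X.Face) : Prop :=
  l.Nodup ∧ l.head? = some f ∧ l.getLast? = some g ∧ l.IsChain X.Meets

/-- A gallery between `f` and `g`: such a sequence for which no smaller subfamily has the same
property. -/
def IsGallery (X : TwoComplex.{u}) (f g : X.Face) (l : List X.Face) : Prop :=
  X.IsCellChain f g l ∧ ∀ l', X.IsCellChain f g l' → l' ⊆ l → l.length ≤ l'.length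

/-- The gallery distance: the least number of `2`-cells in a gallery (`⊤` if there is none). -/
noncomputable def galleryDist (X : TwoComplex.{u}) (f g : X.Face) : ℕ∞ :=
  sInf {n : ℕ∞ | ∃ l, X.IsGallery f g l ∧ n = (l.length : ℕ∞)}

/-! ### Subcomplexes -/

/-- A subcomplex of a `2`-complex. -/
structure Subcomplex (X : TwoComplex.{u}) where
  verts : Set X.V
  darts : Set X.Dart
  faces : Set X.Face
  src_mem : ∀ d ∈ darts, X.src d ∈ verts
  rev_mem : ∀ d ∈ darts, X.rev d ∈ darts
  side_mem : ∀ f ∈ faces, ∀ k, X.side f k ∈ darts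

/-- A subcomplex as a `2`-complex of its own. -/
def Subcomplex.cx {X : TwoComplex.{u}} (E : X.Subcomplex) : TwoComplex.{u} where
  V := E.verts
  Dart := E.darts
  src := fun d => ⟨X.src d, E.src_mem d d.2⟩
  rev := fun d => ⟨X.rev d, E.rev_mem d d.2⟩
  rev_rev := fun d => Subtype.ext (X.rev_rev d)
  rev_ne := fun d h => X.rev_ne d (congrArg Subtype.val h)
  Face := E.faces
  len := fun f => X.len f
  len_pos := fun f => X.len_pos f
  side := fun f k => ⟨X.side f k, E.side_mem f f.2 k⟩
  side_chain := fun f k => Subtype.ext (X.side_chain f k)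
  side_immersed := fun f k h => X.side_immersed f k (congrArg Subtype.val h)

/-- The subcomplex that is the union of the closed `2`-cells in `A`. -/
def cellUnion (X : TwoComplex.{u}) (A : Set X.Face) : X.Subcomplex where
  verts := {a | ∃ f ∈ A, X.OnBoundary a f}
  darts := {d | ∃ f ∈ A, ∃ s, X.attach f s = d}
  faces := A
  src_mem := by
    rintro d ⟨f, hf, ⟨k, b⟩, rfl⟩
    cases b
    · exact ⟨f, hf, k + 1, by simpa [attach] using X.side_chain f k⟩
    · exact ⟨f, hf, k, by simp [attach]⟩
  rev_mem := by
    rintro d ⟨f, hf, ⟨k, b⟩, rfl⟩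
    refine ⟨f, hf, (k, !b), ?_⟩
    cases b <;> simp [attach, X.rev_rev]
  side_mem := fun f hf k => ⟨f, hf, (k, true), by simp [attach]⟩

/-! ### Geometric realization -/

/-- The disjoint union of the closed cells: a point for each vertex, an interval for each dart, and
for each side of each polygon a triangle.  The point `(t, r)` of the triangle over the `k`-th side
of a polygon lies on the segment from the centre of the polygon (`r = 0`) to the point with
parameter `t` of that side (`r = 1`). -/
abbrev Cells (X : TwoComplex.{u}) : Type u :=
  (Σ _ : X.V, PUnit.{1}) ⊕ (Σ _ : X.Dart, unitInterval) ⊕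
    (Σ f : X.Face, Σ _ : ZMod (X.len f), unitInterval × unitInterval)

/-- A vertex as a `0`-cell. -/
def vertexPt (X : TwoComplex.{u}) (a : X.V) : X.Cells := Sum.inl ⟨a, PUnit.unit⟩

/-- The point with parameter `t` on a dart. -/
def dartPt (X : TwoComplex.{u}) (d : X.Dart) (t : unitInterval) : X.Cells :=
  Sum.inr (Sum.inl ⟨d, t⟩)

/-- The point with coordinates `(t, r)` in the triangle over the `k`-th side of a `2`-cell. -/
def facePt (X : TwoComplex.{u}) (f : X.Face) (k : ZMod (X.len f)) (t r : unitInterval) : X.Cells :=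
  Sum.inr (Sum.inr ⟨f, k, t, r⟩)

/-- The identifications that make the complex out of its cells. -/
inductive Glue (X : TwoComplex.{u}) : X.Cells → X.Cells → Prop
  /-- a dart begins at its source -/
  | src (d : X.Dart) : Glue X (X.dartPt d 0) (X.vertexPt (X.src d))
  /-- opposite darts are the same `1`-cell with opposite parametrizations -/
  | rev (d : X.Dart) (t : unitInterval) :
      Glue X (X.dartPt d t) (X.dartPt (X.rev d) (unitInterval.symm t))
  /-- the boundary of the polygon is attached along its sides -/
  | attach (f : X.Face) (k : ZMod (X.len f)) (t : unitInterval) :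
      Glue X (X.facePt f k t 1) (X.dartPt (X.side f k) t)
  /-- consecutive triangles of a polygon have a common edge -/
  | spoke (f : X.Face) (k : ZMod (X.len f)) (r : unitInterval) :
      Glue X (X.facePt f k 1 r) (X.facePt f (k + 1) 0 r)
  /-- all triangles of a polygon meet in its centre -/
  | centre (f : X.Face) (k k' : ZMod (X.len f)) (t t' : unitInterval) :
      Glue X (X.facePt f k t 0) (X.facePt f k' t' 0)

/-- The topological space (CW complex) underlying a `2`-complex, with the quotient topology. -/
def Realization (X : TwoComplex.{u}) : Type u := Quot X.Glue

instance (X : TwoComplex.{u}) : TopologicalSpace X.Realization :=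
  inferInstanceAs (TopologicalSpace (Quot X.Glue))

end TwoComplex

/-! ### The model planes -/

/-- The `1`-cells of the model: the segments from `(i,j,0)` to `(i+1,j,0)`, from `(i,j,1)` to
`(i,j+1,1)`, and from `(i,j,0)` to `(i,j,1)`, the last ones only where they are not collapsed. -/
inductive ModelEdge (S : Set (ℤ × ℤ)) : Type
  | x (i j : ℤ) : ModelEdge S
  | y (i j : ℤ) : ModelEdge S
  | z (i j : ℤ) (h : (i, j) ∉ S) : ModelEdge S

/-- The vertices of the model: `(i,j,b)` stands for `(i,j,0)` if `b` is `false` and for `(i,j,1)` if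
`b` is `true`; over the collapsed edges only `(i,j,0)` is kept. -/
abbrev ModelVertex (S : Set (ℤ × ℤ)) : Type :=
  {p : ℤ × ℤ × Bool // (p.1, p.2.1) ∈ S → p.2.2 = false}

open Classical in
/-- The image of the vertex `(i,j,b)` under the collapse. -/
noncomputable def modelVertex (S : Set (ℤ × ℤ)) (i j : ℤ) (b : Bool) : ModelVertex S :=
  if h : (i, j) ∈ S then ⟨(i, j, false), fun _ => rfl⟩ else ⟨(i, j, b), fun h' => absurd h' h⟩

/-- The two end points of a `1`-cell of the model. -/
noncomputable def modelEnd (S : Set (ℤ × ℤ)) : ModelEdge S → Bool → ModelVertex S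
  | .x i j, c => modelVertex S (if c then i else i + 1) j false
  | .y i j, c => modelVertex S i (if c then j else j + 1) true
  | .z i j _, c => modelVertex S i j (!c)

/-- The `1`-skeleton of the model; `(e, true)` is the edge `e` traversed in the positive direction. -/
noncomputable def modelGraph (S : Set (ℤ × ℤ)) : Graph.{0} where
  V := ModelVertex S
  Dart := ModelEdge S × Bool
  src := fun d => modelEnd S d.1 d.2
  rev := fun d => (d.1, !d.2)
  rev_rev := by rintro ⟨e, b⟩; simp
  rev_ne := by rintro ⟨e, b⟩; simp

open Classical in
/-- The vertical edge at `(i,j)`, traversed upwards or downwards, or nothing if it is collapsed. -/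
noncomputable def modelVertical (S : Set (ℤ × ℤ)) (i j : ℤ) (up : Bool) : List (ModelEdge S × Bool) :=
  if h : (i, j) ∈ S then [] else [(.z i j h, up)]

/-- The boundary of a `2`-cell of the model: the image under the collapse of the cycle
`(i,j,0), (i+1,j,0), (i+1,j,1), (i+1,j+1,1), (i+1,j+1,0), (i,j+1,0), (i,j+1,1), (i,j,1)`. -/
noncomputable def modelWord (S : Set (ℤ × ℤ)) (p : ℤ × ℤ) : List (ModelEdge S × Bool) :=
  [(.x p.1 p.2, true)] ++ modelVertical S (p.1 + 1) p.2 true ++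
  [(.y (p.1 + 1) p.2, true)] ++ modelVertical S (p.1 + 1) (p.2 + 1) false ++
  [(.x p.1 (p.2 + 1), false)] ++ modelVertical S p.1 (p.2 + 1) true ++
  [(.y p.1 p.2, false)] ++ modelVertical S p.1 p.2 false

theorem modelWord_length_pos (S : Set (ℤ × ℤ)) (p : ℤ × ℤ) : 0 < (modelWord S p).length := by
  simp [modelWord]

/-- The `k`-th entry of a non-empty word, the positions being counted cyclically. -/
def cyclicGet {α : Type*} (l : List α) (h : 0 < l.length) (k : ZMod l.length) : α :=
  l.get ⟨k.val, haveI : NeZero l.length := ⟨h.ne'⟩; ZMod.val_lt k⟩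

theorem cyclicGet_chain {α : Type*} (R : α → α → Prop) (l : List α) (h : 0 < l.length)
    (hR : (l ++ [l[0]]).IsChain R) (k : ZMod l.length) :
    R (cyclicGet l h k) (cyclicGet l h (k + 1)) := by
  have : NeZero l.length := ⟨h.ne'⟩
  have hk : k.val < l.length := ZMod.val_lt k
  have h1 := List.isChain_iff_getElem.1 hR k.val (by simp; omega)
  have h2 : (k + 1).val = (k.val + 1) % l.length := by
    rw [ZMod.val_add, ZMod.val_one_eq_one_mod, Nat.add_mod_mod]
  rw [List.getElem_append_left hk] at h1
  have h3 : (l ++ [l[0]])[k.val + 1]'(by simp; omega) = cyclicGet l h (k + 1) := by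
    unfold cyclicGet
    simp only [List.get_eq_getElem, h2]
    rcases Nat.lt_or_ge (k.val + 1) l.length with h4 | h4
    · rw [List.getElem_append_left h4]
      simp only [Nat.mod_eq_of_lt h4]
    · have h5 : k.val + 1 = l.length := by omega
      simp [h5]
  rw [h3] at h1
  exact h1

theorem modelWord_isChain (S : Set (ℤ × ℤ)) (p : ℤ × ℤ) :
    (modelWord S p ++ [(modelWord S p)[0]'(modelWord_length_pos S p)]).IsChain fun d d' =>
      (modelGraph S).src d' = (modelGraph S).tgt d ∧ d' ≠ (modelGraph S).rev d := by
  obtain ⟨i, j⟩ := p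
  by_cases h₁ : (i + 1, j) ∈ S <;> by_cases h₂ : (i + 1, j + 1) ∈ S <;>
    by_cases h₃ : (i, j + 1) ∈ S <;> by_cases h₄ : (i, j) ∈ S <;>
    simp [modelWord, modelVertical, modelGraph, Graph.tgt, modelEnd, modelVertex, h₁, h₂, h₃, h₄]

/-- The complex obtained from the model by collapsing the edges from `(i,j,0)` to `(i,j,1)` for
`(i,j) ∈ S`; it has one `2`-cell for each `(i,j)`. -/
noncomputable def modelPlane (S : Set (ℤ × ℤ)) : TwoComplex.{0} where
  toGraph := modelGraph S
  Face := ℤ × ℤ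
  len := fun p => (modelWord S p).length
  len_pos := modelWord_length_pos S
  side := fun p k => cyclicGet (modelWord S p) (modelWord_length_pos S p) k
  side_chain := fun p k =>
    (cyclicGet_chain _ _ (modelWord_length_pos S p) (modelWord_isChain S p) k).1
  side_immersed := fun p k =>
    (cyclicGet_chain _ _ (modelWord_length_pos S p) (modelWord_isChain S p) k).2

/-! ### Quasi-flats and flats -/

/-- A quasi-flat plane: a `C(4)`--`T(4)` complex homeomorphic to one of the model planes. -/
def IsQuasiFlatPlane (X : TwoComplex.{u}) : Prop :=
  X.IsC 4 ∧ X.IsT 4 ∧ ∃ S : Set (ℤ × ℤ), Nonempty (X.Realization ≃ₜ (modelPlane S).Realization)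

/-- A subcomplex of `X` is a quasi-flat if it is a quasi-flat plane and the gallery distances of its
`2`-cells in it are the same as in `X`. -/
def IsQuasiFlat (X : TwoComplex.{u}) (E : X.Subcomplex) : Prop :=
  IsQuasiFlatPlane E.cx ∧ ∀ f g : E.faces, E.cx.galleryDist f g = X.galleryDist f g

/-- The quadrization: the bipartite graph on the `0`-cells and `2`-cells of `X`, where `a` and `f`
are adjacent if `a` lies on the boundary of `f`. -/
def quadrization (X : TwoComplex.{u}) : SimpleGraph (X.V ⊕ X.Face) where
  Adj
    | .inl a, .inr f => X.OnBoundary a f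
    | .inr f, .inl a => X.OnBoundary a f
    | _, _ => False
  symm := ⟨by rintro (a | f) (b | g) h <;> exact h⟩
  loopless := ⟨by rintro (a | f) h <;> exact h⟩

/-- The `1`-skeleton of the tiling of the Euclidean plane by unit squares. -/
noncomputable def squareGrid : SimpleGraph (ℤ × ℤ) :=
  SimpleGraph.hasse ℤ □ SimpleGraph.hasse ℤ

/-- A flat in (the `1`-skeleton of) a square complex: an isometric embedding of the grid. -/
def IsFlat {W : Type u} (Y : SimpleGraph W) (e : ℤ × ℤ → W) : Prop :=
  ∀ p q, Y.edist (e p) (e q) = squareGrid.edist p q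

/-- The subcomplex of `X` that consists of the closed `2`-cells corresponding to vertices of a flat
in the quadrization. -/
def flatSubcomplex (X : TwoComplex.{u}) (e : ℤ × ℤ → X.V ⊕ X.Face) : X.Subcomplex :=
  X.cellUnion {f | Sum.inr f ∈ Set.range e}

end SmallCancellation

/-! The proof replaces disc diagrams by normal forms of words. The edges of the quadrization are
refined to the corners of the `2`-cells. Oriented corners are letters, and a common boundary path of
two `2`-cells between two vertices (`Matches`) is a square, that is, a relation between two words of
length two. `C(4)` allows squares with two consecutive sides in common to be composed. `C(4)`,
together with the consequence of `T(4)` that no three `2`-cells meet pairwise along edges around a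
vertex (`noTriangle`), gives the alternatives for three squares around a common point
(`Matches.wheel_face`, `Matches.wheel_vertex`). For any `SquareSystem` this solves the word problem:
equivalent reduced words can be matched at their last letters by at most one square
(`joined_of_eqv`), and words act on classes of reduced words so that the two halves of a square act
alike (`step_sq`).

If `X` is simply connected, every closed edge path acts trivially. A closed path on one or two
boundaries is a word of two or four letters, so it must be a backtrack or come from a square. Hence
(`isThin`) a `2`-cell passes through a vertex at most once, and two `2`-cells with two common
vertices share a boundary path between them.

Turned by 45 degrees, the flat is an array of `2`-cells `F m n` whose four grid vertices are the `v`
at the corners of the unit square `(m, n)`. The isometry shows that cells can meet only if their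
indices differ by at most one in each coordinate. Neighbouring cells share a side, and the four
sides make up the boundary of a cell (`quadrilateral`), which gives a `FlatSystem`. The two
horizontal sides at a vertex may run together for a while on one side of it, the two vertical ones
on the other; this overlap lies on all four cells and is the model edge `{(i, j)} × [0, 1]`,
collapsed if it is trivial. On the line of the cell `(m, n)` the times `-L`, `-lam`, `mu`, `R`
delimit the three model edges based at `(m, n)`. That cell is the last one, in both coordinates,
containing any vertex strictly between `-L` and `R` (`le_of_onBoundary`), so there are no further
identifications. Thus the union of the cells is a subdivision of a model plane and is homeomorphic
to it (`nonempty_homeomorph`).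

`C(4)` and `T(4)` pass to subcomplexes. Both gallery distances are the king's distance between the
indices plus one: a king's walk gives a chain inside the flat, and the isometry bounds the length of
every chain in `X` from below. -/

namespace SmallCancellation

/-! ### Square systems and the word problem -/

/-- An alphabet `E` with formal inverses, and a relation `sq a b c d` which says that the words `ab`
and `cd` are the two halves of the boundary of a square.  Two squares that have two consecutive
sides in common can be composed, and the hexagon formed by three squares around a common corner has
a diagonal. -/
structure SquareSystem (E : Type*) where
  inv : E → E
  inv_inv : ∀ a, inv (inv a) = a
  sq : E → E → E → E → Prop
  symm : ∀ {a b c d}, sq a b c d → sq c d a b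
  trans : ∀ {a b c d e f}, sq a b c d → sq c d e f → sq a b e f
  rot : ∀ {a b c d}, sq a b c d → sq (inv a) c b (inv d)
  backtrack : ∀ {a c d}, sq a (inv a) c d → d = inv c
  wheel : ∀ {a b c d e f g c' d'}, sq c a d b → sq f d g c' → sq c' b d' e →
    (∃ z, sq f d z (inv b)) ∨ (∃ z, sq z a c' b ∧ sq f c g z) ∨ (∃ z, sq z e d b ∧ sq g d' f z)

namespace SquareSystem

variable {E : Type*} (Q : SquareSystem E)

/-- Replacing one half of the boundary of a square in a word by the other one.  Words are written
with their last letter first. -/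
inductive Flip : List E → List E → Prop
  | head {a b c d : E} (p : List E) : Q.sq a b c d → Flip (b :: a :: p) (d :: c :: p)
  | cons (a : E) {p q : List E} : Flip p q → Flip (a :: p) (a :: q)

/-- Words that are related by a sequence of flips. -/
def Eqv : List E → List E → Prop := Relation.ReflTransGen Q.Flip

variable {Q}

theorem Flip.symm {p q : List E} (h : Q.Flip p q) : Q.Flip q p := by
  induction h with
  | head p h => exact .head p (Q.symm h)
  | cons a _ ih => exact .cons a ih

theorem Flip.length_eq {p q : List E} (h : Q.Flip p q) : p.length = q.length := by
  induction h with
  | head p h => simp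
  | cons a _ ih => simp [ih]

theorem Eqv.refl (p : List E) : Q.Eqv p p := Relation.ReflTransGen.refl

theorem Eqv.symm {p q : List E} (h : Q.Eqv p q) : Q.Eqv q p :=
  have : Std.Symm Q.Flip := ⟨fun _ _ => Flip.symm⟩
  Relation.ReflTransGen.stdSymm.symm _ _ h

theorem Eqv.trans {p q r : List E} (h : Q.Eqv p q) (h' : Q.Eqv q r) : Q.Eqv p r :=
  Relation.ReflTransGen.trans h h'

theorem Flip.eqv {p q : List E} (h : Q.Flip p q) : Q.Eqv p q := Relation.ReflTransGen.single h

theorem Eqv.length_eq {p q : List E} (h : Q.Eqv p q) : p.length = q.length := by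
  induction h with
  | refl => rfl
  | tail _ h ih => exact ih.trans h.length_eq

theorem Eqv.cons (a : E) {p q : List E} (h : Q.Eqv p q) : Q.Eqv (a :: p) (a :: q) := by
  induction h with
  | refl => exact .refl _
  | tail _ h ih => exact ih.trans (Flip.cons a h).eqv

theorem Eqv.flip {a b c d : E} (h : Q.sq a b c d) {p q : List E} (hp : Q.Eqv p (a :: q)) :
    Q.Eqv (b :: p) (d :: c :: q) :=
  (hp.cons b).trans (Flip.head q h).eqv

variable (Q)

/-- A word is reduced if no sequence of flips produces a subword `a a⁻¹`. -/
def Reduced (p : List E) : Prop :=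
  ∀ q, Q.Eqv p q → q.IsChain fun b a => b ≠ Q.inv a

variable {Q}

theorem Reduced.eqv {p q : List E} (hp : Q.Reduced p) (h : Q.Eqv p q) : Q.Reduced q :=
  fun r hr => hp r (h.trans hr)

theorem Reduced.tail {a : E} {p : List E} (hp : Q.Reduced (a :: p)) : Q.Reduced p :=
  fun _ hq => (hp _ (hq.cons a)).tail

theorem Reduced.ne {a b : E} {p q : List E} (hp : Q.Reduced p) (h : Q.Eqv p (b :: a :: q)) :
    b ≠ Q.inv a :=
  (List.isChain_cons_cons.1 (hp _ h)).1

theorem eqv_nil {p : List E} (h : Q.Eqv [] p) : p = [] :=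
  List.length_eq_zero_iff.1 h.length_eq.symm

theorem reduced_nil : Q.Reduced [] := by
  intro q hq
  rw [eqv_nil hq]
  exact .nil

variable (Q)

/-- The two ways in which the last letters of equivalent reduced words can be related. -/
def Joined (p : List E) (a : E) (q : List E) (b : E) : Prop :=
  (a = b ∧ Q.Eqv p q) ∨ ∃ r c d, Q.Eqv p (c :: r) ∧ Q.Eqv q (d :: r) ∧ Q.sq c a d b

variable {Q}

theorem backtrack' {a c d : E} (h : Q.sq (Q.inv a) a c d) : d = Q.inv c := by
  refine Q.backtrack (a := Q.inv a) ?_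
  rwa [Q.inv_inv]

/-- Many flips may change the last letter, but `Joined` is transitive on reduced words, so one
square suffices. Transitivity compares the two endings of the middle prefix by induction on the
length and merges the resulting three squares with `wheel`. -/
theorem joined_of_eqv (n : ℕ) : ∀ {p q : List E} {a b : E}, p.length = n → Q.Reduced (a :: p) →
    Q.Eqv (a :: p) (b :: q) → Q.Joined p a q b := by
  induction n using Nat.strong_induction_on with
  | _ n ih =>
  have trans : ∀ {p q s : List E} {a b e : E}, q.length = n → Q.Reduced (b :: q) →
      Q.Joined p a q b → Q.Joined q b s e → Q.Joined p a s e := by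
    rintro p q s a b e hn hq (⟨rfl, h₁⟩ | ⟨r, c, d, h₁, h₂, h₃⟩) (⟨rfl, k₁⟩ | ⟨r', c', d', k₁, k₂, k₃⟩)
    · exact .inl ⟨rfl, h₁.trans k₁⟩
    · exact .inr ⟨r', c', d', h₁.trans k₁, k₂, k₃⟩
    · exact .inr ⟨r, c, d, h₁, k₁.symm.trans h₂, h₃⟩
    · have hr : r.length < n := by
        have := h₂.length_eq
        simp only [List.length_cons] at this
        omega
      rcases ih _ hr rfl (hq.tail.eqv h₂) (h₂.symm.trans k₁) with
        ⟨rfl, hrr⟩ | ⟨t, f, g, l₁, l₂, l₃⟩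
      · exact .inr ⟨r, c, d', h₁, k₂.trans (hrr.symm.cons d'), Q.trans h₃ k₃⟩
      -- The middle prefix `q` ends both in `d` and in `c'`, and the square relating these endings
      -- completes a wheel. The first alternative would make `q` end in the inverse of `b`, against
      -- reducedness; each of the other two leaves a single square.
      · rcases Q.wheel h₃ l₃ k₃ with ⟨z, hz⟩ | ⟨z, hz, hz'⟩ | ⟨z, hz, hz'⟩
        · exfalso
          have : Q.Eqv q (Q.inv b :: z :: t) :=
            h₂.trans (Eqv.flip hz l₁)
          refine hq.ne (this.cons b) ?_
          rw [Q.inv_inv]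
        · exact .inr ⟨r', z, d', h₁.trans ((Eqv.flip hz' l₁).trans (l₂.symm.cons z)), k₂,
            Q.trans hz k₃⟩
        · exact .inr ⟨r, c, z, h₁, k₂.trans ((Eqv.flip hz' l₂).trans (l₁.symm.cons z)),
            Q.trans h₃ (Q.symm hz)⟩
  intro p q a b hn hp h
  have key : ∀ w, Q.Eqv (a :: p) w → ∀ b q, w = b :: q → Q.Joined p a q b := by
    intro w hw
    induction hw with
    | refl =>
      rintro b q h
      cases h
      exact .inl ⟨rfl, .refl _⟩
    | @tail m w hm hf ih' =>
      rintro b q rfl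
      have hl := Eqv.length_eq hm
      obtain _ | ⟨b', q'⟩ := m
      · simp at hl
      · have hj := ih' b' q' rfl
        have hlen : q'.length = n := by
          simp only [List.length_cons] at hl
          omega
        refine trans hlen (hp.eqv hm) hj ?_
        cases hf with
        | head r hs => exact .inr ⟨r, _, _, .refl _, .refl _, hs⟩
        | cons _ hf => exact .inl ⟨rfl, hf.eqv⟩
  exact key _ h b q rfl

theorem Reduced.joined {p q : List E} {a b : E} (hp : Q.Reduced (a :: p))
    (h : Q.Eqv (a :: p) (b :: q)) : Q.Joined p a q b :=
  joined_of_eqv _ rfl hp h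

/-- The invariant under flips is that the prefix is reduced and is not equivalent to a word ending
in the inverse of the last letter. If a flip changes the last two letters, the new prefix is a
letter appended to a shorter word, and induction applies. -/
theorem reduced_cons_aux (n : ℕ) : ∀ {p : List E} {a : E}, p.length = n → Q.Reduced p →
    (∀ q, ¬ Q.Eqv p (Q.inv a :: q)) → Q.Reduced (a :: p) := by
  induction n using Nat.strong_induction_on with
  | _ n ih =>
  intro p a hn hp ha
  have step : ∀ {a p b q}, p.length = n → Q.Reduced p → (∀ q, ¬ Q.Eqv p (Q.inv a :: q)) →
      Q.Flip (a :: p) (b :: q) → Q.Reduced q ∧ (∀ r, ¬ Q.Eqv q (Q.inv b :: r)) := by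
    intro a p b q hn hp ha hf
    cases hf with
    | cons _ hf => exact ⟨hp.eqv hf.eqv, fun r hr => ha r (hf.eqv.trans hr)⟩
    | @head c _ d _ r hs =>
      have hr : Q.Reduced (d :: r) := by
        refine ih r.length ?_ rfl hp.tail ?_
        · simp only [List.length_cons] at hn
          omega
        · intro r' hr'
          exact ha _ (Eqv.flip (Q.rot (Q.symm hs)) hr')
      refine ⟨hr, fun q' hq' => ?_⟩
      rcases hr.joined hq' with ⟨rfl, -⟩ | ⟨t, f, z, h₁, -, h₃⟩
      · refine ha r ?_
        rw [backtrack' (Q.symm hs), Q.inv_inv]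
        exact .refl _
      -- The square that would produce the inverse of `b`, composed with the flipped one, would
      -- already produce the inverse of `a` at the end of `p`.
      · have h₄ := Q.rot h₃
        rw [Q.inv_inv] at h₄
        have h₅ := Q.rot (Q.trans h₄ (Q.symm hs))
        rw [Q.inv_inv] at h₅
        exact ha _ (Eqv.flip h₅ h₁)
  have key : ∀ w, Q.Eqv (a :: p) w → ∀ b q, w = b :: q →
      Q.Reduced q ∧ (∀ r, ¬ Q.Eqv q (Q.inv b :: r)) := by
    intro w hw
    induction hw with
    | refl =>
      rintro b q h
      cases h
      exact ⟨hp, ha⟩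
    | @tail m w hm hf ih' =>
      rintro b q rfl
      have hl := Eqv.length_eq hm
      obtain _ | ⟨b', q'⟩ := m
      · simp at hl
      · obtain ⟨h₁, h₂⟩ := ih' b' q' rfl
        refine step ?_ h₁ h₂ hf
        simp only [List.length_cons] at hl
        omega
  intro q hq
  obtain _ | ⟨b, q⟩ := q
  · exact .nil
  · obtain ⟨h₁, h₂⟩ := key _ hq b q rfl
    obtain _ | ⟨c, q⟩ := q
    · simp
    · refine List.isChain_cons_cons.2 ⟨fun hb => ?_, h₁ _ (.refl _)⟩
      refine h₂ q ?_
      rw [hb, Q.inv_inv]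
      exact .refl _

theorem Reduced.cons {p : List E} {a : E} (hp : Q.Reduced p)
    (ha : ∀ q, ¬ Q.Eqv p (Q.inv a :: q)) : Q.Reduced (a :: p) :=
  reduced_cons_aux _ rfl hp ha

/-! ### The action of words on reduced words -/

variable (Q)

open Classical in
/-- Appending a letter to a reduced word, with cancellation if possible. -/
noncomputable def step (a : E) (p : List E) : List E :=
  if h : ∃ q, Q.Eqv p (Q.inv a :: q) then h.choose else a :: p

variable {Q}

/-- Rotating the square turns its two equal sides into a backtrack. -/
theorem sq_left_cancel {a b d : E} (h : Q.sq a b a d) : b = d := by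
  have h₁ := Q.rot h
  have h₂ : Q.sq (Q.inv a) (Q.inv (Q.inv a)) b (Q.inv d) := by rwa [Q.inv_inv]
  have h₃ := Q.backtrack h₂
  rw [← Q.inv_inv d, h₃, Q.inv_inv]

theorem sq_inv {a b c d : E} (h : Q.sq a b c d) :
    Q.sq (Q.inv b) (Q.inv a) (Q.inv d) (Q.inv c) :=
  Q.rot (Q.symm (Q.rot h))

theorem sq_right_cancel {a b c : E} (h : Q.sq a b c b) : a = c := by
  have := sq_left_cancel (sq_inv h)
  rw [← Q.inv_inv a, this, Q.inv_inv]

/-- Right cancellation makes `step` independent, up to flips, of the remainder chosen when a letter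
cancels. -/
theorem Reduced.tail_eqv {a : E} {p q : List E} (hp : Q.Reduced (a :: p))
    (h : Q.Eqv (a :: p) (a :: q)) : Q.Eqv p q := by
  rcases hp.joined h with ⟨-, h⟩ | ⟨r, c, d, h₁, h₂, h₃⟩
  · exact h
  · rw [sq_right_cancel h₃] at h₁
    exact h₁.trans h₂.symm

theorem step_of_eqv {a : E} {p q : List E} (hp : Q.Reduced p) (h : Q.Eqv p (Q.inv a :: q)) :
    Q.Eqv (Q.step a p) q := by
  have hex : ∃ q, Q.Eqv p (Q.inv a :: q) := ⟨q, h⟩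
  rw [step, dif_pos hex]
  have h' := hex.choose_spec
  exact (hp.eqv h').tail_eqv (h'.symm.trans h)

theorem step_of_reduced {a : E} {p : List E} (hp : Q.Reduced (a :: p)) : Q.step a p = a :: p := by
  rw [step, dif_neg]
  rintro ⟨q, hq⟩
  exact hp.ne (hq.cons a) (Q.inv_inv a).symm

theorem step_cases (a : E) {p : List E} (hp : Q.Reduced p) :
    (∃ q, Q.Eqv p (Q.inv a :: q) ∧ Q.Eqv (Q.step a p) q) ∨
      (Q.Reduced (a :: p) ∧ Q.step a p = a :: p) := by
  by_cases h : ∃ q, Q.Eqv p (Q.inv a :: q)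
  · obtain ⟨q, hq⟩ := h
    exact .inl ⟨q, hq, step_of_eqv hp hq⟩
  · have := hp.cons (fun q hq => h ⟨q, hq⟩)
    exact .inr ⟨this, step_of_reduced this⟩

theorem Reduced.step (a : E) {p : List E} (hp : Q.Reduced p) : Q.Reduced (Q.step a p) := by
  rcases step_cases a hp with ⟨q, hq, hq'⟩ | ⟨h, h'⟩
  · exact (hp.eqv hq).tail.eqv hq'.symm
  · rwa [h']

theorem step_congr (a : E) {p p' : List E} (hp : Q.Reduced p) (h : Q.Eqv p p') :
    Q.Eqv (Q.step a p) (Q.step a p') := by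
  rcases step_cases a hp with ⟨q, hq, hq'⟩ | ⟨h₁, h₂⟩
  · exact hq'.trans (step_of_eqv (hp.eqv h) (h.symm.trans hq)).symm
  · rw [h₂, step_of_reduced (h₁.eqv (h.cons a))]
    exact h.cons a

theorem step_inv_step (a : E) {p : List E} (hp : Q.Reduced p) :
    Q.Eqv (Q.step (Q.inv a) (Q.step a p)) p := by
  rcases step_cases a hp with ⟨q, hq, hq'⟩ | ⟨h₁, h₂⟩
  · refine (step_congr _ (hp.step a) hq').trans ?_
    rw [step_of_reduced (hp.eqv hq)]
    exact hq.symm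
  · rw [h₂]
    refine step_of_eqv h₁ ?_
    rw [Q.inv_inv]
    exact .refl _

/-- The case of `step_sq` in which neither first letter cancels. If `b` cancels, the square at the
end of the word composes with the given one and shows that `d` cancels with the same remainder. -/
theorem step_sq_of_reduced {a b c d : E} {p : List E} (hs : Q.sq a b c d)
    (ha : Q.Reduced (a :: p)) (hc : Q.Reduced (c :: p)) :
    Q.Eqv (Q.step b (a :: p)) (Q.step d (c :: p)) := by
  rcases step_cases b ha with ⟨m, hm, hm'⟩ | ⟨h₁, h₂⟩
  · refine hm'.trans (Eqv.symm (step_of_eqv hc ?_))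
    rcases ha.joined hm with ⟨rfl, h⟩ | ⟨l, g, h, h₁, h₂, h₃⟩
    · rw [backtrack' hs, Q.inv_inv]
      exact h.cons c
    · have : Q.sq (Q.inv g) h c d := by
        have := Q.rot h₃
        rw [Q.inv_inv] at this
        exact Q.trans this hs
      have := Q.rot this
      rw [Q.inv_inv] at this
      exact (Eqv.flip this h₁).trans (h₂.symm.cons _)
  · rw [h₂, step_of_reduced (h₁.eqv (Flip.head p hs).eqv)]
    exact (Flip.head p hs).eqv

/-- The two halves of the boundary of a square act in the same way. -/
theorem step_sq {a b c d : E} {p : List E} (hs : Q.sq a b c d) (hp : Q.Reduced p) :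
    Q.Eqv (Q.step b (Q.step a p)) (Q.step d (Q.step c p)) := by
  -- Here `a` cancels and `c` does not. In the usual order of letters, `p c` is `q a⁻¹ c`, which
  -- flips to `q b d⁻¹`; hence `d` cancels and leaves `q b`.
  have mixed : ∀ {a b c d : E} {p q : List E}, Q.sq a b c d → Q.Reduced p →
      Q.Eqv p (Q.inv a :: q) → Q.Reduced (c :: p) →
      Q.Eqv (Q.step b q) (Q.step d (c :: p)) := by
    intro a b c d p q hs hp hq hc
    have h₁ : Q.Eqv (c :: p) (Q.inv d :: b :: q) := Eqv.flip (Q.rot hs) hq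
    have h₂ := (hc.eqv h₁).tail
    rw [step_of_reduced h₂]
    exact (step_of_eqv hc h₁).symm
  rcases step_cases a hp with ⟨q, hq, hq'⟩ | ⟨h₁, h₂⟩
  · refine (step_congr b (hp.step a) hq').trans ?_
    rcases step_cases c hp with ⟨q', hr, hr'⟩ | ⟨h₃, h₄⟩
    · refine Eqv.trans ?_ (step_congr d (hp.step c) hr').symm
      have hqr := hq.symm.trans hr
      have hred := hp.eqv hq
      rcases hred.joined hqr with ⟨h, h'⟩ | ⟨r, s, t, h₁, h₂, h₃⟩
      · have hac : a = c := by rw [← Q.inv_inv a, h, Q.inv_inv]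
        subst hac
        rw [sq_left_cancel hs]
        exact step_congr d hred.tail h'
      -- Both first letters cancel. The square relating the two endings of `p` composes with the
      -- given square to one over the shorter word `r`, where nothing cancels at the first letter.
      · have h₄ : Q.sq (Q.inv s) t b (Q.inv d) := by
          have := Q.rot h₃
          rw [Q.inv_inv] at this
          exact Q.trans this (Q.rot hs)
        have h₅ := Q.rot h₄
        rw [Q.inv_inv, Q.inv_inv] at h₅
        exact (step_congr b hred.tail h₁).trans ((step_sq_of_reduced h₅ (hred.tail.eqv h₁)
          ((hp.eqv hr).tail.eqv h₂)).trans (step_congr d (hp.eqv hr).tail h₂).symm)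
    · rw [h₄]
      exact mixed hs hp hq h₃
  · rw [h₂]
    rcases step_cases c hp with ⟨q', hr, hr'⟩ | ⟨h₃, h₄⟩
    · exact (mixed (Q.symm hs) hp hr h₁).symm.trans (step_congr d (hp.step c) hr').symm
    · rw [h₄]
      exact step_sq_of_reduced hs h₁ h₃

variable (Q)

/-- The action of a word, written with its first letter first. -/
noncomputable def act (w : List E) (p : List E) : List E := w.foldl (fun p a => Q.step a p) p

variable {Q}

@[simp] theorem act_nil (p : List E) : Q.act [] p = p := rfl

@[simp] theorem act_cons (a : E) (w p : List E) : Q.act (a :: w) p = Q.act w (Q.step a p) := rfl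

theorem act_append (w w' p : List E) : Q.act (w ++ w') p = Q.act w' (Q.act w p) :=
  List.foldl_append

theorem Reduced.act (w : List E) {p : List E} (hp : Q.Reduced p) : Q.Reduced (Q.act w p) := by
  induction w generalizing p with
  | nil => exact hp
  | cons a w ih => exact ih (hp.step a)

theorem act_congr (w : List E) {p p' : List E} (hp : Q.Reduced p) (h : Q.Eqv p p') :
    Q.Eqv (Q.act w p) (Q.act w p') := by
  induction w generalizing p p' with
  | nil => exact h
  | cons a w ih => exact ih (hp.step a) (step_congr a hp h)

variable (Q)

/-- Words that act in the same way on equivalence classes of reduced words. -/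
def SameAct (w w' : List E) : Prop := ∀ p, Q.Reduced p → Q.Eqv (Q.act w p) (Q.act w' p)

variable {Q}

theorem SameAct.refl (w : List E) : Q.SameAct w w := fun _ _ => .refl _

theorem SameAct.symm {w w' : List E} (h : Q.SameAct w w') : Q.SameAct w' w :=
  fun p hp => (h p hp).symm

theorem SameAct.trans {w w' w'' : List E} (h : Q.SameAct w w') (h' : Q.SameAct w' w'') :
    Q.SameAct w w'' :=
  fun p hp => (h p hp).trans (h' p hp)

theorem SameAct.append {w₁ w₁' w₂ w₂' : List E} (h₁ : Q.SameAct w₁ w₁') (h₂ : Q.SameAct w₂ w₂') :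
    Q.SameAct (w₁ ++ w₂) (w₁' ++ w₂') := by
  intro p hp
  rw [act_append, act_append]
  exact (act_congr w₂ (hp.act w₁) (h₁ p hp)).trans (h₂ _ (hp.act w₁'))

theorem sameAct_backtrack (a : E) : Q.SameAct [a, Q.inv a] [] :=
  fun _ hp => step_inv_step a hp

theorem sameAct_sq {a b c d : E} (h : Q.sq a b c d) : Q.SameAct [a, b] [c, d] :=
  fun _ hp => step_sq h hp

theorem reduced_singleton (a : E) : Q.Reduced [a] :=
  reduced_nil.cons fun q hq => by simpa using hq.length_eq

theorem reduced_pair {a b : E} (h : b ≠ Q.inv a) : Q.Reduced [b, a] := by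
  refine (reduced_singleton a).cons fun q hq => ?_
  have hq' : q = [] := by simpa using hq.length_eq
  subst hq'
  rcases (reduced_singleton a).joined hq with ⟨h', -⟩ | ⟨r, c, d, h', -⟩
  · exact h (by rw [h', Q.inv_inv])
  · simpa using h'.length_eq

theorem act_pair {a b : E} (h : b ≠ Q.inv a) : Q.act [a, b] [] = [b, a] := by
  rw [act_cons, act_cons, act_nil, step_of_reduced (reduced_singleton a),
    step_of_reduced (reduced_pair h)]

/-- A two-letter word that acts trivially is a backtrack. -/
theorem eq_inv_of_sameAct_nil {a b : E} (h : Q.SameAct [a, b] []) : b = Q.inv a := by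
  by_contra hne
  have := h [] reduced_nil
  rw [act_pair hne] at this
  simpa using this.length_eq

/-- Two-letter words that are not backtracks and act in the same way bound a square. -/
theorem sq_of_sameAct {a b c d : E} (hab : b ≠ Q.inv a) (hcd : d ≠ Q.inv c)
    (h : Q.SameAct [a, b] [c, d]) : Q.sq a b c d ∨ (a = c ∧ b = d) := by
  -- On the empty word, equality of actions becomes equivalence of two reduced words, to which
  -- `Reduced.joined` applies.
  have := h [] reduced_nil
  rw [act_pair hab, act_pair hcd] at this
  rcases (reduced_pair hab).joined this with ⟨rfl, h'⟩ | ⟨r, a', c', h₁, h₂, h₃⟩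
  · rcases (reduced_singleton a).joined h' with ⟨rfl, -⟩ | ⟨r, a', c', h₁, -⟩
    · exact .inr ⟨rfl, rfl⟩
    · simpa using h₁.length_eq
  · have hr : r = [] := by simpa using h₁.length_eq.symm
    subst hr
    have aux : ∀ {x y : E}, Q.Eqv [x] [y] → x = y := by
      intro x y hxy
      rcases (reduced_singleton x).joined hxy with ⟨rfl, -⟩ | ⟨r, a', c', h₁, -⟩
      · rfl
      · simpa using h₁.length_eq
    rw [aux h₁, aux h₂]
    exact .inl h₃

end SquareSystem
end SmallCancellation

namespace SmallCancellation

namespace TwoComplex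

/-! ### Flags: boundary paths as bi-infinite lines -/

/-- A `2`-cell with a corner (recorded by an integer, which matters only modulo the number of sides)
and a direction of travel along the boundary. -/
structure Flag (X : TwoComplex.{u}) where
  face : X.Face
  pos : ℤ
  dir : Bool

variable {X : TwoComplex.{u}}

namespace Flag

/-- The number of sides of the `2`-cell. -/
def len (x : X.Flag) : ℕ := X.len x.face

/-- Moving the corner along the boundary. -/
def shift (x : X.Flag) (t : ℤ) : X.Flag := ⟨x.face, if x.dir then x.pos + t else x.pos - t, x.dir⟩

/-- Changing the direction of travel. -/
def rev (x : X.Flag) : X.Flag := ⟨x.face, x.pos, !x.dir⟩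

/-- The dart of the polygon that is traversed at time `t`. -/
def polyDart (x : X.Flag) (t : ℤ) : (polygon (X.len x.face)).Dart :=
  match x with
  | ⟨f, i, true⟩ => (((i + t : ℤ) : ZMod (X.len f)), true)
  -- Going backwards from the vertex `i`, the first side to be traversed is the side `i - 1`.
  | ⟨f, i, false⟩ => (((i - 1 - t : ℤ) : ZMod (X.len f)), false)

/-- The dart of the complex that is traversed at time `t`. -/
def line (x : X.Flag) (t : ℤ) : X.Dart := X.attach x.face (x.polyDart t)

/-- The corner of a flag, without the direction. -/
def corner (x : X.Flag) : X.Face × ℤ := (x.face, x.pos % x.len)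

/-- The vertex of a flag. -/
def vert (x : X.Flag) : X.V := X.src (x.line 0)

theorem len_pos (x : X.Flag) : 0 < x.len := X.len_pos x.face

theorem len_pos' (x : X.Flag) : (0 : ℤ) < x.len := by exact_mod_cast x.len_pos

@[simp] theorem face_shift (x : X.Flag) (t : ℤ) : (x.shift t).face = x.face := rfl
@[simp] theorem face_rev (x : X.Flag) : x.rev.face = x.face := rfl
@[simp] theorem len_shift (x : X.Flag) (t : ℤ) : (x.shift t).len = x.len := rfl
@[simp] theorem len_rev (x : X.Flag) : x.rev.len = x.len := rfl

theorem polyDart_true (f : X.Face) (i t j : ℤ) (h : i + t = j) :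
    (⟨f, i, true⟩ : X.Flag).polyDart t = ((j : ZMod (X.len f)), true) :=
  congrArg (fun z : ℤ => ((z : ZMod (X.len f)), true)) h

theorem polyDart_false (f : X.Face) (i t j : ℤ) (h : i - 1 - t = j) :
    (⟨f, i, false⟩ : X.Flag).polyDart t = ((j : ZMod (X.len f)), false) :=
  congrArg (fun z : ℤ => ((z : ZMod (X.len f)), false)) h

theorem line_true (f : X.Face) (i t j : ℤ) (h : i + t = j) :
    (⟨f, i, true⟩ : X.Flag).line t = X.side f (j : ZMod (X.len f)) := by
  rw [line, polyDart_true f i t j h]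
  simp [attach]

theorem line_false (f : X.Face) (i t j : ℤ) (h : i - 1 - t = j) :
    (⟨f, i, false⟩ : X.Flag).line t = X.rev (X.side f (j : ZMod (X.len f))) := by
  rw [line, polyDart_false f i t j h]
  simp [attach]

theorem ext_pos {f : X.Face} {i j : ℤ} {b c : Bool} (h : i = j) (h' : b = c) :
    (⟨f, i, b⟩ : X.Flag) = ⟨f, j, c⟩ := by
  rw [h, h']

@[simp] theorem rev_rev (x : X.Flag) : x.rev.rev = x := by
  cases x
  simp [rev]

@[simp] theorem shift_zero (x : X.Flag) : x.shift 0 = x := by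
  obtain ⟨f, i, b⟩ := x
  cases b <;> simp [shift]

@[simp] theorem shift_shift (x : X.Flag) (s t : ℤ) : (x.shift s).shift t = x.shift (s + t) := by
  obtain ⟨f, i, b⟩ := x
  cases b
  · exact ext_pos (show i - s - t = i - (s + t) by ring) rfl
  · exact ext_pos (show i + s + t = i + (s + t) by ring) rfl

theorem rev_shift (x : X.Flag) (t : ℤ) : (x.shift t).rev = x.rev.shift (-t) := by
  obtain ⟨f, i, b⟩ := x
  cases b
  · exact ext_pos (show i - t = i + -t by ring) rfl
  · exact ext_pos (show i + t = i - -t by ring) rfl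

theorem polyDart_shift (x : X.Flag) (s t : ℤ) : (x.shift s).polyDart t = x.polyDart (s + t) := by
  obtain ⟨f, i, b⟩ := x
  cases b
  · exact (polyDart_false f (i - s) t (i - 1 - (s + t)) (by ring)).trans
      (polyDart_false f i _ _ rfl).symm
  · exact (polyDart_true f (i + s) t (i + (s + t)) (by ring)).trans
      (polyDart_true f i _ _ rfl).symm

theorem line_shift (x : X.Flag) (s t : ℤ) : (x.shift s).line t = x.line (s + t) :=
  congrArg (X.attach x.face) (x.polyDart_shift s t)

theorem polyDart_rev (x : X.Flag) (t : ℤ) :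
    x.rev.polyDart t = (polygon (X.len x.face)).rev (x.polyDart (-1 - t)) := by
  obtain ⟨f, i, b⟩ := x
  cases b
  · rw [polyDart_false f i (-1 - t) (i + t) (by ring)]
    exact polyDart_true f i t (i + t) rfl
  · rw [polyDart_true f i (-1 - t) (i - 1 - t) (by ring)]
    exact polyDart_false f i t _ rfl

theorem _root_.SmallCancellation.TwoComplex.attach_rev (f : X.Face)
    (s : (polygon (X.len f)).Dart) :
    X.attach f ((polygon (X.len f)).rev s) = X.rev (X.attach f s) := by
  obtain ⟨k, b⟩ := s
  cases b <;> simp [attach, polygon, X.rev_rev]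

/-- The reversed flag moves from time `-t` to time `-t - 1` of the original line, hence along the
dart of index `-1 - t`. -/
theorem line_rev (x : X.Flag) (t : ℤ) : x.rev.line t = X.rev (x.line (-1 - t)) := by
  rw [line, polyDart_rev]
  exact X.attach_rev _ _

theorem polyDart_add_len (x : X.Flag) (t : ℤ) : x.polyDart (t + x.len) = x.polyDart t := by
  obtain ⟨f, i, b⟩ := x
  cases b
  · rw [polyDart_false f i _ _ rfl, polyDart_false f i _ _ rfl]
    exact congrArg (fun z : ZMod (X.len f) => (z, false)) (by simp [len])
  · rw [polyDart_true f i _ _ rfl, polyDart_true f i _ _ rfl]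
    exact congrArg (fun z : ZMod (X.len f) => (z, true)) (by simp [len])

theorem line_add_len (x : X.Flag) (t : ℤ) : x.line (t + x.len) = x.line t :=
  congrArg (X.attach x.face) (x.polyDart_add_len t)

theorem line_add_mul_len (x : X.Flag) (t k : ℤ) : x.line (t + k * x.len) = x.line t := by
  have hp : Function.Periodic x.line (x.len : ℤ) := x.line_add_len
  simpa [mul_comm] using hp.int_mul k t

theorem line_congr (x : X.Flag) {s t : ℤ} (h : (x.len : ℤ) ∣ t - s) : x.line t = x.line s := by
  obtain ⟨k, hk⟩ := h
  rw [show t = s + k * x.len by linarith]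
  exact x.line_add_mul_len s k

@[simp] theorem corner_rev (x : X.Flag) : x.rev.corner = x.corner := rfl

theorem corner_shift_eq_iff (x : X.Flag) {s t : ℤ} :
    (x.shift s).corner = (x.shift t).corner ↔ (x.len : ℤ) ∣ t - s := by
  obtain ⟨f, i, b⟩ := x
  rw [Prod.ext_iff]
  cases b
  · have : (i - s) % (X.len f : ℤ) = (i - t) % X.len f ↔ (X.len f : ℤ) ∣ t - s := by
      refine (Int.modEq_iff_dvd (n := (X.len f : ℤ))).trans ?_
      rw [show i - t - (i - s) = -(t - s) by ring, dvd_neg]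
    exact (and_iff_right rfl).trans this
  · have : (i + s) % (X.len f : ℤ) = (i + t) % X.len f ↔ (X.len f : ℤ) ∣ t - s := by
      refine (Int.modEq_iff_dvd (n := (X.len f : ℤ))).trans ?_
      rw [show i + t - (i + s) = t - s by ring]
    exact (and_iff_right rfl).trans this

/-- Two flags with the same corner have the same or opposite directions. -/
theorem eq_or_rev_of_corner_eq {x y : X.Flag} (h : x.corner = y.corner) :
    ∃ k : ℤ, y = x.shift (k * x.len) ∨ y = x.rev.shift (k * x.len) := by
  obtain ⟨f, i, b⟩ := x
  obtain ⟨g, j, c⟩ := y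
  obtain rfl : f = g := congrArg Prod.fst h
  have h' : i % X.len f = j % X.len f := congrArg Prod.snd h
  obtain ⟨k, hk⟩ := (Int.modEq_iff_dvd (n := (X.len f : ℤ))).1 h'
  have hj : j = i + X.len f * k := by linarith
  cases b <;> cases c
  · exact ⟨-k, .inl (by simp [shift, len, hj]; ring)⟩
  · exact ⟨k, .inr (by simp [shift, rev, len, hj]; ring)⟩
  · exact ⟨-k, .inr (by simp [shift, rev, len, hj]; ring)⟩
  · exact ⟨k, .inl (by simp [shift, len, hj]; ring)⟩

theorem src_line_succ (x : X.Flag) (t : ℤ) : X.src (x.line (t + 1)) = X.src (X.rev (x.line t)) := by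
  obtain ⟨f, i, b⟩ := x
  cases b
  · have := X.side_chain f ((i - 1 - (t + 1) : ℤ) : ZMod (X.len f))
    rw [line_false f i _ _ rfl, line_false f i t (i - 1 - (t + 1) + 1) (by ring), X.rev_rev, ← this]
    push_cast
    rfl
  · have := X.side_chain f ((i + t : ℤ) : ZMod (X.len f))
    rw [line_true f i t _ rfl, line_true f i _ (i + t + 1) (by ring), ← this]
    push_cast
    rfl

theorem line_succ_ne (x : X.Flag) (t : ℤ) : x.line (t + 1) ≠ X.rev (x.line t) := by
  obtain ⟨f, i, b⟩ := x
  cases b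
  · have := X.side_immersed f ((i - 1 - (t + 1) : ℤ) : ZMod (X.len f))
    rw [line_false f i _ _ rfl, line_false f i t (i - 1 - (t + 1) + 1) (by ring), X.rev_rev]
    push_cast at this ⊢
    exact this.symm
  · have := X.side_immersed f ((i + t : ℤ) : ZMod (X.len f))
    rw [line_true f i t _ rfl, line_true f i _ (i + t + 1) (by ring)]
    push_cast at this ⊢
    exact this

theorem vert_shift (x : X.Flag) (t : ℤ) : (x.shift t).vert = X.src (x.line t) := by
  rw [vert, line_shift, add_zero]

@[simp] theorem vert_rev (x : X.Flag) : x.rev.vert = x.vert := by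
  rw [vert, vert, line_rev]
  have := x.src_line_succ (-1)
  simpa using this.symm

/-- The two darts at a corner are different. -/
theorem line_rev_zero_ne (x : X.Flag) : x.rev.line 0 ≠ x.line 0 := by
  rw [line_rev]
  have := x.line_succ_ne (-1)
  simpa using this.symm

theorem onBoundary_vert (x : X.Flag) : X.OnBoundary x.vert x.face := by
  obtain ⟨f, i, b⟩ := x
  cases b
  · rw [← vert_rev]
    exact ⟨_, congrArg X.src (line_true f i 0 _ rfl).symm⟩
  · exact ⟨_, congrArg X.src (line_true f i 0 _ rfl).symm⟩

theorem exists_of_onBoundary {a : X.V} {f : X.Face} (h : X.OnBoundary a f) :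
    ∃ x : X.Flag, x.face = f ∧ x.vert = a := by
  obtain ⟨k, rfl⟩ := h
  obtain ⟨i, rfl⟩ := ZMod.intCast_surjective k
  exact ⟨⟨f, i, true⟩, rfl, congrArg X.src (line_true f i 0 i (add_zero i))⟩

theorem exists_of_attach {d : X.Dart} {f : X.Face} (h : ∃ s, X.attach f s = d) :
    ∃ x : X.Flag, x.face = f ∧ x.line 0 = d := by
  obtain ⟨⟨k, b⟩, rfl⟩ := h
  obtain ⟨i, rfl⟩ := ZMod.intCast_surjective k
  cases b
  · exact ⟨⟨f, i + 1, false⟩, rfl, (line_false f (i + 1) 0 i (by ring)).trans (by simp [attach])⟩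
  · exact ⟨⟨f, i, true⟩, rfl, (line_true f i 0 i (by ring)).trans (by simp [attach])⟩

/-- The lines of `x` and `y` agree on the interval `[a, b)`. -/
def Agree (x y : X.Flag) (a b : ℤ) : Prop := ∀ t, a ≤ t → t < b → x.line t = y.line t

/-- The lines of `x` and `y` agree everywhere. -/
def Full (x y : X.Flag) : Prop := (∀ t, x.line t = y.line t) ∧ x.len = y.len

namespace Agree

variable {x y z : X.Flag} {a b c d s : ℤ}

theorem symm (h : x.Agree y a b) : y.Agree x a b := fun t h₁ h₂ => (h t h₁ h₂).symm

theorem trans (h : x.Agree y a b) (h' : y.Agree z a b) : x.Agree z a b :=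
  fun t h₁ h₂ => (h t h₁ h₂).trans (h' t h₁ h₂)

theorem mono (h : x.Agree y a b) (hc : a ≤ c) (hd : d ≤ b) : x.Agree y c d :=
  fun t h₁ h₂ => h t (hc.trans h₁) (h₂.trans_le hd)

theorem union (h : x.Agree y a b) (h' : x.Agree y c d) (hcb : c ≤ b) : x.Agree y a d := by
  intro t h₁ h₂
  rcases lt_or_ge t b with h₃ | h₃
  · exact h t h₁ h₃
  · exact h' t (hcb.trans h₃) h₂

theorem shift (h : x.Agree y a b) (s : ℤ) : (x.shift s).Agree (y.shift s) (a - s) (b - s) := by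
  intro t h₁ h₂
  rw [line_shift, line_shift]
  exact h _ (by linarith) (by linarith)

theorem rev (h : x.Agree y a b) : x.rev.Agree y.rev (-b) (-a) := by
  intro t h₁ h₂
  rw [line_rev, line_rev, h _ (by linarith) (by linarith)]

/-- At `t = b` no dart is compared; the vertex is the end of the dart at time `b - 1`, which is why
the interval must be non-empty. -/
theorem src_eq (h : x.Agree y a b) {t : ℤ} (h₁ : a ≤ t) (h₂ : t ≤ b) (hab : a < b) :
    X.src (x.line t) = X.src (y.line t) := by
  rcases lt_or_eq_of_le h₂ with h₂ | rfl
  · rw [h t h₁ h₂]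
  · have := h (t - 1) (by linarith) (by linarith)
    have h₃ := x.src_line_succ (t - 1)
    have h₄ := y.src_line_succ (t - 1)
    rw [sub_add_cancel] at h₃ h₄
    rw [h₃, h₄, this]

end Agree

namespace Full

variable {x y z : X.Flag}

theorem refl (x : X.Flag) : x.Full x := ⟨fun _ => rfl, rfl⟩
theorem symm (h : x.Full y) : y.Full x := ⟨fun t => (h.1 t).symm, h.2.symm⟩
theorem rev (h : x.Full y) : x.rev.Full y.rev :=
  ⟨fun t => by rw [line_rev, line_rev, h.1], h.2⟩
theorem shift (h : x.Full y) (s : ℤ) : (x.shift s).Full (y.shift s) :=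
  ⟨fun t => by rw [line_shift, line_shift, h.1], h.2⟩
theorem of_shift {s : ℤ} (h : (x.shift s).Full (y.shift s)) : x.Full y := by
  simpa using h.shift (-s)
theorem of_rev (h : x.rev.Full y.rev) : x.Full y := by
  simpa using h.rev
theorem agree (h : x.Full y) (a b : ℤ) : x.Agree y a b := fun t _ _ => h.1 t

end Full

/-! ### Agreement and pieces -/

/-- The dart of a polygon that follows a given one. -/
theorem polyDart_succ_unique {n m : ℕ} (h : Graph.Iso (polygon n) (polygon m))
    (s : (polygon n).Dart) : h.onDart (polygonNext n s) = polygonNext m (h.onDart s) := by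
  -- The next dart is characterized within the graph: it begins where `s` ends and is not the
  -- reverse of `s`. Isomorphisms preserve this.
  have key : ∀ {k : ℕ} (s t : (polygon k).Dart), (polygon k).src t = (polygon k).tgt s →
      t ≠ (polygon k).rev s → t = polygonNext k s := by
    rintro k ⟨i, b⟩ ⟨j, c⟩ h₁ h₂
    cases b <;> cases c <;> simp [Graph.tgt, polygon, polygonNext] at h₁ h₂ ⊢
    · rw [← h₁]; ring
    · exact absurd h₁ h₂
    · exact absurd h₁ h₂
    · exact h₁
  have next : ∀ {k : ℕ} (s : (polygon k).Dart), (polygon k).src (polygonNext k s) =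
      (polygon k).tgt s ∧ polygonNext k s ≠ (polygon k).rev s := by
    rintro k ⟨i, b⟩
    cases b <;> simp [Graph.tgt, polygon, polygonNext]
  refine key _ _ ?_ fun h' => (next s).2 ?_
  · rw [h.src_onDart, (next s).1, Graph.tgt, Graph.tgt, ← h.src_onDart, h.rev_onDart]
  · rw [h.rev_onDart] at h'
    exact h.onDart.injective h'

theorem polyDart_succ (x : X.Flag) (t : ℤ) :
    x.polyDart (t + 1) = polygonNext _ (x.polyDart t) := by
  obtain ⟨f, i, b⟩ := x
  cases b
  · rw [polyDart_false f i t (i - 1 - t) rfl, polyDart_false f i (t + 1) (i - 1 - t - 1) (by ring)]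
    exact congrArg (fun z : ZMod (X.len f) => (z, false)) (by push_cast; simp)
  · rw [polyDart_true f i t (i + t) rfl, polyDart_true f i (t + 1) (i + t + 1) (by ring)]
    exact congrArg (fun z : ZMod (X.len f) => (z, true)) (by push_cast; simp)

/-- Lines are the same if there is an isomorphism of polygons that relates them. -/
theorem full_of_iso {x y : X.Flag}
    (h : Graph.Iso (polygon (X.len x.face)) (polygon (X.len y.face)))
    (h₀ : h.onDart (x.polyDart 0) = y.polyDart 0)
    (ha : ∀ s, X.attach y.face (h.onDart s) = X.attach x.face s) : x.Full y := by
  have hlen : x.len = y.len := by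
    have : Nat.card (ZMod x.len) = Nat.card (ZMod y.len) := Nat.card_congr h.onV
    rwa [Nat.card_zmod, Nat.card_zmod] at this
  have hnat : ∀ n : ℕ, h.onDart (x.polyDart n) = y.polyDart n := by
    intro n
    induction n with
    | zero => exact h₀
    | succ n ih =>
      push_cast
      rw [polyDart_succ, polyDart_succ, ← ih]
      exact polyDart_succ_unique h _
  refine ⟨fun t => ?_, hlen⟩
  have hx := x.len_pos'
  obtain ⟨n, hn⟩ := Int.eq_ofNat_of_zero_le (Int.emod_nonneg t hx.ne')
  have hd : (x.len : ℤ) ∣ t - n := by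
    rw [← hn]
    exact Int.dvd_self_sub_emod
  rw [x.line_congr hd, y.line_congr (hlen ▸ hd), line, line, ← hnat, ha]

/-- The path of length `n` that a flag starts. -/
def path (x : X.Flag) (n : ℕ) : List X.Dart := (List.range n).map fun i : ℕ => x.line i

/-- The path of length `n` in the polygon that a flag starts. -/
def polyPath (x : X.Flag) (n : ℕ) : List (polygon (X.len x.face)).Dart :=
  (List.range n).map fun i : ℕ => x.polyDart i

theorem path_succ (x : X.Flag) (n : ℕ) : x.path (n + 1) = x.line 0 :: (x.shift 1).path n := by
  simp only [path, List.range_succ_eq_map, List.map_cons, List.map_map, line_shift]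
  congr 1
  refine List.map_congr_left fun i _ => ?_
  simp [add_comm]

theorem path_add (x : X.Flag) (m n : ℕ) :
    x.path (m + n) = x.path m ++ (x.shift m).path n := by
  simp only [path, List.range_add, List.map_append, List.map_map, line_shift]
  congr 1

theorem polyPath_succ (x : X.Flag) (n : ℕ) :
    x.polyPath (n + 1) = x.polyDart 0 :: (x.shift 1).polyPath n := by
  simp only [polyPath, List.range_succ_eq_map, List.map_cons, List.map_map, polyDart_shift]
  congr 1
  refine List.map_congr_left fun i _ => ?_
  simp [add_comm]

theorem isWalk_polyPath (x : X.Flag) (n : ℕ) :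
    ∃ b, (polygon (X.len x.face)).IsWalk ((polygon (X.len x.face)).src (x.polyDart 0)) b
      (x.polyPath n) := by
  induction n generalizing x with
  | zero => exact ⟨_, rfl⟩
  | succ n ih =>
    obtain ⟨b, hb⟩ := ih (x.shift 1)
    refine ⟨b, ?_⟩
    rw [polyPath_succ]
    refine ⟨rfl, ?_⟩
    convert hb using 1
    rw [polyDart_shift, add_zero]
    have h := polyDart_succ x 0
    rw [zero_add] at h
    rw [h, Graph.tgt]
    generalize x.polyDart 0 = s
    obtain ⟨i, b⟩ := s
    cases b <;> simp [polygon, polygonNext]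

theorem isLift_polyPath (x : X.Flag) (n : ℕ) : X.IsLift x.face (x.polyPath n) (x.path n) := by
  obtain ⟨b, hb⟩ := x.isWalk_polyPath n
  exact ⟨⟨_, b, hb⟩, by simp [polyPath, path, line]⟩

/-- The line of `x` agrees with some other line on `[a, b)`, but not everywhere. -/
def PieceOn (x : X.Flag) (a b : ℤ) : Prop := ∃ y : X.Flag, x.Agree y a b ∧ ¬ x.Full y

theorem PieceOn.mono {x : X.Flag} {a b c d : ℤ} (h : x.PieceOn a b) (hc : a ≤ c) (hd : d ≤ b) :
    x.PieceOn c d := by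
  obtain ⟨y, h₁, h₂⟩ := h
  exact ⟨y, h₁.mono hc hd, h₂⟩

theorem PieceOn.shift {x : X.Flag} {a b : ℤ} (h : x.PieceOn a b) (s : ℤ) :
    (x.shift s).PieceOn (a - s) (b - s) := by
  obtain ⟨y, h₁, h₂⟩ := h
  exact ⟨y.shift s, h₁.shift s, fun h => h₂ h.of_shift⟩

theorem PieceOn.rev {x : X.Flag} {a b : ℤ} (h : x.PieceOn a b) : x.rev.PieceOn (-b) (-a) := by
  obtain ⟨y, h₁, h₂⟩ := h
  exact ⟨y.rev, h₁.rev, fun h => h₂ h.of_rev⟩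

/-- A compatible isomorphism of polygons would carry first dart to first dart, so by `full_of_iso`
the lines would agree everywhere. -/
theorem PieceOn.isPiece {x : X.Flag} {n : ℕ} (hn : 0 < n) (h : x.PieceOn 0 n) :
    X.IsPiece (x.path n) := by
  obtain ⟨y, h₁, h₂⟩ := h
  have hpath : x.path n = y.path n := by
    refine List.map_congr_left fun i hi => h₁ i (by positivity) ?_
    exact_mod_cast List.mem_range.1 hi
  obtain ⟨m, rfl⟩ := Nat.exists_eq_succ_of_ne_zero hn.ne'
  refine ⟨by simp [path_succ], x.face, trivial, y.face, trivial, _, _, x.isLift_polyPath _,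
    hpath ▸ y.isLift_polyPath _, ?_⟩
  rintro ⟨h, h₃, h₄⟩
  refine h₂ (full_of_iso h ?_ h₄)
  rw [polyPath_succ, polyPath_succ] at h₃
  exact (List.cons.inj h₃).1

theorem path_len_eq_boundaryPath (f : X.Face) (i : ℤ) :
    (⟨f, i, true⟩ : X.Flag).path (X.len f) = X.boundaryPath f (i : ZMod (X.len f)) := by
  refine List.map_congr_left fun t _ => ?_
  rw [line_true f i t _ rfl]
  push_cast
  rfl

end Flag

/-- In a `C(4)` complex, the boundary of a `2`-cell is not covered by three pieces. -/
theorem IsC.not_covered (hC : X.IsC 4) (x : X.Flag) {a b : ℤ} (h₀ : 0 ≤ a) (hab : a ≤ b)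
    (hb : b ≤ x.len) (h₁ : a = 0 ∨ x.PieceOn 0 a) (h₂ : a = b ∨ x.PieceOn a b)
    (h₃ : b = x.len ∨ x.PieceOn b x.len) : False := by
  -- `C(4)` is stated for boundary paths in the positive direction. Reversing the flag after a full
  -- turn sends the interval from `c` to `d` to the one from `len - d` to `len - c`.
  wlog hdir : x.dir = true generalizing x a b
  · have hx : ((x.shift x.len).rev).dir = true := by simpa [Flag.rev, Flag.shift] using hdir
    have tr : ∀ {c d : ℤ}, x.PieceOn c d → (x.shift x.len).rev.PieceOn (x.len - d) (x.len - c) := by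
      intro c d h
      have := (h.shift x.len).rev
      rwa [neg_sub, neg_sub] at this
    refine this ((x.shift x.len).rev) (a := x.len - b) (b := x.len - a) (by linarith) (by linarith)
      (by simpa using h₀) ?_ ?_ ?_ hx
    · exact h₃.imp (fun h => by rw [h, sub_self]) (fun h => by simpa using tr h)
    · exact h₂.imp (fun h => by rw [h]) tr
    · refine h₁.imp (fun h => by simp [h]) (fun h => by simpa using tr h)
  · obtain ⟨f, i, d⟩ := x
    obtain rfl : d = true := hdir
    set x : X.Flag := ⟨f, i, true⟩ with hx
    have hlen : x.len = X.len f := rfl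
    have single : ∀ {c d : ℤ}, c ≤ d → c = d ∨ x.PieceOn c d →
        ∃ l : List (List X.Dart), (∀ p ∈ l, X.IsPiece p) ∧
          l.flatten = (x.shift c).path (d - c).toNat ∧ l.length ≤ 1 := by
      rintro c d hcd (rfl | h)
      · exact ⟨[], by simp, by simp [Flag.path], by simp⟩
      · rcases hcd.eq_or_lt with rfl | hcd
        · exact ⟨[], by simp, by simp [Flag.path], by simp⟩
        · refine ⟨[(x.shift c).path (d - c).toNat], ?_, by simp, by simp⟩
          simp only [List.mem_singleton, forall_eq]
          refine Flag.PieceOn.isPiece (by omega) ?_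
          have := h.shift c
          rwa [sub_self, ← Int.toNat_of_nonneg (show 0 ≤ d - c by linarith)] at this
    obtain ⟨l₁, p₁, f₁, n₁⟩ := single h₀ (h₁.imp Eq.symm id)
    obtain ⟨l₂, p₂, f₂, n₂⟩ := single hab h₂
    obtain ⟨l₃, p₃, f₃, n₃⟩ := single hb h₃
    have hflat : (l₁ ++ l₂ ++ l₃).flatten = X.boundaryPath f (i : ZMod (X.len f)) := by
      rw [← Flag.path_len_eq_boundaryPath, List.flatten_append, List.flatten_append, f₁, f₂, f₃]
      have e₁ : X.len f = ((a - 0).toNat + (b - a).toNat) + ((x.len : ℤ) - b).toNat := by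
        omega
      conv_rhs => rw [e₁, Flag.path_add, Flag.path_add]
      rw [Flag.shift_zero]
      congr 3
      · simp [h₀, hx]
      · push_cast
        rw [Int.toNat_of_nonneg (by linarith), Int.toNat_of_nonneg (by linarith)]
        ring
    have := hC f i (l₁ ++ l₂ ++ l₃) (by
      intro c hc
      rw [List.mem_append, List.mem_append] at hc
      rcases hc with (hc | hc) | hc
      exacts [p₁ c hc, p₂ c hc, p₃ c hc]) hflat
    simp only [List.length_append] at this
    omega

/-- Lines that agree over a full turn agree everywhere. -/
theorem IsC.full_of_turn (hC : X.IsC 4) {x y : X.Flag} {a b : ℤ} (h : x.Agree y a b)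
    (hab : a + x.len ≤ b) : x.Full y := by
  by_contra hn
  have hp : x.PieceOn a b := ⟨y, h, hn⟩
  have := (hp.shift a).mono (c := 0) (d := x.len) (by simp) (by linarith)
  exact hC.not_covered (x.shift a) (a := 0) (b := 0) le_rfl le_rfl (by simp) (.inl rfl) (.inl rfl)
    (.inr this)

/-- A closed walk that winds around the boundary of a `2`-cell is not the concatenation of three
pieces. -/
theorem IsC.not_closed_chain (hC : X.IsC 4) (x : X.Flag) {a b k : ℤ} (hk : k ≠ 0)
    (h₁ : x.PieceOn (min 0 a) (max 0 a)) (h₂ : x.PieceOn (min a b) (max a b))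
    (h₃ : x.PieceOn (min b (k * x.len)) (max b (k * x.len))) : False := by
  wlog hk' : 0 < k generalizing x a b k
  · have tr : ∀ {c d : ℤ}, x.PieceOn (min c d) (max c d) →
        x.rev.PieceOn (min (-c) (-d)) (max (-c) (-d)) := by
      intro c d h
      have := h.rev
      rwa [← min_neg_neg, ← max_neg_neg] at this
    refine this x.rev (neg_ne_zero.2 hk) (a := -a) (b := -b) (by simpa using tr h₁) (tr h₂) ?_
      (by omega)
    have := tr h₃
    rwa [← neg_mul] at this
  · have hL := x.len_pos'
    have hkL : (x.len : ℤ) ≤ k * x.len := by nlinarith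
    -- The break points are clipped to a single turn. The second one is formed from `max a b`, since
    -- the walk may turn back between `a` and `b`; each clipped interval lies within the range of
    -- the corresponding part of the walk.
    refine hC.not_covered x (a := max 0 (min a x.len)) (b := max 0 (min (max a b) x.len))
      (le_max_left _ _) (by omega) (by omega) ?_ ?_ ?_
    · by_cases ha : a ≤ 0
      · left; omega
      · right; exact h₁.mono (by omega) (by omega)
    · by_cases ha : b ≤ a
      · left; omega
      · by_cases h : max 0 (min a x.len) = max 0 (min (max a b) x.len)
        · exact .inl h
        · right; exact h₂.mono (by omega) (by omega)
    · by_cases h : max 0 (min (max a b) (x.len : ℤ)) = x.len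
      · exact .inl h
      · right
        exact h₃.mono (by omega) (by omega)

end TwoComplex
end SmallCancellation

/-! ### Common boundary paths of two flags -/

namespace SmallCancellation

namespace TwoComplex

variable {X : TwoComplex.{u}}

namespace Flag

/-- The paths that the flags `x` and `y` run through between the times `a` and `b` are the same. -/
def Glued (x y : X.Flag) (a b : ℤ) : Prop :=
  x.Agree y (min a b) (max a b) ∧
    -- Only for `a = b` does this add something to the agreement of the darts.
    ∀ t, min a b ≤ t → t ≤ max a b → (x.shift t).vert = (y.shift t).vert

namespace Glued

variable {x y z : X.Flag} {a b c d : ℤ}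

theorem symm (h : x.Glued y a b) : y.Glued x a b :=
  ⟨h.1.symm, fun t h₁ h₂ => (h.2 t h₁ h₂).symm⟩

theorem swap (h : x.Glued y a b) : x.Glued y b a := by
  unfold Glued at h ⊢
  rwa [min_comm, max_comm]

theorem trans (h : x.Glued y a b) (h' : y.Glued z a b) : x.Glued z a b :=
  ⟨h.1.trans h'.1, fun t h₁ h₂ => (h.2 t h₁ h₂).trans (h'.2 t h₁ h₂)⟩

theorem mono (h : x.Glued y a b) (h₁ : min a b ≤ min c d) (h₂ : max c d ≤ max a b) :
    x.Glued y c d :=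
  ⟨h.1.mono h₁ h₂, fun t h₃ h₄ => h.2 t (h₁.trans h₃) (h₄.trans h₂)⟩

theorem union (h : x.Glued y a b) (h' : x.Glued y b c) : x.Glued y a c := by
  refine ⟨fun t h₁ h₂ => ?_, fun t h₁ h₂ => ?_⟩
  · by_cases h₃ : min a b ≤ t ∧ t < max a b
    · exact h.1 t h₃.1 h₃.2
    · exact h'.1 t (by omega) (by omega)
  · by_cases h₃ : min a b ≤ t ∧ t ≤ max a b
    · exact h.2 t h₃.1 h₃.2
    · exact h'.2 t (by omega) (by omega)

theorem rev (h : x.Glued y a b) : x.rev.Glued y.rev (-a) (-b) := by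
  have h₁ : min (-a) (-b) = -max a b := by omega
  have h₂ : max (-a) (-b) = -min a b := by omega
  refine ⟨?_, fun t ht ht' => ?_⟩
  · rw [h₁, h₂]
    exact h.1.rev
  · have := h.2 (-t) (by omega) (by omega)
    have hx := x.rev_shift (-t)
    have hy := y.rev_shift (-t)
    rw [neg_neg] at hx hy
    rwa [← hx, ← hy, vert_rev, vert_rev]

theorem shift (h : x.Glued y a b) (s : ℤ) : (x.shift s).Glued (y.shift s) (a - s) (b - s) := by
  refine ⟨fun t h₁ h₂ => ?_, fun t h₁ h₂ => ?_⟩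
  · rw [line_shift, line_shift]
    exact h.1 _ (by omega) (by omega)
  · rw [shift_shift, shift_shift]
    exact h.2 _ (by omega) (by omega)

theorem of_shift {s : ℤ} (h : (x.shift s).Glued (y.shift s) a b) :
    x.Glued y (s + a) (s + b) := by
  have := h.shift (-s)
  rw [shift_shift, shift_shift, add_neg_cancel, shift_zero, shift_zero] at this
  convert this using 1 <;> ring

end Glued

theorem Full.glued {x y : X.Flag} (h : x.Full y) (a b : ℤ) : x.Glued y a b :=
  ⟨h.agree _ _, fun t _ _ => by rw [vert_shift, vert_shift, h.1]⟩

theorem glued_of_agree {x y : X.Flag} {n : ℤ} (hv : x.vert = y.vert)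
    (h : x.Agree y (min 0 n) (max 0 n)) : x.Glued y 0 n := by
  refine ⟨h, fun t h₁ h₂ => ?_⟩
  rcases eq_or_ne n 0 with rfl | hn
  · obtain rfl : t = 0 := by omega
    simpa using hv
  · rw [vert_shift, vert_shift]
    exact h.src_eq h₁ h₂ (by omega)

/-- Flags with the same corner and the same direction. -/
def Twin (x y : X.Flag) : Prop := ∃ k : ℤ, y = x.shift (k * x.len)

theorem Twin.full {x y : X.Flag} (h : x.Twin y) : x.Full y := by
  obtain ⟨k, rfl⟩ := h
  refine ⟨fun t => ?_, rfl⟩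
  rw [line_shift, add_comm, line_add_mul_len]

theorem Twin.corner_shift {x y : X.Flag} (h : x.Twin y) (t : ℤ) :
    (x.shift t).corner = (y.shift t).corner := by
  obtain ⟨k, rfl⟩ := h
  rw [shift_shift, corner_shift_eq_iff]
  exact ⟨k, by ring⟩

theorem Twin.rev {x y : X.Flag} (h : x.Twin y) : x.rev.Twin y.rev := by
  obtain ⟨k, rfl⟩ := h
  exact ⟨-k, by rw [rev_shift, len_rev, neg_mul]⟩

theorem twin_or_twin_rev {x y : X.Flag} (h : x.corner = y.corner) : x.Twin y ∨ x.rev.Twin y := by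
  obtain ⟨k, h | h⟩ := eq_or_rev_of_corner_eq h
  · exact .inl ⟨k, h⟩
  · exact .inr ⟨k, h⟩

theorem corner_shift_of_full {x y : X.Flag} (h : x.Full y) {s t : ℤ}
    (h' : (x.shift s).corner = (x.shift t).corner) :
    (y.shift s).corner = (y.shift t).corner := by
  rw [corner_shift_eq_iff] at h' ⊢
  rwa [← h.2]

/-- The sign of `n` decides whether the first common dart at the corner is the forward or the
backward one. Incompatible directions are excluded by comparing these darts. -/
theorem Glued.shift_line_eq {x y : X.Flag} {n : ℤ} (h : x.Glued y 0 n) (hn : n ≠ 0) :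
    (0 < n ∧ x.line 0 = y.line 0) ∨ (n < 0 ∧ x.rev.line 0 = y.rev.line 0) := by
  rcases hn.lt_or_gt with hn | hn
  · refine .inr ⟨hn, ?_⟩
    rw [line_rev, line_rev]
    exact congrArg X.rev (h.1 _ (by omega) (by omega))
  · exact .inl ⟨hn, h.1 0 (by omega) (by omega)⟩

/-- The line of `x` is periodic, but the witness `y` may have another period; so the witness is
shifted along. -/
theorem PieceOn.translate {x : X.Flag} {a b : ℤ} (h : x.PieceOn a b) (k : ℤ) :
    x.PieceOn (a + k * x.len) (b + k * x.len) := by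
  obtain ⟨y, h₁, h₂⟩ := h
  have hl : ∀ t, (y.shift (-(k * x.len))).line t = y.line (t - k * x.len) := fun t => by
    rw [line_shift]
    congr 1
    ring
  have hx : ∀ t, x.line (t - k * x.len) = x.line t := fun t => by
    rw [← x.line_add_mul_len (t - k * x.len) k, sub_add_cancel]
  refine ⟨y.shift (-(k * x.len)), fun t ht ht' => ?_, fun h => h₂ ⟨fun t => ?_, h.2⟩⟩
  · rw [hl, ← hx]
    exact h₁ _ (by linarith) (by linarith)
  · have := h.1 (t + k * x.len)
    rwa [hl, add_sub_cancel_right, line_add_mul_len] at this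

end Flag

open TwoComplex.Flag

/-! ### Matching corners -/

/-- The two `2`-cells with the corners `c`, `c'` and `d`, `d'` have a boundary path from `c` to `c'`
and from `d` to `d'` in common. -/
def Matches (X : TwoComplex.{u}) (c d c' d' : X.Face × ℤ) : Prop :=
  ∃ (x y : X.Flag) (n : ℤ), x.corner = c ∧ y.corner = d ∧ (x.shift n).corner = c' ∧
    (y.shift n).corner = d' ∧ x.Glued y 0 n

theorem matches_of_glued {x y : X.Flag} {a b : ℤ} (h : x.Glued y a b) :
    X.Matches (x.shift a).corner (y.shift a).corner (x.shift b).corner (y.shift b).corner := by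
  refine ⟨x.shift a, y.shift a, b - a, rfl, rfl, ?_, ?_, ?_⟩
  · rw [shift_shift, add_sub_cancel]
  · rw [shift_shift, add_sub_cancel]
  · simpa using h.shift a

namespace Matches

variable {c d c' d' e e' : X.Face × ℤ}

theorem symm (h : X.Matches c d c' d') : X.Matches d c d' c' := by
  obtain ⟨x, y, n, h₁, h₂, h₃, h₄, h₅⟩ := h
  exact ⟨y, x, n, h₂, h₁, h₄, h₃, h₅.symm⟩

theorem swap (h : X.Matches c d c' d') : X.Matches c' d' c d := by
  obtain ⟨x, y, n, rfl, rfl, rfl, rfl, h₅⟩ := h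
  have := matches_of_glued h₅.swap
  simpa using this

/-- Flags with the same corner are twins up to reversal, so the first flag of a match can be
prescribed. -/
theorem align (h : X.Matches c d c' d') {x : X.Flag} (hx : x.corner = c) :
    ∃ (y : X.Flag) (n : ℤ), y.corner = d ∧ (x.shift n).corner = c' ∧
      (y.shift n).corner = d' ∧ x.Glued y 0 n := by
  obtain ⟨x', y, n, h₁, h₂, h₃, h₄, h₅⟩ := h
  rcases twin_or_twin_rev (hx.trans h₁.symm) with h | h
  · exact ⟨y, n, h₂, (h.corner_shift n).trans h₃, h₄, (h.full.glued _ _).trans h₅⟩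
  · refine ⟨y.rev, -n, h₂, ?_, ?_, ?_⟩
    · have := h.rev.corner_shift (-n)
      rw [rev_rev] at this
      rw [this, ← rev_shift, corner_rev, h₃]
    · rw [← rev_shift, corner_rev, h₄]
    · have := h.rev
      rw [rev_rev] at this
      refine (this.full.glued _ _).trans ?_
      simpa using h₅.rev

/-- After alignment the two paths could still disagree about the direction on the second cell. If
both are non-trivial, this would identify the two darts at the middle corner of one of the cells,
which are different because the attaching maps are immersions. -/
theorem concat (h : X.Matches c d c' d') (h' : X.Matches c' d' e e') : X.Matches c d e e' := by
  obtain ⟨x, y, n, rfl, rfl, rfl, rfl, hxy⟩ := h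
  obtain ⟨z, m, h₁, h₂, h₃, h₄⟩ := h'.align rfl
  rcases twin_or_twin_rev h₁.symm with ht | ht
  · have hz := h₄.trans (ht.full.symm.glued 0 m)
    refine ⟨x, y, n + m, rfl, rfl, ?_, ?_, hxy.union (by simpa using hz.of_shift)⟩
    · rw [← h₂, shift_shift]
    · rw [← h₃, ← shift_shift]
      exact ht.corner_shift m
  · rcases eq_or_ne m 0 with rfl | hm
    · rw [shift_zero] at h₂ h₃
      exact ⟨x, y, n, rfl, rfl, h₂, by rw [← h₁, h₃], hxy⟩
    rcases eq_or_ne n 0 with rfl | hn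
    · simp only [shift_zero] at h₁ h₂ h₄
      exact ⟨x, z, m, rfl, h₁, h₂, h₃, h₄⟩
    exfalso
    have hz := h₄.trans (ht.full.symm.glued 0 m)
    have hxy' := hxy.swap.shift n
    rw [sub_self, zero_sub] at hxy'
    have hx := (x.shift n).line_rev_zero_ne
    have hy := (y.shift n).line_rev_zero_ne
    rcases hz.shift_line_eq hm with ⟨-, h₅⟩ | ⟨-, h₅⟩ <;>
      rcases hxy'.shift_line_eq (neg_ne_zero.2 hn) with ⟨-, h₆⟩ | ⟨-, h₆⟩
    · exact hy (h₅.symm.trans h₆)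
    · exact hx (h₆.trans h₅.symm)
    · rw [rev_rev] at h₅
      exact hx (h₅.trans h₆.symm)
    · rw [rev_rev] at h₅
      exact hy (h₆.symm.trans h₅)

/-- In a `C(4)` complex, a common path of two `2`-cells does not return to a corner of one of them
at a different corner of the other one. -/
theorem eq_of_eq (hC : X.IsC 4) (h : X.Matches c d c d') : d = d' := by
  obtain ⟨x, y, n, rfl, rfl, h₁, rfl, h₂⟩ := h
  have hn : (x.len : ℤ) ∣ n := by
    have := (x.corner_shift_eq_iff (s := 0) (t := n)).1 (by rw [h₁, shift_zero])
    simpa using this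
  rcases eq_or_ne n 0 with rfl | hn0
  · rw [shift_zero]
  · have hf : x.Full y := by
      refine hC.full_of_turn h₂.1 ?_
      obtain ⟨k, rfl⟩ := hn
      have hx := x.len_pos'
      have hk : k ≠ 0 := by
        rintro rfl
        simp at hn0
      rcases hk.lt_or_gt with hk | hk
      · have : (x.len : ℤ) * k ≤ -x.len := by nlinarith
        omega
      · have : (x.len : ℤ) ≤ x.len * k := by nlinarith
        omega
    have := corner_shift_of_full hf (s := 0) (t := n) (by rw [h₁, shift_zero])
    rwa [shift_zero] at this

/-- If a common path started at one corner of a cell in both directions, the two darts at this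
corner would coincide. -/
theorem eq_of_diag (h : X.Matches c c d d') : d = d' := by
  obtain ⟨x, y, n, rfl, h₀, rfl, rfl, h₂⟩ := h
  rcases twin_or_twin_rev h₀.symm with h | h
  · exact h.corner_shift n
  · rcases eq_or_ne n 0 with rfl | hn
    · simp [h₀]
    · exfalso
      have hz := h₂.trans (h.full.symm.glued 0 n)
      rcases hz.shift_line_eq hn with ⟨-, h₅⟩ | ⟨-, h₅⟩
      · exact x.line_rev_zero_ne h₅.symm
      · rw [rev_rev] at h₅
        exact x.line_rev_zero_ne h₅

/-- Common paths of the `2`-cells `f`, `g` and of `g`, `h` between the same corners of `g` are the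
same path. -/
theorem trans (hC : X.IsC 4) (h : X.Matches c d c' d') (h' : X.Matches d e d' e') :
    X.Matches c e c' e' := by
  obtain ⟨y, x, n, rfl, rfl, rfl, rfl, hyx⟩ := h.symm
  obtain ⟨z, m, rfl, h₁, rfl, hyz⟩ := h'.align rfl
  have hnm : (y.len : ℤ) ∣ n - m := y.corner_shift_eq_iff.1 h₁
  by_cases hyx' : y.Full x
  · refine ⟨x, z, m, rfl, rfl, corner_shift_of_full hyx' h₁, rfl,
      (hyx'.symm.glued _ _).trans hyz⟩
  by_cases hyz' : y.Full z
  · exact ⟨x, z, n, rfl, rfl, rfl, corner_shift_of_full hyz' h₁.symm,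
      hyx.symm.trans (hyz'.glued _ _)⟩
  obtain ⟨k, hk⟩ := hnm
  rcases eq_or_ne k 0 with rfl | hk0
  · obtain rfl : n = m := by simpa [sub_eq_zero] using hk
    exact ⟨x, z, n, rfl, rfl, rfl, rfl, hyx.symm.trans hyz⟩
  -- The two paths on the middle cell differ by `k ≠ 0` full turns, so two pieces, one of them
  -- translated, already wind around its boundary.
  · exfalso
    have p₁ : y.PieceOn (min 0 n) (max 0 n) := ⟨x, hyx.1, hyx'⟩
    have p₂ : y.PieceOn (min 0 m) (max 0 m) := ⟨z, hyz.1, hyz'⟩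
    have p₃ := p₂.translate k
    have e : (k * y.len : ℤ) = n - m := by rw [hk]; ring
    refine hC.not_closed_chain y hk0 p₁ (p₁.mono (c := min n n) (d := max n n) ?_ ?_)
      (p₃.mono ?_ ?_) <;> omega

end Matches

/-- There are no three `2`-cells around a vertex that have pairwise a dart at that vertex in common,
these three darts being different. -/
def NoTriangle (X : TwoComplex.{u}) : Prop :=
  ∀ x y z : X.Flag, x.line 0 = y.rev.line 0 → y.line 0 = z.rev.line 0 → z.line 0 = x.rev.line 0 →
    x.line 0 ≠ y.line 0 → y.line 0 ≠ z.line 0 → x.line 0 ≠ z.line 0 → False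

/-! ### Three squares around a corner -/

/-- The diagonals of the hexagon formed by three squares around a vertex. -/
theorem Matches.wheel_vertex (hT : X.NoTriangle) {a b c d e f g c' d' : X.Face × ℤ}
    (h₁ : X.Matches c a d b) (h₂ : X.Matches f g d c') (h₃ : X.Matches c' b d' e) :
    (∃ z, X.Matches f z d b) ∨ (∃ z, X.Matches z a c' b ∧ X.Matches f g c z) ∨
      ∃ z, X.Matches z e d b ∧ X.Matches g f d' z := by
  -- The flags `v`, `x`, `y` are placed at the corners `b`, `d`, `c'` at the common vertex. With
  -- compatible directions, their pairwise common paths are the intervals from `0` to `n₁`, `n₂`,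
  -- `n₃`, and the relative position of these end points decides between the alternatives.
  have main : ∀ (v x y : X.Flag) (n₁ n₂ n₃ : ℤ), v.corner = b → x.corner = d → y.corner = c' →
      (v.shift n₁).corner = a → (x.shift n₁).corner = c → v.Glued x 0 n₁ →
      (v.shift n₂).corner = e → (y.shift n₂).corner = d' → v.Glued y 0 n₂ →
      (x.shift n₃).corner = f → (y.shift n₃).corner = g → x.Glued y 0 n₃ →
      ((∃ z, X.Matches f z d b) ∨ (∃ z, X.Matches z a c' b ∧ X.Matches f g c z) ∨
        ∃ z, X.Matches z e d b ∧ X.Matches g f d' z) := by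
    rintro v x y n₁ n₂ n₃ rfl rfl rfl rfl rfl g₁ rfl rfl g₂ rfl rfl g₃
    have h₀ : ∀ {p q : X.Flag} {n : ℤ}, p.Glued q n 0 →
        X.Matches (p.shift n).corner (q.shift n).corner p.corner q.corner := by
      intro p q n h
      simpa using matches_of_glued h
    by_cases i₁ : min 0 n₁ ≤ n₃ ∧ n₃ ≤ max 0 n₁
    · exact .inl ⟨_, h₀ (g₁.symm.mono (by omega) (by omega))⟩
    by_cases i₂ : min 0 n₂ ≤ n₃ ∧ n₃ ≤ max 0 n₂
    · exact .inl ⟨_, h₀ ((g₃.trans (g₂.symm.mono (by omega) (by omega))).swap)⟩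
    right
    have case₂ : v.Glued y 0 n₁ → (∃ z, X.Matches z (v.shift n₁).corner y.corner v.corner ∧
        X.Matches (x.shift n₃).corner (y.shift n₃).corner (x.shift n₁).corner z) := by
      intro h
      exact ⟨_, h₀ h.symm.swap, matches_of_glued (g₃.swap.union (g₁.symm.trans h))⟩
    have case₃ : v.Glued x 0 n₂ → (∃ z, X.Matches z (v.shift n₂).corner x.corner v.corner ∧
        X.Matches (y.shift n₃).corner (x.shift n₃).corner (y.shift n₂).corner z) := by
      intro h
      exact ⟨_, h₀ h.symm.swap, matches_of_glued (g₃.symm.swap.union (g₂.symm.trans h))⟩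
    by_cases i₃ : min 0 n₂ ≤ n₁ ∧ n₁ ≤ max 0 n₂
    · exact .inl (case₂ (g₂.mono (by omega) (by omega)))
    by_cases i₄ : min 0 n₃ ≤ n₁ ∧ n₁ ≤ max 0 n₃
    · exact .inl (case₂ (g₁.trans (g₃.mono (by omega) (by omega))))
    by_cases i₅ : min 0 n₁ ≤ n₂ ∧ n₂ ≤ max 0 n₁
    · exact .inr (case₃ (g₁.mono (by omega) (by omega)))
    · exact .inr (case₃ (g₂.trans (g₃.symm.mono (by omega) (by omega))))
  obtain ⟨v, -, -, rfl, -, -, -, -⟩ := h₁.swap.symm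
  obtain ⟨x, n₁, hx, rfl, rfl, g₁⟩ := h₁.swap.symm.align rfl
  obtain ⟨y, n₂, hy, rfl, rfl, g₂⟩ := h₃.symm.align rfl
  obtain ⟨y', n₃, hy', rfl, rfl, g₃⟩ := h₂.swap.align hx
  rcases twin_or_twin_rev (hy.trans hy'.symm) with ht | ht
  · exact main v x y n₁ n₂ n₃ rfl hx hy rfl rfl g₁ rfl rfl g₂ rfl (ht.corner_shift n₃)
      (g₃.trans (ht.full.symm.glued _ _))
  -- When one of the paths is trivial, the direction does not matter along it, and a flag may be
  -- reversed to restore compatibility.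
  rcases eq_or_ne n₃ 0 with rfl | e₃
  · exact main v x y n₁ n₂ 0 rfl hx hy rfl rfl g₁ rfl rfl g₂ rfl (by simp [hy, hy'])
      (glued_of_agree (by
        have h₁ := g₁.2 0 (by omega) (by omega)
        have h₂ := g₂.2 0 (by omega) (by omega)
        rw [shift_zero, shift_zero] at h₁ h₂
        rw [← h₁, ← h₂]) (fun t h h' => by omega))
  rcases eq_or_ne n₂ 0 with rfl | e₂
  · refine main v x y.rev n₁ 0 n₃ rfl hx hy rfl rfl g₁ rfl (by simp) (glued_of_agree ?_ ?_) rfl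
      (ht.corner_shift n₃) (g₃.trans (ht.full.symm.glued _ _))
    · simpa using g₂.2 0 (by omega) (by omega)
    · exact fun t h h' => by omega
  rcases eq_or_ne n₁ 0 with rfl | e₁
  · have ht' := ht.rev
    rw [rev_rev] at ht'
    refine main v x.rev y 0 n₂ (-n₃) rfl hx hy rfl (by simp) (glued_of_agree ?_ ?_) rfl rfl g₂
      (by rw [← rev_shift, corner_rev]) ?_ ?_
    · simpa using g₁.2 0 (by omega) (by omega)
    · exact fun t h h' => by omega
    · rw [ht'.corner_shift, ← rev_shift, corner_rev]
    · have := g₃.rev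
      rw [neg_zero] at this
      exact this.trans (ht'.full.symm.glued _ _)
  -- Now all three paths are non-trivial and the directions are incompatible. Depending on the
  -- signs, either the two darts at one of the corners coincide or three different darts form the
  -- forbidden triangle.
  exfalso
  have k₃ := g₃.trans (ht.full.symm.glued 0 n₃)
  have hv := v.line_rev_zero_ne
  have hx' := x.line_rev_zero_ne
  have hy' := y.line_rev_zero_ne
  rcases g₁.shift_line_eq e₁ with ⟨-, l₁⟩ | ⟨-, l₁⟩ <;>
    rcases g₂.shift_line_eq e₂ with ⟨-, l₂⟩ | ⟨-, l₂⟩ <;>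
    rcases k₃.shift_line_eq e₃ with ⟨-, l₃⟩ | ⟨-, l₃⟩ <;>
    try rw [rev_rev] at l₃
  · exact hy' (l₃.symm.trans (l₁.symm.trans l₂))
  · exact hx' (l₃.trans (l₂.symm.trans l₁))
  · exact hv (l₂.trans (l₃.symm.trans l₁.symm))
  · refine hT v x.rev y.rev (by rwa [rev_rev]) (by rwa [rev_rev]) l₂.symm ?_ ?_ ?_
    · rw [l₁]; exact hx'.symm
    · rw [l₃]; exact hy'.symm
    · rw [← l₂]; exact hv.symm
  · refine hT v.rev x y l₁ l₃ (by rw [rev_rev, l₂]) ?_ ?_ ?_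
    · rw [l₁]; exact hx'
    · rw [l₃]; exact hy'
    · rw [← l₂]; exact hv
  · exact hv (l₁.trans (l₃.trans l₂.symm))
  · exact hx' (l₁.symm.trans (l₂.trans l₃.symm))
  · exact hy' (l₂.symm.trans (l₁.trans l₃))

/-- The diagonals of the hexagon formed by three squares around a `2`-cell. -/
theorem Matches.wheel_face (hC : X.IsC 4) {a b c d e f g c' d' : X.Face × ℤ}
    (h₁ : X.Matches c d a b) (h₂ : X.Matches f d g c') (h₃ : X.Matches c' d' b e) :
    (∃ z, X.Matches f d z b) ∨ (∃ z, X.Matches z c' a b ∧ X.Matches f c g z) ∨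
      ∃ z, X.Matches z d e b ∧ X.Matches g d' f z := by
  -- On the line of the central cell `v`, the neighbours `u`, `y`, `u'` share the intervals from `0`
  -- to `p`, from `p` to `p + r`, and from `0` to `q`, where `p + r` and `q` agree up to full turns.
  obtain ⟨v, -, -, rfl, -, -, -, -⟩ := h₁.swap.symm
  obtain ⟨u, p, rfl, rfl, rfl, g₁⟩ := h₁.swap.symm.align rfl
  obtain ⟨u', q, rfl, rfl, rfl, g₂⟩ := h₃.swap.align rfl
  obtain ⟨y, r, rfl, hr, rfl, g₃⟩ := h₂.symm.align rfl
  obtain ⟨y, rfl⟩ : ∃ y' : X.Flag, y = y'.shift p := ⟨y.shift (-p), by simp⟩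
  have g₃ := g₃.of_shift
  rw [add_zero] at g₃
  rw [shift_shift] at hr
  simp only [shift_shift]
  have h₀ : ∀ {s t : X.Flag} {n : ℤ}, s.Glued t n 0 →
      X.Matches (s.shift n).corner (t.shift n).corner s.corner t.corner := by
    intro p q n h
    simpa using matches_of_glued h
  have case₁ : v.Glued y p 0 → ∃ z, X.Matches (y.shift p).corner (v.shift p).corner z v.corner :=
    fun h => ⟨_, h₀ h.symm⟩
  have case₂ : v.Glued u 0 (p + r) →
      (∃ z, X.Matches z (v.shift q).corner u.corner v.corner ∧
        X.Matches (y.shift p).corner (u.shift p).corner (y.shift (p + r)).corner z) := by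
    intro h
    rw [← hr]
    exact ⟨_, h₀ h.symm.swap, matches_of_glued (g₃.symm.trans (g₁.swap.union h |>.mono
      (by omega) (by omega)))⟩
  have case₃ : v.Glued u' 0 p → v.Glued u' 0 (p + r) →
      (u'.shift (p + r)).corner = (u'.shift q).corner →
      (∃ z, X.Matches z (v.shift p).corner u'.corner v.corner ∧
        X.Matches (y.shift (p + r)).corner (u'.shift q).corner (y.shift p).corner z) := by
    intro h h' h''
    rw [← h'']
    exact ⟨_, h₀ h.symm.swap, matches_of_glued (g₃.symm.swap.trans (h'.swap.union h))⟩
  by_cases f₁ : v.Full y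
  · exact .inl (case₁ (f₁.glued _ _))
  by_cases f₂ : v.Full u
  · exact .inr (.inl (case₂ (f₂.glued _ _)))
  by_cases f₃ : v.Full u'
  · exact .inr (.inr (case₃ (f₃.glued _ _) (f₃.glued _ _) (corner_shift_of_full f₃ hr)))
  obtain ⟨k, hk⟩ := v.corner_shift_eq_iff.1 hr.symm
  -- Without winding, one of the times `0`, `p`, `p + r` lies between the other two, and this gives
  -- the diagonal. With winding, three pieces would run around the boundary of `v`.
  rcases eq_or_ne k 0 with rfl | hk0
  · obtain rfl : q = p + r := by linarith
    by_cases i₁ : min p (p + r) ≤ 0 ∧ 0 ≤ max p (p + r)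
    · exact .inl (case₁ (g₃.mono (by omega) (by omega)))
    by_cases i₂ : min 0 p ≤ p + r ∧ p + r ≤ max 0 p
    · exact .inr (.inl (case₂ (g₁.mono (by omega) (by omega))))
    · exact .inr (.inr (case₃ (g₂.mono (by omega) (by omega)) g₂ rfl))
  · exfalso
    have p₁ : v.PieceOn _ _ := ⟨u, g₁.1, f₂⟩
    have p₂ : v.PieceOn _ _ := ⟨y, g₃.1, f₁⟩
    have p₃ : v.PieceOn _ _ := ⟨u', g₂.1, f₃⟩
    have e : (k * v.len : ℤ) = p + r - q := by rw [hk]; ring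
    exact hC.not_closed_chain v hk0 p₁ p₂ ((p₃.translate k).mono (by omega) (by omega))

/-- The corners of the `2`-cells, traversed from the vertex to the `2`-cell (`true`) or from the
`2`-cell to the vertex (`false`).  Two cells with a common path between two vertices form a square.
-/
def cornerSystem (hC : X.IsC 4) (hT : X.NoTriangle) : SquareSystem ((X.Face × ℤ) × Bool) where
  inv a := (a.1, !a.2)
  inv_inv a := by simp
  sq
    | (a, true), (b, false), (c, true), (d, false) => X.Matches a c b d
    | (a, false), (b, true), (c, false), (d, true) => X.Matches a b c d
    | _, _, _, _ => False
  symm := by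
    rintro ⟨a, _ | _⟩ ⟨b, _ | _⟩ ⟨c, _ | _⟩ ⟨d, _ | _⟩ h <;> try exact h.elim
    · exact Matches.swap h
    · exact Matches.symm h
  trans := by
    rintro ⟨a, _ | _⟩ ⟨b, _ | _⟩ ⟨c, _ | _⟩ ⟨d, _ | _⟩ ⟨e, _ | _⟩ ⟨f, _ | _⟩ h h' <;>
      first | exact h.elim | exact h'.elim | skip
    · exact Matches.concat h h'
    · exact Matches.trans hC h h'
  rot := by
    rintro ⟨a, _ | _⟩ ⟨b, _ | _⟩ ⟨c, _ | _⟩ ⟨d, _ | _⟩ h <;> try exact h.elim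
    · exact h
    · exact h
  backtrack := by
    rintro ⟨a, _ | _⟩ ⟨c, _ | _⟩ ⟨d, _ | _⟩ h <;> try exact h.elim
    · have := Matches.eq_of_diag h
      rw [this]
      rfl
    · have := Matches.eq_of_eq hC h
      rw [this]
      rfl
  wheel := by
    rintro ⟨a, _ | _⟩ ⟨b, _ | _⟩ ⟨c, _ | _⟩ ⟨d, _ | _⟩ ⟨e, _ | _⟩ ⟨f, _ | _⟩ ⟨g, _ | _⟩ ⟨c', _ | _⟩
      ⟨d', _ | _⟩ h₁ h₂ h₃ <;>
      first | exact h₁.elim | exact h₂.elim | exact h₃.elim | skip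
    · rcases Matches.wheel_face hC h₁ h₂ h₃ with ⟨z, h⟩ | ⟨z, h, h'⟩ | ⟨z, h, h'⟩
      · exact .inl ⟨(z, false), h⟩
      · exact .inr (.inl ⟨(z, true), h, h'⟩)
      · exact .inr (.inr ⟨(z, true), h, h'⟩)
    · rcases Matches.wheel_vertex hT h₁ h₂ h₃ with ⟨z, h⟩ | ⟨z, h, h'⟩ | ⟨z, h, h'⟩
      · exact .inl ⟨(z, true), h⟩
      · exact .inr (.inl ⟨(z, false), h, h'⟩)
      · exact .inr (.inr ⟨(z, false), h, h'⟩)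

end TwoComplex
end SmallCancellation

namespace SmallCancellation

/-! ### Simple connectedness and the corner system -/

namespace TwoComplex

variable {X : TwoComplex.{u}}

open TwoComplex.Flag

theorem Flag.Twin.vert {x y : X.Flag} (h : x.Twin y) : x.vert = y.vert :=
  congrArg X.src (h.full.1 0)

theorem Flag.vert_eq_of_corner_eq {x y : X.Flag} (h : x.corner = y.corner) : x.vert = y.vert := by
  rcases twin_or_twin_rev h with h | h
  · exact h.vert
  · rw [← h.vert, vert_rev]

theorem Flag.exists_shift_corner {x y : X.Flag} (h : x.face = y.face) :
    ∃ n : ℕ, (x.shift n).corner = y.corner := by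
  have : ∃ n : ℤ, (x.shift n).corner = y.corner := by
    obtain ⟨f, i, b⟩ := x
    obtain ⟨g, j, c⟩ := y
    obtain rfl : f = g := h
    cases b
    · exact ⟨i - j, by simp [corner, shift, len]⟩
    · exact ⟨j - i, by simp [corner, shift, len]⟩
  obtain ⟨n, hn⟩ := this
  have hx := x.len_pos'
  refine ⟨(n % x.len).toNat, ?_⟩
  rw [← hn, corner_shift_eq_iff, Int.toNat_of_nonneg (Int.emod_nonneg _ hx.ne')]
  exact Int.dvd_self_sub_emod

theorem Flag.isWalk_path (x : X.Flag) (n : ℕ) :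
    X.IsWalk x.vert (x.shift n).vert (x.path n) := by
  induction n generalizing x with
  | zero =>
    rw [Nat.cast_zero, shift_zero]
    exact rfl
  | succ n ih =>
    rw [path_succ]
    refine ⟨rfl, ?_⟩
    have := ih (x.shift 1)
    rw [shift_shift] at this
    convert this using 1
    · rw [vert_shift, Graph.tgt]
      have := x.src_line_succ 0
      rw [zero_add] at this
      exact this.symm
    · push_cast
      rw [add_comm]

theorem isWalk_append {G : Graph.{u}} {a b c : G.V} {p q : List G.Dart} (hp : G.IsWalk a b p)
    (hq : G.IsWalk b c q) : G.IsWalk a c (p ++ q) := by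
  induction p generalizing a with
  | nil =>
    obtain rfl : a = b := hp
    exact hq
  | cons d p ih => exact ⟨hp.1, ih hp.2⟩

section Action

variable (hC : X.IsC 4) (hT : X.NoTriangle)

/-- Passing through a `2`-cell from one corner to another one. -/
def through (c d : X.Face × ℤ) : List ((X.Face × ℤ) × Bool) := [(c, true), (d, false)]

theorem through_self (c : X.Face × ℤ) :
    (cornerSystem hC hT).SameAct (through c c) [] :=
  SquareSystem.sameAct_backtrack (Q := cornerSystem hC hT) (c, true)

theorem through_trans (c d e : X.Face × ℤ) :
    (cornerSystem hC hT).SameAct (through c d ++ through d e) (through c e) := by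
  have := SquareSystem.sameAct_backtrack (Q := cornerSystem hC hT) (d, false)
  exact ((SquareSystem.SameAct.refl [(c, true)]).append this).append
    (SquareSystem.SameAct.refl [(e, false)])

theorem through_of_matches {c d c' d' : X.Face × ℤ} (h : X.Matches c d c' d') :
    (cornerSystem hC hT).SameAct (through c c') (through d d') :=
  SquareSystem.sameAct_sq (Q := cornerSystem hC hT) (a := (c, true)) (b := (c', false))
    (c := (d, true)) (d := (d', false)) h

theorem through_of_line_eq {x y : X.Flag} (h : x.line 0 = y.line 0) :
    (cornerSystem hC hT).SameAct (through x.corner (x.shift 1).corner)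
      (through y.corner (y.shift 1).corner) := by
  refine through_of_matches hC hT ?_
  have hg : x.Glued y 0 1 := by
    refine glued_of_agree (congrArg X.src h) fun t h₁ h₂ => ?_
    obtain rfl : t = 0 := by omega
    exact h
  simpa using matches_of_glued hg

variable (hedge : X.EveryEdgeInFace)

/-- A flag that starts along a given dart. -/
noncomputable def edgeFlag (d : X.Dart) : X.Flag :=
  (Flag.exists_of_attach (hedge d).choose_spec).choose

theorem line_edgeFlag (d : X.Dart) : (edgeFlag hedge d).line 0 = d :=
  (Flag.exists_of_attach (hedge d).choose_spec).choose_spec.2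

/-- A dart as a path through a `2`-cell that contains it. -/
noncomputable def dartWord (d : X.Dart) : List ((X.Face × ℤ) × Bool) :=
  through (edgeFlag hedge d).corner ((edgeFlag hedge d).shift 1).corner

theorem dartWord_line (x : X.Flag) : (cornerSystem hC hT).SameAct (dartWord hedge (x.line 0))
    (through x.corner (x.shift 1).corner) :=
  through_of_line_eq hC hT (line_edgeFlag hedge _)

theorem dartWord_rev (d : X.Dart) :
    (cornerSystem hC hT).SameAct (dartWord hedge d ++ dartWord hedge (X.rev d)) [] := by
  set x := edgeFlag hedge d with hx
  have h₁ : ((x.shift 1).rev).line 0 = X.rev d := by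
    rw [line_rev, line_shift, ← line_edgeFlag hedge d]
    rfl
  have h₂ := dartWord_line hC hT hedge ((x.shift 1).rev)
  rw [h₁, corner_rev] at h₂
  have h₃ : (((x.shift 1).rev).shift 1).corner = x.corner := by
    rw [rev_shift, shift_shift]
    simp
  rw [h₃] at h₂
  exact ((SquareSystem.SameAct.refl _).append h₂).trans
    ((through_trans hC hT _ _ _).trans (through_self hC hT _))

/-- Each dart may be replaced by a passage through the cell of `x`, and consecutive passages through
the same cell telescope. -/
theorem flatMap_path (x : X.Flag) (n : ℕ) :
    (cornerSystem hC hT).SameAct ((x.path n).flatMap (dartWord hedge))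
      (through x.corner (x.shift n).corner) := by
  induction n generalizing x with
  | zero =>
    rw [Nat.cast_zero, shift_zero]
    exact (through_self hC hT _).symm
  | succ n ih =>
    rw [path_succ, List.flatMap_cons]
    have := ih (x.shift 1)
    rw [shift_shift] at this
    have e : ((n + 1 : ℕ) : ℤ) = 1 + n := by push_cast; ring
    rw [e]
    exact ((dartWord_line hC hT hedge x).append this).trans (through_trans hC hT _ _ _)

theorem flatMap_boundaryPath (f : X.Face) (k : ZMod (X.len f)) :
    (cornerSystem hC hT).SameAct ((X.boundaryPath f k).flatMap (dartWord hedge)) [] := by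
  obtain ⟨i, rfl⟩ := ZMod.intCast_surjective k
  rw [← path_len_eq_boundaryPath]
  refine (flatMap_path hC hT hedge _ _).trans ?_
  have : ((⟨f, i, true⟩ : X.Flag).shift (X.len f)).corner = (⟨f, i, true⟩ : X.Flag).corner := by
    have := (corner_shift_eq_iff (⟨f, i, true⟩ : X.Flag) (s := X.len f) (t := 0)).2
      (by rw [zero_sub, dvd_neg]; exact dvd_rfl)
    rwa [shift_zero] at this
  rw [this]
  exact through_self hC hT _

/-- A boundary path telescopes to a full turn and a backtrack cancels, so insertions do not change
the action. -/
theorem flatMap_of_homotopic {a b : X.V} {p q : List X.Dart} (h : X.Homotopic a b p q) :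
    (cornerSystem hC hT).SameAct (p.flatMap (dartWord hedge)) (q.flatMap (dartWord hedge)) := by
  induction h with
  | rel p q h =>
    obtain ⟨-, -, l₁, c, l₂, rfl, rfl, hc⟩ := h
    rw [List.flatMap_append, List.flatMap_append, List.flatMap_append]
    refine SquareSystem.SameAct.append ?_ (.refl _)
    have hc' : (cornerSystem hC hT).SameAct (c.flatMap (dartWord hedge)) [] := by
      rcases hc with ⟨d, rfl⟩ | ⟨f, k, rfl⟩
      · simpa using dartWord_rev hC hT hedge d
      · exact flatMap_boundaryPath hC hT hedge f k
    simpa using (SquareSystem.SameAct.refl (l₁.flatMap (dartWord hedge))).append hc'.symm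
  | refl => exact .refl _
  | symm _ _ _ ih => exact ih.symm
  | trans _ _ _ _ _ ih₁ ih₂ => exact ih₁.trans ih₂

end Action

/-- The consequences of simple connectedness and of the small cancellation conditions: a `2`-cell
has no two corners at the same vertex, and the common vertices of two `2`-cells are joined by common
boundary paths. -/
structure IsThin (X : TwoComplex.{u}) : Prop where
  corner_eq : ∀ {x y : X.Flag}, x.face = y.face → x.vert = y.vert → x.corner = y.corner
  matches_of_vert : ∀ {x y x' y' : X.Flag}, x.face = x'.face → y.face = y'.face →
    x.vert = y.vert → x'.vert = y'.vert → x.vert ≠ x'.vert →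
    X.Matches x.corner y.corner x'.corner y'.corner

/-- A closed path on one boundary acts as a two-letter word; one that runs along two boundaries acts
as a four-letter word. Since both act trivially, the first word is a backtrack, so its corners
coincide, and the second gives two halves that are equal or bound a square. -/
theorem isThin (hX : X.IsSimplyConnected) (hC : X.IsC 4) (hT : X.NoTriangle)
    (hedge : X.EveryEdgeInFace) : X.IsThin where
  corner_eq := by
    intro x y hf hv
    obtain ⟨n, hn⟩ := exists_shift_corner hf
    have hw := x.isWalk_path n
    rw [vert_eq_of_corner_eq hn, ← hv] at hw
    have h := (flatMap_path hC hT hedge x n).symm.trans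
      (flatMap_of_homotopic hC hT hedge (hX.2.2 _ _ hw))
    rw [hn] at h
    exact (congrArg Prod.fst (SquareSystem.eq_inv_of_sameAct_nil h)).symm
  matches_of_vert := by
    intro x y x' y' hx hy hv hv' hne
    obtain ⟨n, hn⟩ := exists_shift_corner hx
    obtain ⟨m, hm⟩ := exists_shift_corner hy.symm
    have hw := isWalk_append (x.isWalk_path n) (c := x.vert) (q := y'.path m) (by
      have := y'.isWalk_path m
      rwa [vert_eq_of_corner_eq hm, ← hv, ← hv', ← vert_eq_of_corner_eq hn] at this)
    have h := flatMap_of_homotopic hC hT hedge (hX.2.2 _ _ hw)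
    rw [List.flatMap_append] at h
    have h₂ := ((flatMap_path hC hT hedge x n).append (flatMap_path hC hT hedge y' m)).symm.trans h
    rw [hn, hm] at h₂
    have h₃ : (cornerSystem hC hT).SameAct (through x.corner x'.corner)
        (through y.corner y'.corner) := by
      have h₄ := h₂.append (SquareSystem.SameAct.refl (Q := cornerSystem hC hT)
        (through y.corner y'.corner))
      have h₅ := (SquareSystem.SameAct.refl (Q := cornerSystem hC hT)
        (through x.corner x'.corner)).append ((through_trans hC hT y'.corner y.corner y'.corner).trans
          (through_self hC hT _))
      rw [← List.append_assoc, List.append_nil] at h₅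
      exact h₅.symm.trans h₄
    have n₁ : ∀ {c d : X.Face × ℤ}, c ≠ d → ((d, false) : (X.Face × ℤ) × Bool) ≠
        (cornerSystem hC hT).inv (c, true) :=
      fun h h' => h (congrArg Prod.fst h').symm
    have hc : x.corner ≠ x'.corner := fun h => hne (vert_eq_of_corner_eq h)
    have hd : y.corner ≠ y'.corner := fun h => hne (by
      rw [hv, hv', vert_eq_of_corner_eq h])
    -- In the second case the cells and corners are the same, and any boundary path between the two
    -- corners is a common path.
    rcases SquareSystem.sq_of_sameAct (n₁ hc) (n₁ hd) h₃ with h | ⟨h, h'⟩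
    · exact h
    · rw [← show x.corner = y.corner from congrArg Prod.fst h,
        ← show x'.corner = y'.corner from congrArg Prod.fst h']
      exact ⟨x, x, n, rfl, rfl, hn, hn, (Full.refl x).glued 0 n⟩

end TwoComplex
end SmallCancellation

namespace SmallCancellation

/-! ### Three polygons around a vertex -/

namespace Triad

variable (n : ZMod 3 → ℕ)

/-- The sides of three polygons. -/
abbrev Side : Type := Σ j : ZMod 3, ZMod (n j)

/-- The sides that are not incident to the vertex `0` of their polygon. -/
abbrev Outer : Type := {s : Side n // s.2 ≠ 0 ∧ s.2 ≠ -1}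

variable {n}

/-- The following side. -/
def next (s : Side n) : Side n := ⟨s.1, s.2 + 1⟩

variable (hn : ∀ j, 3 ≤ n j)

include hn in
theorem natCast_ne_zero (j : ZMod 3) {k : ℕ} (h₀ : 0 < k) (h₃ : k < 3) :
    (k : ZMod (n j)) ≠ 0 := by
  intro h
  have := Nat.le_of_dvd h₀ ((ZMod.natCast_eq_zero_iff k (n j)).1 h)
  have := hn j
  omega

include hn in
theorem one_ne_zero' (j : ZMod 3) : (1 : ZMod (n j)) ≠ 0 := by
  simpa using natCast_ne_zero hn j (k := 1) (by omega) (by omega)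

include hn in
theorem two_ne_zero' (j : ZMod 3) : (2 : ZMod (n j)) ≠ 0 := by
  simpa using natCast_ne_zero hn j (k := 2) (by omega) (by omega)

include hn in
theorem one_ne_neg_one (j : ZMod 3) : (1 : ZMod (n j)) ≠ -1 := by
  intro h
  refine two_ne_zero' hn j ?_
  linear_combination h

include hn in
theorem neg_two_ne_neg_one (j : ZMod 3) : (-2 : ZMod (n j)) ≠ -1 := by
  intro h
  refine one_ne_zero' hn j ?_
  linear_combination -h

/-- The first outer side of a polygon. -/
def first (j : ZMod 3) : Outer n := ⟨⟨j, 1⟩, one_ne_zero' hn j, one_ne_neg_one hn j⟩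

/-- The last outer side of a polygon. -/
def last (j : ZMod 3) : Outer n :=
  ⟨⟨j, -2⟩, neg_ne_zero.2 (two_ne_zero' hn j), neg_two_ne_neg_one hn j⟩

/-- The initial vertex of a side: the centre is `none`, and the vertex `-1` of a polygon is the
vertex `1` of the preceding one. -/
def vtx (s : Side n) : Option (Outer n) :=
  if h₀ : s.2 = 0 then none else if h₁ : s.2 = -1 then some (first hn (s.1 - 1))
  else some ⟨s, h₀, h₁⟩

/-- The reverses of the darts.  The dart `inl s` has its polygon on the left, the dart `inr s` has
the outer face on its left. -/
def rev : Side n ⊕ Outer n → Side n ⊕ Outer n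
  | .inl s => if h₀ : s.2 = 0 then .inl ⟨s.1 + 1, -1⟩ else
      if h₁ : s.2 = -1 then .inl ⟨s.1 - 1, 0⟩ else .inr ⟨s, h₀, h₁⟩
  | .inr s => .inl s

/-- The initial vertex of a dart. -/
def src : Side n ⊕ Outer n → Option (Outer n)
  | .inl s => vtx hn s
  | .inr s => vtx hn (next s)

/-- The next dart along the boundary of the face on the left. -/
def turn : Side n ⊕ Outer n → Side n ⊕ Outer n
  | .inl s => .inl (next s)
  | .inr s => if h : s.1.2 = 1 then .inr (last hn (s.1.1 + 1)) else
      .inr ⟨⟨s.1.1, s.1.2 - 1⟩, sub_ne_zero.2 h, fun h' => s.2.1 (by linear_combination h')⟩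

/-- The previous dart along the boundary of the face on the left. -/
def turnBack : Side n ⊕ Outer n → Side n ⊕ Outer n
  | .inl s => .inl ⟨s.1, s.2 - 1⟩
  | .inr s => if h : s.1.2 = -2 then .inr (first hn (s.1.1 - 1)) else
      .inr ⟨⟨s.1.1, s.1.2 + 1⟩, fun h' => s.2.2 (by linear_combination h'),
        fun h' => h (by linear_combination h')⟩

theorem vtx_zero (j : ZMod 3) : vtx hn ⟨j, 0⟩ = none := by simp [vtx]

include hn in
theorem neg_one_ne_zero (j : ZMod 3) : (-1 : ZMod (n j)) ≠ 0 := neg_ne_zero.2 (one_ne_zero' hn j)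

theorem vtx_neg_one (j : ZMod 3) : vtx hn ⟨j, -1⟩ = some (first hn (j - 1)) := by
  simp [vtx, neg_one_ne_zero hn j]

theorem vtx_outer (s : Outer n) : vtx hn s = some s := by
  rw [vtx, dif_neg s.2.1, dif_neg s.2.2]

theorem vtx_eq_none {s : Side n} : vtx hn s = none ↔ s.2 = 0 := by
  unfold vtx
  split_ifs <;> simp_all

theorem rev_zero (j : ZMod 3) : rev (.inl (⟨j, 0⟩ : Side n)) = .inl ⟨j + 1, -1⟩ := by simp [rev]

theorem rev_neg_one (j : ZMod 3) (hn : ∀ j, 3 ≤ n j) :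
    rev (.inl (⟨j, -1⟩ : Side n)) = .inl ⟨j - 1, 0⟩ := by
  simp [rev, neg_one_ne_zero hn j]

theorem rev_outer (s : Outer n) : rev (.inl s.1) = .inr s := by
  simp [rev, s.2.1, s.2.2]

/-- The three kinds of sides. -/
theorem side_cases {P : Side n → Prop} (h₀ : ∀ j, P ⟨j, 0⟩) (h₁ : ∀ j, P ⟨j, -1⟩)
    (h₂ : ∀ s : Outer n, P s) (s : Side n) : P s := by
  obtain ⟨j, i⟩ := s
  by_cases h : i = 0
  · rw [h]; exact h₀ j
  by_cases h' : i = -1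
  · rw [h']; exact h₁ j
  exact h₂ ⟨⟨j, i⟩, h, h'⟩

include hn in
theorem rev_rev (d : Side n ⊕ Outer n) : rev (rev d) = d := by
  rcases d with s | s
  · induction s using side_cases with
    | h₀ j =>
      rw [rev_zero, rev_neg_one _ hn]
      exact congrArg (fun j => Sum.inl (⟨j, 0⟩ : Side n)) (add_sub_cancel_right j 1)
    | h₁ j =>
      rw [rev_neg_one _ hn, rev_zero]
      exact congrArg (fun j => Sum.inl (⟨j, -1⟩ : Side n)) (sub_add_cancel j 1)
    | h₂ s =>
      rw [rev_outer]
      rfl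
  · exact rev_outer s

theorem rev_inl_ne (j : ZMod 3) (i k : ZMod (n j)) :
    rev (.inl (⟨j, i⟩ : Side n)) ≠ .inl ⟨j, k⟩ := by
  have h3 : ∀ j : ZMod 3, j + 1 ≠ j ∧ j - 1 ≠ j := by decide
  simp only [rev]
  split_ifs
  · intro h
    exact (h3 j).1 (congrArg Sigma.fst (Sum.inl_injective h))
  · intro h
    exact (h3 j).2 (congrArg Sigma.fst (Sum.inl_injective h))
  · simp

theorem rev_ne (d : Side n ⊕ Outer n) : rev d ≠ d := by
  rcases d with s | s
  · exact rev_inl_ne s.1 s.2 s.2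
  · simp [rev]

theorem turn_first (j : ZMod 3) : turn hn (.inr (first hn j)) = .inr (last hn (j + 1)) :=
  dif_pos rfl

theorem turnBack_last (j : ZMod 3) : turnBack hn (.inr (last hn j)) = .inr (first hn (j - 1)) :=
  dif_pos rfl

theorem turnBack_turn (d : Side n ⊕ Outer n) : turnBack hn (turn hn d) = d := by
  rcases d with s | ⟨⟨j, i⟩, h₀, h₁⟩
  · simp [turn, turnBack, next]
  · by_cases h : i = 1
    · subst h
      refine (congrArg _ (turn_first hn j)).trans ((turnBack_last hn _).trans ?_)
      exact congrArg (fun j => Sum.inr (first hn j)) (add_sub_cancel_right j 1)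
    · have h' : i - 1 ≠ -2 := fun h' => h₁ (by linear_combination h')
      simp [turn, turnBack, h, h']

theorem turn_turnBack (d : Side n ⊕ Outer n) : turn hn (turnBack hn d) = d := by
  rcases d with s | ⟨⟨j, i⟩, h₀, h₁⟩
  · simp [turn, turnBack, next]
  · by_cases h : i = -2
    · subst h
      refine (congrArg _ (turnBack_last hn j)).trans ((turn_first hn _).trans ?_)
      exact congrArg (fun j => Sum.inr (last hn j)) (sub_add_cancel j 1)
    · have h' : i + 1 ≠ 1 := fun h' => h₀ (by linear_combination h')
      simp [turn, turnBack, h, h']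

/-- Turning clockwise around the initial vertex does not change it. -/
theorem src_turn_rev (d : Side n ⊕ Outer n) : src hn (turn hn (rev d)) = src hn d := by
  rcases d with s | s
  · induction s using side_cases with
    | h₀ j =>
      rw [rev_zero]
      simp [turn, next, src, vtx_zero]
    | h₁ j =>
      rw [rev_neg_one _ hn]
      have : turn hn (.inl ⟨j - 1, 0⟩) = .inl (first hn (j - 1)).1 := by
        simp [turn, next, first]
      rw [this]
      exact (vtx_outer hn _).trans (vtx_neg_one hn j).symm
    | h₂ s =>
      rw [rev_outer]
      obtain ⟨⟨j, i⟩, h₀, h₁⟩ := s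
      by_cases h : i = 1
      · subst h
        refine (congrArg _ (turn_first hn j)).trans ?_
        have : next (last hn (j + 1)).1 = ⟨j + 1, -1⟩ := by
          refine congrArg (Sigma.mk (j + 1)) ?_
          change (-2 : ZMod (n (j + 1))) + 1 = -1
          ring
        change vtx hn (next (last hn (j + 1)).1) = vtx hn (first hn j).1
        rw [this, vtx_neg_one, vtx_outer]
        exact congrArg (fun j => some (first hn j)) (add_sub_cancel_right j 1)
      · simp [turn, h, src, next]
  · rfl

/-- The union of three polygons around a vertex. -/
def complex : TwoComplex.{0} where
  V := Option (Outer n)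
  Dart := Side n ⊕ Outer n
  src := src hn
  rev := rev
  rev_rev := rev_rev hn
  rev_ne := rev_ne
  Face := ZMod 3
  len := n
  len_pos j := by have := hn j; omega
  side j i := .inl ⟨j, i⟩
  side_chain j i := by
    have := src_turn_rev hn (rev (.inl ⟨j, i⟩))
    rw [rev_rev hn] at this
    exact this
  side_immersed j i := (rev_inl_ne j i (i + 1)).symm

/-- Turning along the boundary of the face on the left, as a permutation. -/
def turnPerm : Equiv.Perm (Side n ⊕ Outer n) :=
  ⟨turn hn, turnBack hn, turnBack_turn hn, turn_turnBack hn⟩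

/-- Each polygon is embedded in the diagram, so two lifts of a path to the same polygon coincide and
do not make it a piece. -/
theorem attach_injective (j : ZMod 3) : Function.Injective ((complex hn).attach j) := by
  have key : ∀ i k : ZMod (n j), (Sum.inl ⟨j, i⟩ : Side n ⊕ Outer n) = .inl ⟨j, k⟩ → i = k := by
    intro i k h
    simpa using h
  rintro ⟨i, b⟩ ⟨k, c⟩ h
  cases b <;> cases c
  · have h' := congrArg rev (show rev (.inl (⟨j, i⟩ : Side n)) = rev (.inl ⟨j, k⟩) from h)
    exact congrArg (·, false) (key i k
      ((rev_rev hn (.inl ⟨j, i⟩)).symm.trans (h'.trans (rev_rev hn (.inl ⟨j, k⟩)))))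
  · exact (rev_inl_ne j i k h).elim
  · exact (rev_inl_ne j k i h.symm).elim
  · rw [key i k h]

theorem reach (j : ZMod 3) (k : ℕ) :
    (∃ p, (complex hn).IsWalk (none : Option (Outer n)) (vtx hn ⟨j, k⟩) p) ∧
      ∃ p, (complex hn).IsWalk (vtx hn ⟨j, k⟩) (none : Option (Outer n)) p := by
  have tgt : ∀ s : Side n, src hn (rev (.inl s)) = vtx hn (next s) := by
    intro s
    have := src_turn_rev hn (rev (.inl s))
    rw [rev_rev hn] at this
    exact this.symm
  induction k with
  | zero =>
    rw [Nat.cast_zero, vtx_zero]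
    exact ⟨⟨[], rfl⟩, ⟨[], rfl⟩⟩
  | succ k ih =>
    obtain ⟨⟨p, hp⟩, q, hq⟩ := ih
    push_cast
    have hw : (complex hn).IsWalk (vtx hn ⟨j, k⟩) (vtx hn ⟨j, k + 1⟩)
        [(Sum.inl ⟨j, k⟩ : Side n ⊕ Outer n)] := ⟨rfl, tgt ⟨j, k⟩⟩
    refine ⟨⟨_, TwoComplex.isWalk_append hp hw⟩,
      rev (.inl (⟨j, k⟩ : Side n)) :: q, tgt _, ?_⟩
    have : (complex hn).tgt (rev (.inl (⟨j, k⟩ : Side n))) = vtx hn ⟨j, k⟩ :=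
      congrArg (src hn) (rev_rev hn _)
    rwa [this]

theorem exists_vtx (v : Option (Outer n)) : ∃ (j : ZMod 3) (k : ℕ), vtx hn ⟨j, k⟩ = v := by
  rcases v with _ | s
  · exact ⟨0, 0, by rw [Nat.cast_zero, vtx_zero]⟩
  · have : NeZero (n s.1.1) := ⟨by have := hn s.1.1; omega⟩
    refine ⟨s.1.1, s.1.2.val, ?_⟩
    rw [ZMod.natCast_zmod_val]
    exact vtx_outer hn s

theorem complex_connected : (complex hn).Connected := by
  intro a b
  obtain ⟨j, k, rfl⟩ := exists_vtx hn a
  obtain ⟨j', k', rfl⟩ := exists_vtx hn b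
  obtain ⟨p, hp⟩ := (reach hn j k).2
  obtain ⟨q, hq⟩ := (reach hn j' k').1
  exact ⟨p ++ q, TwoComplex.isWalk_append hp hq⟩

/-- Reversal of darts, as a permutation. -/
def flipPerm : Equiv.Perm (Side n ⊕ Outer n) := ⟨rev, rev, rev_rev hn, rev_rev hn⟩

/-- The inverse of the rotation: turning clockwise around the initial vertex. -/
def unrot : Equiv.Perm (Side n ⊕ Outer n) := turnPerm hn * flipPerm hn

theorem unrot_apply (d : Side n ⊕ Outer n) : unrot hn d = turn hn (rev d) := rfl

theorem sameCycle_center (j : ZMod 3) :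
    (unrot hn).SameCycle (.inl ⟨j, 0⟩) (.inl ⟨0, 0⟩) := by
  have step : ∀ j, (unrot hn).SameCycle (.inl ⟨j, 0⟩) (.inl ⟨j + 1, 0⟩) := by
    intro j
    refine ⟨1, ?_⟩
    rw [zpow_one, unrot_apply, rev_zero]
    simp [turn, next]
  have h0 := step 0
  have h1 := step 1
  have h2 := step 2
  fin_cases j
  · exact .refl _ _
  · exact h1.trans h2
  · exact h2

/-- A standard dart at each vertex: the side `0` of the polygon `0` at the centre, and elsewhere the
outer side that names the vertex. -/
theorem sameCycle_rep (d : Side n ⊕ Outer n) :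
    (unrot hn).SameCycle d ((src hn d).elim (.inl ⟨0, 0⟩) fun s => .inl s.1) := by
  have side : ∀ s : Side n, (unrot hn).SameCycle (.inl s)
      ((vtx hn s).elim (.inl ⟨0, 0⟩) fun s => .inl s.1) := by
    intro s
    induction s using side_cases with
    | h₀ j =>
      rw [vtx_zero]
      exact sameCycle_center hn j
    | h₁ j =>
      rw [vtx_neg_one]
      refine ⟨1, ?_⟩
      rw [zpow_one, unrot_apply, rev_neg_one _ hn]
      simp [turn, next, first]
    | h₂ s =>
      rw [vtx_outer]
      exact .refl _ _
  rcases d with s | s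
  · exact side s
  · exact Equiv.Perm.SameCycle.trans ⟨1, rfl⟩ (side (next s))

theorem sameCycle_iff (a b : Side n ⊕ Outer n) :
    (unrot hn).SameCycle a b ↔ src hn a = src hn b := by
  constructor
  · rintro ⟨k, rfl⟩
    have h : ∀ d, src hn (unrot hn d) = src hn d := src_turn_rev hn
    have h' : ∀ d, src hn ((unrot hn)⁻¹ d) = src hn d := fun d => by
      rw [← h, ← Equiv.Perm.mul_apply, mul_inv_cancel, Equiv.Perm.one_apply]
    induction k with
    | zero => rfl
    | succ k ih => rw [add_comm, zpow_add, zpow_one, Equiv.Perm.mul_apply, h, ih]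
    | pred k ih =>
      rw [show (-(k : ℤ) - 1) = -1 + -(k : ℤ) by ring, zpow_add, zpow_neg_one,
        Equiv.Perm.mul_apply, h', ih]
  · intro h
    have := sameCycle_rep hn a
    rw [h] at this
    exact this.trans (sameCycle_rep hn b).symm

/-- Along the outer face the index of the side decreases to `1`; then the last outer side of the
next polygon follows. In this way all three polygons are visited. -/
theorem turn_outer (s : Outer n) :
    (turnPerm hn).SameCycle (.inr s) (.inr (first hn 0)) := by
  have down : ∀ (k : ℕ) (j : ZMod 3) (h : ((k : ℕ) + 1 : ZMod (n j)) ≠ 0 ∧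
      ((k : ℕ) + 1 : ZMod (n j)) ≠ -1), k + 1 < n j →
      (turnPerm hn).SameCycle (.inr ⟨⟨j, k + 1⟩, h⟩) (.inr (first hn j)) := by
    intro k j
    induction k with
    | zero =>
      intro h hk
      have : (⟨⟨j, ((0 : ℕ) : ZMod (n j)) + 1⟩, h⟩ : Outer n) = first hn j :=
        Subtype.ext (congrArg (Sigma.mk j) (by simp))
      rw [this]
    | succ k ih =>
      intro h hk
      have h₀ : ((k : ℕ) + 1 : ZMod (n j)) ≠ 0 := by
        intro h'
        have := (ZMod.natCast_eq_zero_iff (k + 1) (n j)).1 (by exact_mod_cast h')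
        have := Nat.le_of_dvd (by omega) this
        omega
      have h₁ : ((k : ℕ) + 1 : ZMod (n j)) ≠ -1 := by
        intro h'
        refine h.1 ?_
        push_cast
        linear_combination h'
      refine Equiv.Perm.SameCycle.trans ⟨1, ?_⟩ (ih ⟨h₀, h₁⟩ (by omega))
      have h₂ : ((k + 1 : ℕ) + 1 : ZMod (n j)) ≠ 1 := by
        intro h'
        refine h₀ ?_
        push_cast at h'
        linear_combination h'
      rw [zpow_one]
      refine (dif_neg h₂).trans ?_
      congr 3
      push_cast
      ring
  have tofirst : ∀ s : Outer n, (turnPerm hn).SameCycle (.inr s) (.inr (first hn s.1.1)) := by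
    rintro ⟨⟨j, i⟩, h₀, h₁⟩
    have : NeZero (n j) := ⟨by have := hn j; omega⟩
    obtain ⟨k, hk, rfl⟩ : ∃ k : ℕ, k < n j ∧ (k : ZMod (n j)) = i :=
      ⟨i.val, ZMod.val_lt i, ZMod.natCast_zmod_val i⟩
    obtain _ | k := k
    · simp at h₀
    · have := down k j ⟨by exact_mod_cast h₀, by exact_mod_cast h₁⟩ hk
      convert this using 4
      push_cast
      rfl
  have step : ∀ j, (turnPerm hn).SameCycle (.inr (first hn j)) (.inr (first hn (j + 1))) := by
    intro j
    refine Equiv.Perm.SameCycle.trans ⟨1, ?_⟩ (tofirst (last hn (j + 1)))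
    rw [zpow_one]
    exact turn_first hn j
  refine (tofirst s).trans ?_
  have h1 := step 1
  have h2 := step 2
  generalize s.1.1 = j
  fin_cases j
  · exact .refl _ _
  · exact h1.trans h2
  · exact h2

-- The sides `0` and `-1` of each polygon are the six that meet the centre. This count is the input
-- to Euler's formula.
include hn in
theorem card_side [∀ j, NeZero (n j)] : Nat.card (Side n) = Nat.card (Outer n) + 6 := by
  have e : Outer n ⊕ (ZMod 3 ⊕ ZMod 3) ≃ Side n := by
    refine Equiv.ofBijective
      (Sum.elim Subtype.val (Sum.elim (fun j => ⟨j, 0⟩) fun j => ⟨j, -1⟩)) ⟨?_, ?_⟩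
    · rintro (s | j | j) (t | k | k) h
      · rw [Subtype.ext h]
      · exact absurd (by simp only [Sum.elim_inl, Sum.elim_inr] at h; rw [h]) s.2.1
      · exact absurd (by simp only [Sum.elim_inl, Sum.elim_inr] at h; rw [h]) s.2.2
      · exact absurd (by simp only [Sum.elim_inl, Sum.elim_inr] at h; rw [← h]) t.2.1
      · obtain rfl : j = k := congrArg Sigma.fst h
        rfl
      · obtain rfl : j = k := congrArg Sigma.fst h
        have : (0 : ZMod (n j)) = -1 := by simpa using h
        exact absurd this.symm (neg_one_ne_zero hn j)
      · exact absurd (by simp only [Sum.elim_inl, Sum.elim_inr] at h; rw [← h]) t.2.2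
      · obtain rfl : j = k := congrArg Sigma.fst h
        have : (-1 : ZMod (n j)) = 0 := by simpa using h
        exact absurd this (neg_one_ne_zero hn j)
      · obtain rfl : j = k := congrArg Sigma.fst h
        rfl
    · intro s
      induction s using side_cases with
      | h₀ j => exact ⟨.inr (.inl j), rfl⟩
      | h₁ j => exact ⟨.inr (.inr j), rfl⟩
      | h₂ s => exact ⟨.inl s, rfl⟩
  rw [← Nat.card_congr e, Nat.card_sum, Nat.card_sum, Nat.card_zmod]

/-- The disc diagram that consists of three polygons around a vertex. -/
def diagram : DiscDiagram where
  cx := complex hn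
  finite_V := by
    have : ∀ j, NeZero (n j) := fun j => ⟨by have := hn j; omega⟩
    exact inferInstanceAs (Finite (Option (Outer n)))
  finite_Dart := by
    have : ∀ j, NeZero (n j) := fun j => ⟨by have := hn j; omega⟩
    exact inferInstanceAs (Finite (Side n ⊕ Outer n))
  finite_Face := inferInstanceAs (Finite (ZMod 3))
  connected := complex_connected hn
  rot := (unrot hn : Equiv.Perm (Side n ⊕ Outer n))⁻¹
  rot_cycles a b :=
    Equiv.Perm.sameCycle_inv.trans (sameCycle_iff hn a b)
  ccw _ := true
  face_step f k := by
    have h : ∀ s : Side n, (unrot hn)⁻¹⁻¹ (rev (.inl s)) = .inl (next s) := by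
      intro s
      rw [inv_inv, unrot_apply, rev_rev hn]
      rfl
    exact (h ⟨f, k⟩).symm
  face_inj := by
    rintro ⟨f, k⟩ ⟨g, l⟩ h
    exact Sum.inl_injective h
  outer_cycle a b ha hb := by
    have h : (unrot hn)⁻¹⁻¹ * flipPerm hn = turnPerm hn := by
      ext d
      exact congrArg (turn hn) (rev_rev hn d)
    change ((unrot hn)⁻¹⁻¹ * flipPerm hn).SameCycle a b
    rw [h]
    rcases a with ⟨j, i⟩ | s
    · exact absurd rfl (ha j i)
    rcases b with ⟨j, i⟩ | t
    · exact absurd rfl (hb j i)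
    exact (turn_outer hn s).trans (turn_outer hn t).symm
  outer_exists _ := ⟨.inr (first hn 0), fun f k h => by cases h⟩
  euler := by
    have : ∀ j, NeZero (n j) := fun j => ⟨by have := hn j; omega⟩
    change 2 * Nat.card (Option (Outer n)) + 2 * Nat.card (ZMod 3) =
      Nat.card (Side n ⊕ Outer n) + 2
    rw [Finite.card_option, Nat.card_sum, card_side hn, Nat.card_zmod]
    ring

theorem src_eq_none {d : Side n ⊕ Outer n} : src hn d = none ↔ ∃ j, d = .inl ⟨j, 0⟩ := by
  constructor
  · rcases d with ⟨j, i⟩ | s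
    · intro h
      obtain rfl : i = 0 := (vtx_eq_none hn).1 h
      exact ⟨j, rfl⟩
    · intro h
      have h' : s.1.2 + 1 = 0 := (vtx_eq_none hn).1 h
      exact absurd (eq_neg_of_add_eq_zero_left h') s.2.2
  · rintro ⟨j, rfl⟩
    exact vtx_zero hn j

theorem isInternal_center : (diagram hn).IsInternal (none : Option (Outer n)) := by
  refine ⟨⟨.inl ⟨0, 0⟩, vtx_zero hn 0⟩, fun d hd => ?_⟩
  obtain ⟨j, rfl⟩ := (src_eq_none hn).1 hd
  exact ⟨j, 0, rfl⟩

theorem valence_center : (complex hn).valence (none : Option (Outer n)) = 3 := by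
  change Nat.card {d : Side n ⊕ Outer n // src hn d = none} = 3
  conv_rhs => rw [← Nat.card_zmod 3]
  refine Nat.card_congr (Equiv.ofBijective
    (fun j => ⟨.inl ⟨j, 0⟩, vtx_zero hn j⟩) ⟨fun j k h => ?_, ?_⟩).symm
  · exact congrArg Sigma.fst (Sum.inl_injective (congrArg Subtype.val h))
  · rintro ⟨d, hd⟩
    obtain ⟨j, rfl⟩ := (src_eq_none hn).1 hd
    exact ⟨j, rfl⟩

end Triad
end SmallCancellation

namespace SmallCancellation
namespace Triad

/-! ### The map of the diagram -/

section Map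

variable {X : TwoComplex.{u}}

open TwoComplex TwoComplex.Flag

variable (a : ZMod 3 → X.Flag)

/-- The dart of `X` to which a side is mapped. -/
def lineOf (s : Side fun j => (a j).len) : X.Dart := (a s.1).line (s.2.cast : ℤ)

theorem lineOf_intCast (j : ZMod 3) (t : ℤ) : lineOf a ⟨j, (t : ZMod (a j).len)⟩ = (a j).line t := by
  refine line_congr _ ?_
  rw [← ZMod.intCast_eq_intCast_iff_dvd_sub]
  simp

/-- The rotation of a polygon. -/
def polyShift (m : ℕ) (c : ZMod m) : Graph.Iso (polygon m) (polygon m) where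
  onV := (Equiv.addLeft c : ZMod m ≃ ZMod m)
  onDart := ((Equiv.addLeft c : ZMod m ≃ ZMod m).prodCongr (Equiv.refl Bool) :
    ZMod m × Bool ≃ ZMod m × Bool)
  src_onDart := by
    rintro ⟨k, b⟩
    cases b
    · exact show c + (k : ZMod m) + 1 = c + (k + 1) from add_assoc _ _ _
    · rfl
  rev_onDart := fun _ => rfl

/-- The reflection of a polygon. -/
def polyReflect (m : ℕ) (c : ZMod m) : Graph.Iso (polygon m) (polygon m) where
  onV := (Equiv.subLeft c : ZMod m ≃ ZMod m)
  onDart := ((Equiv.subLeft (c - 1) : ZMod m ≃ ZMod m).prodCongr Equiv.boolNot :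
    ZMod m × Bool ≃ ZMod m × Bool)
  src_onDart := by
    rintro ⟨k, b⟩
    have h₁ (k : ZMod m) : c - 1 - k = c - (k + 1) := by ring
    have h₂ (k : ZMod m) : c - 1 - k + 1 = c - k := by ring
    cases b
    · exact h₁ k
    · exact h₂ k
  rev_onDart := fun _ => rfl

/-- The polygon of a flag, parametrized from its corner in its direction. -/
def polyIso : (x : X.Flag) → Graph.Iso (polygon x.len) (polygon (X.len x.face))
  | ⟨f, i, true⟩ => polyShift (X.len f) i
  | ⟨f, i, false⟩ => polyReflect (X.len f) i

theorem polyIso_intCast (x : X.Flag) (t : ℤ) :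
    (polyIso x).onDart ((t : ZMod x.len), true) = x.polyDart t := by
  obtain ⟨f, i, b⟩ := x
  cases b
  · rw [polyDart_false f i t _ rfl]
    refine congrArg (fun z : ZMod (X.len f) => (z, false)) ?_
    push_cast
    rfl
  · rw [polyDart_true f i t _ rfl]
    refine congrArg (fun z : ZMod (X.len f) => (z, true)) ?_
    push_cast
    rfl

theorem attach_polyIso (j : ZMod 3) (i : ZMod (a j).len) :
    X.attach (a j).face ((polyIso (a j)).onDart (i, true)) = lineOf a ⟨j, i⟩ := by
  obtain ⟨t, rfl⟩ := ZMod.intCast_surjective i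
  rw [lineOf_intCast]
  exact congrArg _ (polyIso_intCast (a j) t)

theorem attach_polyIso_false (j : ZMod 3) (i : ZMod (a j).len) :
    X.attach (a j).face ((polyIso (a j)).onDart (i, false)) = X.rev (lineOf a ⟨j, i⟩) := by
  have h₁ := X.attach_rev (a j).face ((polyIso (a j)).onDart (i, true))
  have h₂ := (polyIso (a j)).rev_onDart (i, true)
  exact (congrArg _ h₂.symm).trans (h₁.trans (congrArg _ (attach_polyIso a j i)))

variable {a}
variable (h3 : ∀ j, 3 ≤ (a j).len) (h : ∀ j, (a j).line 0 = (a (j + 1)).rev.line 0)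

include h in
theorem rev_line_zero (j : ZMod 3) : X.rev ((a j).line 0) = (a (j + 1)).line (-1) := by
  rw [h, line_rev, X.rev_rev]
  rfl

theorem lineOf_zero (j : ZMod 3) : lineOf a ⟨j, 0⟩ = (a j).line 0 := by
  simpa using lineOf_intCast a j 0

theorem lineOf_neg_one (j : ZMod 3) : lineOf a ⟨j, -1⟩ = (a j).line (-1) := by
  simpa using lineOf_intCast a j (-1)

theorem src_lineOf_next (s : Side fun j => (a j).len) :
    X.src (lineOf a (next s)) = X.src (X.rev (lineOf a s)) := by
  obtain ⟨j, i⟩ := s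
  obtain ⟨t, rfl⟩ := ZMod.intCast_surjective i
  have := lineOf_intCast a j (t + 1)
  push_cast at this
  rw [next, this, lineOf_intCast]
  exact (a j).src_line_succ t

/-- The map of the diagram on darts. -/
def mapDart : (Side fun j => (a j).len) ⊕ (Outer fun j => (a j).len) → X.Dart
  | .inl s => lineOf a s
  | .inr s => X.rev (lineOf a s.1)

include h3 h in
theorem mapDart_rev (d : (Side fun j => (a j).len) ⊕ (Outer fun j => (a j).len)) :
    X.rev (mapDart d) = mapDart (rev d) := by
  rcases d with s | s
  · induction s using side_cases with
    | h₀ j =>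
      rw [rev_zero]
      change X.rev (lineOf a _) = lineOf a _
      rw [lineOf_zero, lineOf_neg_one, rev_line_zero h]
    | h₁ j =>
      rw [rev_neg_one _ h3]
      change X.rev (lineOf a _) = lineOf a _
      have := rev_line_zero h (j - 1)
      rw [sub_add_cancel] at this
      rw [lineOf_zero, lineOf_neg_one, ← this, X.rev_rev]
    | h₂ s => rw [rev_outer]; rfl
  · exact X.rev_rev _

/-- The map of the diagram on vertices. -/
def mapVertex : Option (Outer fun j => (a j).len) → X.V
  | none => (a 0).vert
  | some s => X.src (lineOf a s.1)

include h3 h in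
theorem src_mapDart (d : (Side fun j => (a j).len) ⊕ (Outer fun j => (a j).len)) :
    X.src (mapDart d) = mapVertex (src h3 d) := by
  have key : ∀ s : Side fun j => (a j).len, X.src (lineOf a s) = mapVertex (vtx h3 s) := by
    intro s
    induction s using side_cases with
    | h₀ j =>
      rw [vtx_zero, lineOf_zero]
      have step : ∀ j, (a j).vert = (a (j + 1)).vert := fun j => by
        rw [← vert_rev (a (j + 1)), vert, h j]
        rfl
      have s1 := step 1
      have s2 := step 2
      change (a j).vert = (a 0).vert
      fin_cases j
      · rfl
      · exact s1.trans s2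
      · exact s2
    | h₁ j =>
      rw [vtx_neg_one, lineOf_neg_one]
      change _ = X.src (lineOf a ⟨j - 1, 1⟩)
      have h₁ := lineOf_intCast a (j - 1) 1
      rw [Int.cast_one] at h₁
      have h₂ := rev_line_zero h (j - 1)
      rw [sub_add_cancel] at h₂
      have h₃ := (a (j - 1)).src_line_succ 0
      rw [zero_add] at h₃
      rw [h₁, ← h₂, h₃]
    | h₂ s =>
      rw [vtx_outer]
      rfl
  rcases d with s | s
  · exact key s
  · exact (src_lineOf_next s.1).symm.trans (key (next s.1))

include h in
theorem attach_polyIso_eq (j : ZMod 3) (s : ZMod (a j).len × Bool) :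
    X.attach (a j).face ((polyIso (a j)).onDart s) = mapDart ((complex h3).attach j s) := by
  obtain ⟨i, b⟩ := s
  cases b
  · exact (attach_polyIso_false a j i).trans (mapDart_rev h3 h (.inl ⟨j, i⟩))
  · exact attach_polyIso a j i

/-- The map from the diagram to the complex. -/
def map : Hom (complex h3) X where
  onV := mapVertex
  onDart := mapDart
  onFace j := (a j).face
  src_onDart := src_mapDart h3 h
  rev_onDart := mapDart_rev h3 h
  face_iso := fun (j : ZMod 3) => ⟨polyIso (a j), attach_polyIso_eq h3 h j⟩

theorem isWalk_map {G H : Graph} (g : Graph.Iso G H) {v w : G.V} {p : List G.Dart}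
    (hp : G.IsWalk v w p) : H.IsWalk (g.onV v) (g.onV w) (p.map g.onDart) := by
  induction p generalizing v with
  | nil => exact congrArg g.onV hp
  | cons d p ih =>
    refine ⟨by rw [g.src_onDart, hp.1], ?_⟩
    have := ih hp.2
    rwa [Graph.tgt, ← g.src_onDart, ← g.rev_onDart] at this

theorem polyIso_intCast_false (x : X.Flag) (t : ℤ) :
    (polyIso x).onDart ((t : ZMod x.len), false) = x.rev.polyDart (-1 - t) := by
  obtain ⟨f, i, b⟩ := x
  cases b
  · change _ = (⟨f, i, true⟩ : X.Flag).polyDart _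
    rw [polyDart_true f i _ _ rfl]
    refine congrArg (fun z : ZMod (X.len f) => (z, true)) ?_
    push_cast
    exact show (i : ZMod (X.len f)) - 1 - t = i + (-1 - t) by ring
  · change _ = (⟨f, i, false⟩ : X.Flag).polyDart _
    rw [polyDart_false f i _ _ rfl]
    refine congrArg (fun z : ZMod (X.len f) => (z, false)) ?_
    push_cast
    exact show (i : ZMod (X.len f)) + t = i - 1 - (-1 - t) by ring

/-- The inverse of an isomorphism of graphs. -/
def _root_.SmallCancellation.Graph.Iso.symm {G : Graph.{u}} {H : Graph.{v}} (g : Graph.Iso G H) :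
    Graph.Iso H G where
  onV := g.onV.symm
  onDart := g.onDart.symm
  src_onDart d := by
    rw [Equiv.eq_symm_apply, ← g.src_onDart, Equiv.apply_symm_apply]
  rev_onDart d := by
    rw [Equiv.eq_symm_apply, ← g.rev_onDart, Equiv.apply_symm_apply]

variable (hinj : Function.Injective fun j => (a j).line 0)

-- At time `-1` the line of `a j` runs along the reverse of the first dart of `a (j - 1)`. Full
-- agreement would make it the reverse of the first dart of `a (j + 1)` as well, although these
-- darts differ.
include h hinj in
theorem not_full_succ (j : ZMod 3) : ¬ (a j).Full (a (j + 1)).rev := by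
  intro hf
  have h₁ := hf.1 (-1)
  have h₂ := rev_line_zero h (j - 1)
  rw [sub_add_cancel, h₁, line_rev, sub_self] at h₂
  have h₃ := hinj (X.revPerm.injective h₂)
  have h4 : ∀ j : ZMod 3, j - 1 ≠ j + 1 := by decide
  exact h4 j h₃

include h hinj in
theorem pieceOn_zero_one (j : ZMod 3) : (a j).PieceOn 0 1 := by
  refine ⟨_, fun t h₀ h₁ => ?_, not_full_succ h hinj j⟩
  obtain rfl : t = 0 := by omega
  exact h j

include h hinj in
theorem pieceOn_neg_one_zero (j : ZMod 3) : (a j).PieceOn (-1) 0 := by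
  have hf := not_full_succ h hinj (j - 1)
  have h₁ := h (j - 1)
  rw [sub_add_cancel] at hf h₁
  refine ⟨(a (j - 1)).rev, fun t _ _ => ?_, fun h' => hf (by simpa using h'.rev.symm)⟩
  obtain rfl : t = -1 := by omega
  rw [line_rev, sub_self, h₁, line_rev, X.rev_rev]
  rfl

-- The two sides at the centre are pieces. If there were no third side, at most two pieces would
-- make up the boundary.
include h hinj in
theorem three_le_len (hC : X.IsC 4) (j : ZMod 3) : 3 ≤ (a j).len := by
  by_contra hlt
  have hpos := (a j).len_pos
  have p₁ := pieceOn_zero_one h hinj j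
  have p₂ := (pieceOn_neg_one_zero h hinj j).translate 1
  simp only [one_mul] at p₂
  obtain h₁ | h₂ : (a j).len = 1 ∨ (a j).len = 2 := by omega
  · rw [h₁] at p₂
    exact hC.not_covered (a j) (a := 0) (b := 0) le_rfl le_rfl (by omega) (.inl rfl) (.inl rfl)
      (.inr (by rw [h₁]; exact p₁))
  · rw [h₂] at p₂
    exact hC.not_covered (a j) (a := 1) (b := 1) (by omega) le_rfl (by omega) (.inr p₁) (.inl rfl)
      (.inr (by rw [h₂]; exact p₂))

/-- No isomorphism of polygons compatible with the attaching maps identifies two consecutive polygons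
of the diagram along their common side. -/
def Incompatible (X : TwoComplex.{u}) (f g : X.Face) (s : (polygon (X.len f)).Dart)
    (t : (polygon (X.len g)).Dart) : Prop :=
  ∀ k : Graph.Iso (polygon (X.len f)) (polygon (X.len g)),
    k.onDart s = t → ¬ ∀ s, X.attach g (k.onDart s) = X.attach f s

theorem Incompatible.rev {f g : X.Face} {s : (polygon (X.len f)).Dart}
    {t : (polygon (X.len g)).Dart} (hi : Incompatible X f g s t) :
    Incompatible X f g ((polygon _).rev s) ((polygon _).rev t) := by
  intro k hk
  refine hi k ?_
  rw [← k.rev_onDart] at hk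
  exact (polygon _).revPerm.injective hk

theorem Incompatible.symm {f g : X.Face} {s : (polygon (X.len f)).Dart}
    {t : (polygon (X.len g)).Dart} (hi : Incompatible X f g s t) : Incompatible X g f t s := by
  intro k hk ha
  refine hi k.symm (by rw [← hk]; exact Equiv.symm_apply_apply _ _) fun s => ?_
  have := ha (k.symm.onDart s)
  rw [← this]
  exact congrArg _ (Equiv.apply_symm_apply _ _)

include h hinj in
theorem incompatible_succ (j : ZMod 3) :
    Incompatible X (a j).face (a (j + 1)).face ((polyIso (a j)).onDart (0, true))
      ((polyIso (a (j + 1))).onDart (-1, false)) := by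
  intro k hk ha
  refine not_full_succ h hinj j (full_of_iso k ?_ ha)
  have h₁ := polyIso_intCast (a j) 0
  have h₂ := polyIso_intCast_false (a (j + 1)) (-1)
  rw [Int.cast_zero] at h₁
  rw [Int.cast_neg, Int.cast_one] at h₂
  exact (congrArg _ h₁.symm).trans (hk.trans h₂)

include h3 h hinj in
theorem incompatible_of_side {j k : ZMod 3} (hjk : j ≠ k) {i : ZMod (a j).len} {l : ZMod (a k).len}
    (he : (.inl ⟨j, i⟩ : (Side fun j => (a j).len) ⊕ (Outer fun j => (a j).len)) =
      rev (.inl ⟨k, l⟩)) :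
    Incompatible X (a j).face (a k).face ((polyIso (a j)).onDart (i, true))
      ((polyIso (a k)).onDart (l, false)) := by
  by_cases h₀ : l = 0
  · subst h₀
    have he' := Sum.inl_injective (he.trans (rev_zero k))
    obtain rfl : j = k + 1 := congrArg Sigma.fst he'
    obtain rfl : i = -1 := by simpa using he'
    have := (incompatible_succ h hinj k).rev.symm
    have e₁ := (polyIso (a k)).rev_onDart (0, true)
    have e₂ := (polyIso (a (k + 1))).rev_onDart (-1, false)
    exact e₁ ▸ e₂ ▸ this
  by_cases h₁ : l = -1
  · subst h₁
    have he' := Sum.inl_injective (he.trans (rev_neg_one k h3))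
    obtain rfl : k = j + 1 := by rw [show j = k - 1 from congrArg Sigma.fst he', sub_add_cancel]
    have : (⟨j, i⟩ : Side fun j => (a j).len) = ⟨j, 0⟩ := by
      rw [he', add_sub_cancel_right]
    obtain rfl : i = 0 := by simpa using this
    exact incompatible_succ h hinj j
  · simp [rev, h₀, h₁] at he

include h hinj in
theorem incompatible_of_attach {j k : ZMod 3} (hjk : j ≠ k) (s : ZMod (a j).len × Bool)
    (t : ZMod (a k).len × Bool) (he : (complex h3).attach j s = (complex h3).attach k t) :
    Incompatible X (a j).face (a k).face ((polyIso (a j)).onDart s) ((polyIso (a k)).onDart t) := by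
  have inl_ne : ∀ i l, (.inl ⟨j, i⟩ : (Side fun j => (a j).len) ⊕ (Outer fun j => (a j).len)) ≠
      .inl ⟨k, l⟩ := fun i l he => hjk (congrArg Sigma.fst (Sum.inl_injective he))
  obtain ⟨i, b⟩ := s
  obtain ⟨l, c⟩ := t
  cases b <;> cases c
  · have he' : rev (.inl (⟨j, i⟩ : Side fun j => (a j).len)) = rev (.inl ⟨k, l⟩) := he
    exact (inl_ne i l (((rev_rev h3 _).symm.trans (congrArg rev he')).trans (rev_rev h3 _))).elim
  · exact (incompatible_of_side h3 h hinj hjk.symm (Eq.symm he)).symm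
  · exact incompatible_of_side h3 h hinj hjk he
  · exact (inl_ne i l he).elim

include h in
theorem isLift_map (j : ZMod 3) {q : List (polygon (a j).len).Dart}
    {p : List ((Side fun j => (a j).len) ⊕ (Outer fun j => (a j).len))}
    (hq : (complex h3).IsLift j q p) :
    X.IsLift (a j).face (q.map (polyIso (a j)).onDart) (p.map mapDart) := by
  obtain ⟨⟨v, w, hw⟩, rfl⟩ := hq
  refine ⟨⟨_, _, isWalk_map _ hw⟩, (List.map_map ..).trans (Eq.trans ?_ (List.map_map ..).symm)⟩
  exact List.map_congr_left fun s _ => attach_polyIso_eq h3 h j s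

-- A piece of the diagram has lifts to two different polygons, and these share only a side at the
-- centre. A compatible isomorphism of the image polygons would make two consecutive lines agree
-- everywhere, against `not_full_succ`.
include hinj in
theorem map_isReduced : (map h3 h).IsReduced := by
  rintro p ⟨hp, (j : ZMod 3), -, (k : ZMod 3), -, (q₁ : List (polygon (a j).len).Dart),
    (q₂ : List (polygon (a k).len).Dart), hq₁, hq₂, hno⟩
  have hq : q₁.map ((complex h3).attach j) = q₂.map ((complex h3).attach k) :=
    hq₁.2.trans hq₂.2.symm
  by_cases hjk : j = k
  · subst hjk
    refine absurd ⟨⟨Equiv.refl _, Equiv.refl _, fun _ => rfl, fun _ => rfl⟩, ?_, fun _ => rfl⟩ hno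
    exact (List.map_id _).trans (List.map_injective_iff.2 (attach_injective h3 j) hq)
  refine ⟨fun h => hp (List.map_eq_nil_iff.1 h), (a j).face, ⟨j, rfl⟩, (a k).face, ⟨k, rfl⟩,
    q₁.map (polyIso (a j)).onDart, q₂.map (polyIso (a k)).onDart,
    isLift_map h3 h j hq₁, isLift_map h3 h k hq₂, ?_⟩
  rintro ⟨g, hg, ha⟩
  rcases q₁ with _ | ⟨s, q₁⟩
  · exact hp hq₁.2.symm
  rcases q₂ with _ | ⟨t, q₂⟩
  · exact hp hq₂.2.symm
  exact incompatible_of_attach h3 h hinj hjk s t (List.cons.inj hq).1 g (List.cons.inj hg).1 ha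

end Map

end Triad

/-- In a `C(4)`--`T(4)` complex no three `2`-cells meet pairwise along a `1`-cell around a vertex. -/
theorem TwoComplex.noTriangle {X : TwoComplex.{u}} (hC : X.IsC 4) (hT : X.IsT 4) :
    X.NoTriangle := by
  intro x y z h₁ h₂ h₃ n₁ n₂ n₃
  let a : ZMod 3 → X.Flag := ![x, y, z]
  have h : ∀ j, (a j).line 0 = (a (j + 1)).rev.line 0 := by
    intro j
    fin_cases j
    · exact h₁
    · exact h₂
    · exact h₃
  have hinj : Function.Injective fun j => (a j).line 0 := by
    intro j k hjk
    fin_cases j <;> fin_cases k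
    · rfl
    · exact absurd hjk n₁
    · exact absurd hjk n₃
    · exact absurd hjk.symm n₁
    · rfl
    · exact absurd hjk n₂
    · exact absurd hjk.symm n₃
    · exact absurd hjk.symm n₂
    · rfl
  have h3 := Triad.three_le_len h hinj hC
  refine hT (Triad.diagram h3) (Triad.map h3 h) (Triad.map_isReduced h3 h hinj) _
    (Triad.isInternal_center h3) ?_
  have := Triad.valence_center h3
  exact ⟨by exact this.symm ▸ (by norm_num), by exact this.symm ▸ (by norm_num)⟩

end SmallCancellation

namespace SmallCancellation

namespace TwoComplex

variable {X : TwoComplex.{u}}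

open TwoComplex.Flag

/-! ### Positions on the boundary of a `2`-cell -/

namespace Flag

/-- The vertex that is reached at time `t`. -/
def pt (x : X.Flag) (t : ℤ) : X.V := X.src (x.line t)

theorem pt_shift (x : X.Flag) (s t : ℤ) : (x.shift s).pt t = x.pt (s + t) := by
  rw [pt, line_shift, pt]

theorem vert_shift_eq_pt (x : X.Flag) (t : ℤ) : (x.shift t).vert = x.pt t := vert_shift x t

theorem pt_rev (x : X.Flag) (t : ℤ) : x.rev.pt t = x.pt (-t) := by
  have := x.rev_shift (-t)
  rw [neg_neg] at this
  rw [← vert_shift_eq_pt, ← this, vert_rev, vert_shift_eq_pt]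

theorem pt_add_len (x : X.Flag) (t : ℤ) : x.pt (t + x.len) = x.pt t := by
  rw [pt, line_add_len, pt]

theorem tgt_line (x : X.Flag) (t : ℤ) : X.tgt (x.line t) = x.pt (t + 1) :=
  (x.src_line_succ t).symm

theorem onBoundary_pt (x : X.Flag) (t : ℤ) : X.OnBoundary (x.pt t) x.face := by
  rw [← vert_shift_eq_pt]
  exact onBoundary_vert (x.shift t)

theorem Glued.pt_eq {x y : X.Flag} {a b t : ℤ} (h : x.Glued y a b) (h₁ : min a b ≤ t)
    (h₂ : t ≤ max a b) : x.pt t = y.pt t := by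
  rw [← vert_shift_eq_pt, ← vert_shift_eq_pt, h.2 t h₁ h₂]

theorem Agree.pt_eq {x y : X.Flag} {a b t s : ℤ} (h : x.Agree y a b) (hs : x.pt s = y.pt s)
    (has : a ≤ s) (hsb : s ≤ b) (h₁ : a ≤ t) (h₂ : t ≤ b) : x.pt t = y.pt t := by
  rcases (h₁.trans h₂).eq_or_lt with h₃ | h₃
  · obtain rfl : t = s := by omega
    exact hs
  · exact h.src_eq h₁ h₂ h₃

end Flag

/-! ### Sides of `2`-cells in a thin complex -/

namespace IsThin

variable (thin : X.IsThin)

include thin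

theorem pt_eq_iff (x : X.Flag) {s t : ℤ} : x.pt s = x.pt t ↔ (x.len : ℤ) ∣ t - s := by
  rw [← corner_shift_eq_iff, ← vert_shift_eq_pt, ← vert_shift_eq_pt]
  exact ⟨thin.corner_eq rfl, vert_eq_of_corner_eq⟩

theorem eq_of_pt_eq (x : X.Flag) {s t : ℤ} (h : x.pt s = x.pt t) (h₁ : t - s < x.len)
    (h₂ : s - t < x.len) : s = t := by
  have := Int.eq_zero_of_abs_lt_dvd ((thin.pt_eq_iff x).1 h) (abs_lt.2 ⟨by omega, h₁⟩)
  omega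

theorem line_eq_or {x y : X.Flag} (hf : x.face = y.face) (hv : x.pt 0 = y.pt 0) :
    x.Full y ∨ x.rev.Full y := by
  rcases twin_or_twin_rev (thin.corner_eq hf hv) with h | h
  · exact .inl h.full
  · exact .inr h.full

omit thin in
theorem _root_.SmallCancellation.TwoComplex.Flag.exists_pt {x : X.Flag} {a : X.V}
    (h : X.OnBoundary a x.face) : ∃ t : ℤ, 0 ≤ t ∧ t < x.len ∧ x.pt t = a := by
  obtain ⟨y, hy, rfl⟩ := exists_of_onBoundary h
  obtain ⟨n, hn⟩ := exists_shift_corner hy.symm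
  have hx := x.len_pos'
  refine ⟨n % x.len, Int.emod_nonneg _ hx.ne', Int.emod_lt_of_pos _ hx, ?_⟩
  rw [← vert_eq_of_corner_eq hn, ← vert_shift_eq_pt]
  refine vert_eq_of_corner_eq ((corner_shift_eq_iff x).2 ?_)
  exact Int.dvd_self_sub_emod

/-- Two `2`-cells with two common vertices have a path between these in common. -/
theorem exists_side {f g : X.Face} {z₁ z₂ z₃ : X.V} (h₁ : X.OnBoundary z₁ f)
    (h₁' : X.OnBoundary z₁ g) (h₂ : X.OnBoundary z₂ f) (h₂' : X.OnBoundary z₂ g) (hne : z₁ ≠ z₂)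
    (h₃ : X.OnBoundary z₃ f) (h₃' : ¬ X.OnBoundary z₃ g) :
    ∃ (x y : X.Flag) (a : ℤ), x.face = f ∧ y.face = g ∧ 0 < a ∧ a < x.len ∧ x.pt 0 = z₁ ∧
      y.pt 0 = z₁ ∧ x.pt a = z₂ ∧ y.pt a = z₂ ∧ x.Agree y 0 a ∧
      ∀ t, 0 ≤ t → t ≤ a → x.pt t = y.pt t := by
  obtain ⟨p, rfl, rfl⟩ := exists_of_onBoundary h₁
  obtain ⟨q, rfl, hq⟩ := exists_of_onBoundary h₁'
  obtain ⟨p', hp', rfl⟩ := exists_of_onBoundary h₂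
  obtain ⟨q', hq', hq₂⟩ := exists_of_onBoundary h₂'
  obtain ⟨x, y, n, hx, hy, hx', hy', hg⟩ :=
    thin.matches_of_vert hp'.symm hq'.symm hq.symm hq₂.symm hne
  have key : ∀ (x y : X.Flag) (n : ℤ), x.corner = p.corner → y.corner = q.corner →
      (x.shift n).corner = p'.corner → (y.shift n).corner = q'.corner → x.Glued y 0 n → 0 < n →
      ∃ (x y : X.Flag) (a : ℤ), x.face = p.face ∧ y.face = q.face ∧ 0 < a ∧ a < x.len ∧
        x.pt 0 = p.vert ∧ y.pt 0 = p.vert ∧ x.pt a = p'.vert ∧ y.pt a = p'.vert ∧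
        x.Agree y 0 a ∧ ∀ t, 0 ≤ t → t ≤ a → x.pt t = y.pt t := by
    intro x y n hx hy hx' hy' hg hn
    have hpt : ∀ t, 0 ≤ t → t ≤ n → x.pt t = y.pt t :=
      fun t h₀ h₁ => hg.pt_eq (by omega) (by omega)
    have hxf : x.face = p.face := congrArg Prod.fst hx
    have hyf : y.face = q.face := congrArg Prod.fst hy
    have e₁ : x.pt 0 = p.vert := vert_eq_of_corner_eq hx
    have e₂ : x.pt n = p'.vert := by
      rw [← vert_shift_eq_pt]
      exact vert_eq_of_corner_eq hx'
    refine ⟨x, y, n, hxf, hyf, hn, ?_, e₁, (hpt 0 le_rfl hn.le).symm.trans e₁, e₂,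
      (hpt n hn.le le_rfl).symm.trans e₂, hg.1.mono (by omega) (by omega), hpt⟩
    -- A common path of at least a full turn would pass through `z₃`, which does not lie on `g`.
    by_contra hlt
    obtain ⟨t, ht₀, ht₁, ht⟩ := exists_pt (x := x) (a := z₃) (by rwa [hxf])
    rw [hpt t ht₀ (by omega)] at ht
    exact h₃' (by rw [← ht, ← hyf]; exact onBoundary_pt y t)
  rcases lt_trichotomy n 0 with hn | rfl | hn
  · refine key x.rev y.rev (-n) hx hy ?_ ?_ (by simpa using hg.rev) (by omega)
    · rw [← rev_shift, corner_rev, hx']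
    · rw [← rev_shift, corner_rev, hy']
  · rw [shift_zero, hx] at hx'
    exact absurd (vert_eq_of_corner_eq hx') hne
  · exact key x y n hx hy hx' hy' hg hn

/-- Four paths on the boundary of a `2`-cell that join four vertices cyclically, each of them
avoiding the other two, make up the boundary. -/
theorem quadrilateral {s₀ s₁ s₂ s₃ : X.Flag} {w₀ w₁ w₂ w₃ : X.V} {a₀ a₁ a₂ a₃ : ℤ}
    (f₁ : s₁.face = s₀.face) (f₂ : s₂.face = s₀.face) (f₃ : s₃.face = s₀.face)
    (p₀ : 0 < a₀) (p₁ : 0 < a₁) (p₂ : 0 < a₂) (p₃ : 0 < a₃)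
    (l₁ : a₁ < s₀.len) (l₂ : a₂ < s₀.len) (l₃ : a₃ < s₀.len)
    (b₀ : s₀.pt 0 = w₀) (e₀ : s₀.pt a₀ = w₁) (b₁ : s₁.pt 0 = w₁) (e₁ : s₁.pt a₁ = w₂)
    (b₂ : s₂.pt 0 = w₃) (e₂ : s₂.pt a₂ = w₂) (b₃ : s₃.pt 0 = w₀) (e₃ : s₃.pt a₃ = w₃)
    (n₀ : ∀ t, 0 ≤ t → t ≤ a₀ → s₀.pt t ≠ w₂ ∧ s₀.pt t ≠ w₃)
    (n₁ : ∀ t, 0 ≤ t → t ≤ a₁ → s₁.pt t ≠ w₀ ∧ s₁.pt t ≠ w₃)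
    (n₂ : ∀ t, 0 ≤ t → t ≤ a₂ → s₂.pt t ≠ w₀ ∧ s₂.pt t ≠ w₁)
    (n₃ : ∀ t, 0 ≤ t → t ≤ a₃ → s₃.pt t ≠ w₁ ∧ s₃.pt t ≠ w₂) :
    (s₀.shift a₀).Full s₁ ∧ (s₀.shift (a₀ + a₁ + a₂)).rev.Full s₂ ∧ s₀.rev.Full s₃ ∧
      a₀ + a₁ + a₂ + a₃ = s₀.len := by
  have full_pt : ∀ {x y : X.Flag}, x.Full y → ∀ t, y.pt t = x.pt t :=
    fun h t => congrArg X.src (h.1 t).symm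
  -- The four vertices are located at the times `0`, `a₀`, `T₂`, `T₃` of one turn of `s₀`. Each of
  -- the other three paths must run in the direction in which it avoids the two vertices forbidden
  -- to it, and this also orders the times.
  obtain ⟨T₂, h₂, h₂', ht₂⟩ := exists_pt (x := s₀) (a := w₂) (by
    rw [← e₁, ← f₁]; exact onBoundary_pt _ _)
  obtain ⟨T₃, h₃, h₃', ht₃⟩ := exists_pt (x := s₀) (a := w₃) (by
    rw [← e₃, ← f₃]; exact onBoundary_pt _ _)
  have o₂ : a₀ < T₂ := by
    by_contra h
    exact (n₀ T₂ h₂ (by omega)).1 ht₂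
  have o₃ : a₀ < T₃ := by
    by_contra h
    exact (n₀ T₃ h₃ (by omega)).2 ht₃
  have hlen := s₀.pt_add_len 0
  rw [zero_add] at hlen
  have F₁ : (s₀.shift a₀).Full s₁ ∧ a₀ + a₁ = T₂ := by
    rcases thin.line_eq_or (x := s₀.shift a₀) (y := s₁) f₁.symm
      (by rw [pt_shift, add_zero, e₀, b₁]) with h | h
    · refine ⟨h, thin.eq_of_pt_eq s₀ ?_ (by omega) (by omega)⟩
      rw [← pt_shift, ← full_pt h, e₁, ht₂]
    · exfalso
      have h' : ∀ t, s₁.pt t = s₀.pt (a₀ - t) := fun t => by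
        rw [full_pt h, pt_rev, pt_shift, sub_eq_add_neg]
      have h₄ : a₀ - a₁ + s₀.len = T₂ := by
        refine thin.eq_of_pt_eq s₀ ?_ (by omega) (by omega)
        rw [pt_add_len, ← h', e₁, ht₂]
      refine (n₁ a₀ (by omega) (by omega)).1 ?_
      rw [h', sub_self, b₀]
  obtain ⟨F₁, rfl⟩ := F₁
  have hs₁ : ∀ t, s₁.pt t = s₀.pt (a₀ + t) := fun t => by rw [full_pt F₁, pt_shift]
  have o₄ : a₀ + a₁ < T₃ := by
    by_contra h
    refine (n₁ (T₃ - a₀) (by omega) (by omega)).2 ?_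
    rw [hs₁, add_sub_cancel, ht₃]
  have F₃ : s₀.rev.Full s₃ ∧ s₀.len - a₃ = T₃ := by
    rcases thin.line_eq_or (x := s₀) (y := s₃) f₃.symm (by rw [b₀, b₃]) with h | h
    · exfalso
      have h₄ : a₃ = T₃ := by
        refine thin.eq_of_pt_eq s₀ ?_ (by omega) (by omega)
        rw [← full_pt h, e₃, ht₃]
      refine (n₃ a₀ (by omega) (by omega)).1 ?_
      rw [full_pt h, e₀]
    · refine ⟨h, thin.eq_of_pt_eq s₀ ?_ (by omega) (by omega)⟩
      rw [sub_eq_neg_add, pt_add_len, ← pt_rev, ← full_pt h, e₃, ht₃]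
  obtain ⟨F₃, h₅⟩ := F₃
  have F₂ : (s₀.shift T₃).rev.Full s₂ ∧ T₃ - a₂ = a₀ + a₁ := by
    rcases thin.line_eq_or (x := s₀.shift T₃) (y := s₂) f₂.symm
      (by rw [pt_shift, add_zero, ht₃, b₂]) with h | h
    · exfalso
      have h' : ∀ t, s₂.pt t = s₀.pt (T₃ + t) := fun t => by rw [full_pt h, pt_shift]
      have h₄ : T₃ + a₂ = a₀ + a₁ + s₀.len := by
        refine thin.eq_of_pt_eq s₀ ?_ (by omega) (by omega)
        rw [pt_add_len, ← h', e₂, ht₂]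
      refine (n₂ (s₀.len - T₃) (by omega) (by omega)).1 ?_
      rw [h', add_sub_cancel, hlen, b₀]
    · refine ⟨h, thin.eq_of_pt_eq s₀ ?_ (by omega) (by omega)⟩
      rw [sub_eq_add_neg, ← pt_shift, ← pt_rev, ← full_pt h, e₂, ht₂]
  obtain ⟨F₂, h₆⟩ := F₂
  refine ⟨F₁, ?_, F₃, by omega⟩
  rwa [show a₀ + a₁ + a₂ = T₃ by omega]

end IsThin

/-- A family of `2`-cells indexed by the unit squares of the plane, such that neighbouring ones have
a boundary path in common.  The line of `x m n` runs through the four vertices `v m n`,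
`v (m + 1) n`, `v (m + 1) (n + 1)`, `v m (n + 1)` at the times `0`, `c₁`, `c₂`, `c₃`. -/
structure FlatSystem (X : TwoComplex.{u}) where
  x : ℤ → ℤ → X.Flag
  v : ℤ → ℤ → X.V
  c₁ : ℤ → ℤ → ℤ
  c₂ : ℤ → ℤ → ℤ
  c₃ : ℤ → ℤ → ℤ
  c₁_pos : ∀ m n, 0 < c₁ m n
  c₁_lt : ∀ m n, c₁ m n < c₂ m n
  c₂_lt : ∀ m n, c₂ m n < c₃ m n
  c₃_lt : ∀ m n, c₃ m n < (x m n).len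
  pt_zero : ∀ m n, (x m n).pt 0 = v m n
  pt_c₁ : ∀ m n, (x m n).pt (c₁ m n) = v (m + 1) n
  pt_c₂ : ∀ m n, (x m n).pt (c₂ m n) = v (m + 1) (n + 1)
  pt_c₃ : ∀ m n, (x m n).pt (c₃ m n) = v m (n + 1)
  horizontal : ∀ m n, (x m (n + 1)).Agree ((x m n).shift (c₃ m n)).rev 0 (c₁ m (n + 1))
  vertical : ∀ m n, (x (m + 1) n).Agree ((x m n).shift (c₁ m n)).rev
    (c₃ (m + 1) n - (x (m + 1) n).len) 0
  c₁_eq : ∀ m n, c₁ m (n + 1) = c₃ m n - c₂ m n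
  len_sub : ∀ m n, (x (m + 1) n).len - c₃ (m + 1) n = c₂ m n - c₁ m n
  inc : ∀ m n m' n', X.OnBoundary (v m' n') (x m n).face →
    m ≤ m' ∧ m' ≤ m + 1 ∧ n ≤ n' ∧ n' ≤ n + 1
  king : ∀ m n m' n' u, X.OnBoundary u (x m n).face → X.OnBoundary u (x m' n').face →
    m' ≤ m + 1 ∧ n' ≤ n + 1

/-- Neighbouring cells have two grid vertices in common and each has one that the other misses, so
`exists_side` gives a common side shorter than a turn. The sides avoid the grid vertices that do not
lie on both cells, hence `quadrilateral` puts the four sides of a cell on one line. -/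
theorem IsThin.exists_flatSystem (thin : X.IsThin) (F : ℤ → ℤ → X.Face) (v : ℤ → ℤ → X.V)
    (inc : ∀ m n m' n', X.OnBoundary (v m' n') (F m n) ↔
      (m' = m ∨ m' = m + 1) ∧ (n' = n ∨ n' = n + 1))
    (hv : ∀ m n m' n', v m n = v m' n' → m = m' ∧ n = n')
    (king : ∀ m n m' n' u, X.OnBoundary u (F m n) → X.OnBoundary u (F m' n') →
      m' ≤ m + 1 ∧ n' ≤ n + 1) :
    ∃ S : FlatSystem X, ∀ m n, (S.x m n).face = F m n := by
  -- In `H` the flags `x` and `y` run along a horizontal side, on the cells above and below it; in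
  -- `V` they run along a vertical side, on the cells to its right and left.
  have H : ∀ m n, ∃ (x y : X.Flag) (a : ℤ), x.face = F m n ∧ y.face = F m (n - 1) ∧ 0 < a ∧
      a < x.len ∧ x.pt 0 = v m n ∧ y.pt 0 = v m n ∧ x.pt a = v (m + 1) n ∧
      y.pt a = v (m + 1) n ∧ x.Agree y 0 a ∧ (∀ t, 0 ≤ t → t ≤ a → x.pt t = y.pt t) ∧
      a < y.len := by
    intro m n
    have i₁ := (inc m n m n).2 (by omega)
    have i₂ := (inc m (n - 1) m n).2 (by omega)
    have i₃ := (inc m n (m + 1) n).2 (by omega)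
    have i₄ := (inc m (n - 1) (m + 1) n).2 (by omega)
    have i₅ := (inc m n m (n + 1)).2 (by omega)
    have i₆ : ¬ X.OnBoundary (v m (n + 1)) (F m (n - 1)) := fun h => by
      have := (inc _ _ _ _).1 h
      omega
    have i₇ := (inc m (n - 1) m (n - 1)).2 (by omega)
    have i₈ : ¬ X.OnBoundary (v m (n - 1)) (F m n) := fun h => by
      have := (inc _ _ _ _).1 h
      omega
    have hne : v m n ≠ v (m + 1) n := fun h => by
      have := hv _ _ _ _ h
      omega
    obtain ⟨x, y, a, hx, hy, h⟩ := thin.exists_side i₁ i₂ i₃ i₄ hne i₅ i₆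
    refine ⟨x, y, a, hx, hy, h.1, h.2.1, h.2.2.1, h.2.2.2.1, h.2.2.2.2.1, h.2.2.2.2.2.1,
      h.2.2.2.2.2.2.1, h.2.2.2.2.2.2.2, ?_⟩
    by_contra hlt
    obtain ⟨t, ht₀, ht₁, ht⟩ := exists_pt (x := y) (by rwa [hy])
    rw [← h.2.2.2.2.2.2.2 t ht₀ (by omega)] at ht
    exact i₈ (by rw [← ht, ← hx]; exact onBoundary_pt x t)
  have V : ∀ m n, ∃ (x y : X.Flag) (a : ℤ), x.face = F m n ∧ y.face = F (m - 1) n ∧ 0 < a ∧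
      a < x.len ∧ x.pt 0 = v m n ∧ y.pt 0 = v m n ∧ x.pt a = v m (n + 1) ∧
      y.pt a = v m (n + 1) ∧ x.Agree y 0 a ∧ (∀ t, 0 ≤ t → t ≤ a → x.pt t = y.pt t) ∧
      a < y.len := by
    intro m n
    have i₁ := (inc m n m n).2 (by omega)
    have i₂ := (inc (m - 1) n m n).2 (by omega)
    have i₃ := (inc m n m (n + 1)).2 (by omega)
    have i₄ := (inc (m - 1) n m (n + 1)).2 (by omega)
    have i₅ := (inc m n (m + 1) n).2 (by omega)
    have i₆ : ¬ X.OnBoundary (v (m + 1) n) (F (m - 1) n) := fun h => by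
      have := (inc _ _ _ _).1 h
      omega
    have i₇ := (inc (m - 1) n (m - 1) n).2 (by omega)
    have i₈ : ¬ X.OnBoundary (v (m - 1) n) (F m n) := fun h => by
      have := (inc _ _ _ _).1 h
      omega
    have hne : v m n ≠ v m (n + 1) := fun h => by
      have := hv _ _ _ _ h
      omega
    obtain ⟨x, y, a, hx, hy, h⟩ := thin.exists_side i₁ i₂ i₃ i₄ hne i₅ i₆
    refine ⟨x, y, a, hx, hy, h.1, h.2.1, h.2.2.1, h.2.2.2.1, h.2.2.2.2.1, h.2.2.2.2.2.1,
      h.2.2.2.2.2.2.1, h.2.2.2.2.2.2.2, ?_⟩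
    by_contra hlt
    obtain ⟨t, ht₀, ht₁, ht⟩ := exists_pt (x := y) (by rwa [hy])
    rw [← h.2.2.2.2.2.2.2 t ht₀ (by omega)] at ht
    exact i₈ (by rw [← ht, ← hx]; exact onBoundary_pt x t)
  choose hx hy a hxf hyf a0 alx hx0 hy0 hxa hya hag hpt aly using H
  choose wx wy b wxf wyf b0 blx wx0 wy0 wxb wyb wag wpt bly using V
  have avoid : ∀ {m n m' n'} (x : X.Flag), x.face = F m' n' →
      ¬ ((m = m' ∨ m = m' + 1) ∧ (n = n' ∨ n = n' + 1)) → ∀ t, x.pt t ≠ v m n := by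
    intro m n m' n' x hf h t ht
    refine h ((inc _ _ _ _).1 ?_)
    rw [← ht, ← hf]
    exact onBoundary_pt x t
  have len_eq : ∀ {x y : X.Flag}, x.face = y.face → x.len = y.len := fun h => congrArg X.len h
  have Q := fun m n => thin.quadrilateral (s₀ := hx m n) (s₁ := wy (m + 1) n)
    (s₂ := hy m (n + 1)) (s₃ := wx m n) (w₀ := v m n) (w₁ := v (m + 1) n)
    (w₂ := v (m + 1) (n + 1)) (w₃ := v m (n + 1)) (a₀ := a m n) (a₁ := b (m + 1) n)
    (a₂ := a m (n + 1)) (a₃ := b m n)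
    (by rw [wyf, hxf, add_sub_cancel_right]) (by rw [hyf, hxf, add_sub_cancel_right])
    (by rw [wxf, hxf]) (a0 _ _) (b0 _ _) (a0 _ _) (b0 _ _)
    (by
      rw [len_eq (show (hx m n).face = (wy (m + 1) n).face by
        rw [wyf, hxf, add_sub_cancel_right])]
      exact bly _ _)
    (by
      rw [len_eq (show (hx m n).face = (hy m (n + 1)).face by
        rw [hyf, hxf, add_sub_cancel_right])]
      exact aly _ _)
    (by
      rw [len_eq (show (hx m n).face = (wx m n).face by rw [wxf, hxf])]
      exact blx _ _)
    (hx0 _ _) (hxa _ _) (wy0 _ _) (wyb _ _) (hy0 _ _) (hya _ _) (wx0 _ _) (wxb _ _)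
    (fun t h₀ h₁ => by
      rw [hpt _ _ t h₀ h₁]
      exact ⟨avoid _ (hyf _ _) (by omega) t, avoid _ (hyf _ _) (by omega) t⟩)
    (fun t h₀ h₁ => by
      rw [← wpt _ _ t h₀ h₁]
      exact ⟨avoid _ (wxf _ _) (by omega) t, avoid _ (wxf _ _) (by omega) t⟩)
    (fun t h₀ h₁ => by
      rw [← hpt _ _ t h₀ h₁]
      exact ⟨avoid _ (hxf _ _) (by omega) t, avoid _ (hxf _ _) (by omega) t⟩)
    (fun t h₀ h₁ => by
      rw [wpt _ _ t h₀ h₁]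
      exact ⟨avoid _ (wyf _ _) (by omega) t, avoid _ (wyf _ _) (by omega) t⟩)
  have full_pt : ∀ {x y : X.Flag}, x.Full y → ∀ t, y.pt t = x.pt t :=
    fun h t => congrArg X.src (h.1 t).symm
  refine ⟨{
    x := hx
    v := v
    c₁ := a
    c₂ := fun m n => a m n + b (m + 1) n
    c₃ := fun m n => a m n + b (m + 1) n + a m (n + 1)
    c₁_pos := a0
    c₁_lt := fun m n => by have := b0 (m + 1) n; omega
    c₂_lt := fun m n => by have := a0 m (n + 1); omega
    c₃_lt := fun m n => by have := b0 m n; have := (Q m n).2.2.2; omega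
    pt_zero := hx0
    pt_c₁ := hxa
    pt_c₂ := fun m n => by rw [← pt_shift, ← full_pt (Q m n).1, wyb]
    pt_c₃ := fun m n => by
      have := full_pt (Q m n).2.1 0
      rw [hy0, pt_rev, pt_shift, neg_zero, add_zero] at this
      exact this.symm
    horizontal := fun m n => (hag m (n + 1)).trans ((Q m n).2.1.symm.agree _ _)
    vertical := fun m n => by
      have h₁ := (wag (m + 1) n).symm.trans ((Q (m + 1) n).2.2.1.symm.agree _ _)
      have h₂ := (((Q m n).1.agree _ _).trans h₁).rev
      have h₃ := (Q (m + 1) n).2.2.2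
      rw [rev_rev, neg_zero] at h₂
      exact h₂.symm.mono (by omega) le_rfl
    c₁_eq := fun m n => by ring
    len_sub := fun m n => by have := (Q (m + 1) n).2.2.2; linarith
    inc := fun m n m' n' h => by
      rw [hxf] at h
      have := (inc _ _ _ _).1 h
      omega
    king := fun m n m' n' u h h' => by
      rw [hxf] at h h'
      exact king _ _ _ _ u h h' }, hxf⟩

end TwoComplex

end SmallCancellation

/-! ### Overlaps of the sides of a flat system at its vertices -/

namespace SmallCancellation

namespace TwoComplex

variable {X : TwoComplex.{u}}

open TwoComplex.Flag

namespace Flag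

theorem rev_shift_rev_full (x : X.Flag) (t : ℤ) : (x.rev.shift (x.len - t)).rev.Full (x.shift t) := by
  rw [rev_shift, rev_rev]
  refine ⟨fun s => ?_, rfl⟩
  rw [line_shift, line_shift, ← line_add_len]
  congr 1
  ring

theorem shift_rev_full (x : X.Flag) (t : ℤ) : (x.rev.shift (x.len - t)).Full (x.shift t).rev := by
  simpa using (x.rev_shift_rev_full t).rev

theorem pt_rev_sub (x : X.Flag) (t : ℤ) : x.rev.pt (x.len - t) = x.pt t := by
  rw [pt_rev, neg_sub, ← pt_add_len, sub_add_cancel]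

end Flag

/-- If two boundary paths agree up to a common vertex, and the `2`-cells have a further common vertex,
then the paths agree up to that vertex. -/
theorem IsThin.agree_of_onBoundary (thin : X.IsThin) {p q : X.Flag} (h₁ : p.line (-1) = q.line (-1))
    {s k : ℤ} (hs : 0 ≤ s) (hs' : s < p.len) (hk : 0 ≤ k) (hks : k + s ≤ p.len)
    (hu : X.OnBoundary (p.pt s) q.face) (hn : ¬ X.OnBoundary (p.pt (-k)) q.face) :
    p.Agree q 0 s := by
  rcases hs.eq_or_lt with rfl | hs
  · intro t h₁ h₂
    omega
  have hv : p.vert = q.vert := by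
    have := p.src_line_succ (-1)
    rw [h₁, ← q.src_line_succ (-1)] at this
    exact this
  obtain ⟨r, hr, hru⟩ := exists_of_onBoundary hu
  have hne : p.vert ≠ (p.shift s).vert := by
    intro h
    rw [vert_shift_eq_pt] at h
    have := thin.eq_of_pt_eq p (show p.pt 0 = p.pt s from h) (by omega) (by omega)
    omega
  obtain ⟨y, n, hy, hpn, -, hg⟩ := (thin.matches_of_vert (x := p) (y := q) (x' := p.shift s) (y' := r) rfl hr.symm hv
    (by rw [hru, vert_shift_eq_pt]) hne).align rfl
  obtain ⟨j, hj⟩ := p.corner_shift_eq_iff.1 hpn.symm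
  have hp := p.len_pos'
  -- The common path supplied by thinness has length `s` up to full turns. Backwards it would pass
  -- the vertex at time `-k`, which is not on the other cell; forwards it begins with the required
  -- path.
  rcases lt_or_ge j 0 with hj0 | hj0
  · exfalso
    have : (p.len : ℤ) * j ≤ -p.len := by nlinarith
    have h₂ := hg.pt_eq (t := -k) (by omega) (by omega)
    refine hn ?_
    rw [h₂, ← show y.face = q.face from congrArg Prod.fst hy]
    exact onBoundary_pt y _
  · have : 0 ≤ (p.len : ℤ) * j := by positivity
    have hag : p.Agree y 0 s := hg.1.mono (by omega) (by omega)
    rcases twin_or_twin_rev hy.symm with h | h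
    · exact hag.trans (h.full.symm.agree _ _)
    · exfalso
      have h₃ := hag 0 le_rfl hs
      rw [← h.full.1, line_rev, sub_zero, ← h₁] at h₃
      exact p.line_succ_ne (-1) (by rwa [neg_add_cancel])

namespace FlatSystem

variable (S : FlatSystem X)

/-- The reflection of a flat system in the diagonal. -/
def transpose : FlatSystem X where
  x m n := (S.x n m).rev
  v m n := S.v n m
  c₁ m n := (S.x n m).len - S.c₃ n m
  c₂ m n := (S.x n m).len - S.c₂ n m
  c₃ m n := (S.x n m).len - S.c₁ n m
  c₁_pos m n := by have := S.c₃_lt n m; omega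
  c₁_lt m n := by have := S.c₂_lt n m; omega
  c₂_lt m n := by have := S.c₁_lt n m; omega
  c₃_lt m n := by have := S.c₁_pos n m; rw [len_rev]; omega
  pt_zero m n := by rw [pt_rev, neg_zero, S.pt_zero]
  pt_c₁ m n := by rw [pt_rev_sub, S.pt_c₃]
  pt_c₂ m n := by rw [pt_rev_sub, S.pt_c₂]
  pt_c₃ m n := by rw [pt_rev_sub, S.pt_c₁]
  horizontal m n := by
    have := (S.vertical n m).rev
    rw [neg_zero, neg_sub, Flag.rev_rev] at this
    exact this.trans ((rev_shift_rev_full _ _).symm.agree _ _)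
  vertical m n := by
    have := (S.horizontal n m).rev
    rw [neg_zero, Flag.rev_rev] at this
    refine (this.trans ((rev_shift_rev_full _ _).symm.agree _ _)).mono ?_ le_rfl
    simp
  c₁_eq m n := by have := S.len_sub n m; omega
  len_sub m n := by have := S.c₁_eq n m; rw [len_rev]; omega
  inc m n m' n' h := by have := S.inc n m n' m' h; omega
  king m n m' n' u h h' := (S.king n m n' m' u h h').symm

/-- The top side of the cell `(m, n)`, read from its right end `v (m + 1) (n + 1)` towards the left.
-/
theorem agree_c₁_c₂ (m n : ℤ) : ((S.x m (n + 1)).shift (S.c₁ m (n + 1))).rev.Agree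
    ((S.x m n).shift (S.c₂ m n)) 0 (S.c₁ m (n + 1)) := by
  have := ((S.horizontal m n).rev).shift (-S.c₁ m (n + 1))
  rw [Flag.rev_rev, shift_shift, ← Flag.rev_shift] at this
  have h := S.c₁_eq m n
  rw [show S.c₃ m n + -S.c₁ m (n + 1) = S.c₂ m n by omega] at this
  exact this.mono (by omega) (by omega)

theorem agree_c₃_c₂ (m n : ℤ) : ((S.x (m + 1) n).shift (S.c₃ (m + 1) n)).rev.Agree
    ((S.x m n).shift (S.c₂ m n)) (S.c₃ (m + 1) n - (S.x (m + 1) n).len) 0 := by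
  have := (S.transpose.agree_c₁_c₂ n m).rev
  refine Agree.trans ?_ ((this.mono ?_ ?_).trans ((rev_shift_rev_full _ _).agree _ _))
  · refine Full.agree ?_ _ _
    rw [Flag.rev_rev]
    exact (shift_rev_full _ _).symm
  · simp [transpose]
  · simp

theorem pt_zero_c₂ (m n : ℤ) : (S.x (m + 1) (n + 1)).pt 0 = ((S.x m n).shift (S.c₂ m n)).pt 0 := by
  rw [S.pt_zero, pt_shift, add_zero, S.pt_c₂]

theorem pt_zero_c₁ (m n : ℤ) :
    (S.x (m + 1) n).pt 0 = ((S.x m n).shift (S.c₁ m n)).rev.pt 0 := by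
  rw [S.pt_zero, pt_rev, pt_shift, neg_zero, add_zero, S.pt_c₁]

theorem pt_zero_c₃ (m n : ℤ) :
    (S.x m (n + 1)).pt 0 = ((S.x m n).shift (S.c₃ m n)).rev.pt 0 := by
  rw [S.pt_zero, pt_rev, pt_shift, neg_zero, add_zero, S.pt_c₃]

/-- A longer agreement would reach `v (m + 2) (n + 1)` or `v m (n + 1)`, each of which lies on only
one of the two diagonally opposite cells. -/
theorem lt_of_agree {m n s : ℤ}
    (h : (S.x (m + 1) (n + 1)).Agree ((S.x m n).shift (S.c₂ m n)) 0 s) :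
    s < S.c₁ (m + 1) (n + 1) ∧ s < S.c₁ m (n + 1) := by
  have h₀ := S.pt_zero_c₂ m n
  constructor <;> by_contra hlt
  · have h₁ := S.c₁_pos (m + 1) (n + 1)
    have h₂ := h.pt_eq h₀ le_rfl (by omega) h₁.le (by omega)
    rw [S.pt_c₁] at h₂
    have h₃ := onBoundary_pt ((S.x m n).shift (S.c₂ m n)) (S.c₁ (m + 1) (n + 1))
    rw [← h₂] at h₃
    have := S.inc _ _ _ _ h₃
    omega
  · have h₁ := S.c₁_pos m (n + 1)
    have h₂ := h.pt_eq h₀ le_rfl (by omega) h₁.le (by omega)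
    have h₄ := S.c₁_eq m n
    rw [pt_shift, show S.c₂ m n + S.c₁ m (n + 1) = S.c₃ m n by omega, S.pt_c₃] at h₂
    have h₃ := onBoundary_pt (S.x (m + 1) (n + 1)) (S.c₁ m (n + 1))
    rw [h₂] at h₃
    have := S.inc _ _ _ _ h₃
    omega

theorem exists_mu (m n : ℤ) :
    ∃ b, (S.x (m + 1) (n + 1)).Agree ((S.x m n).shift (S.c₂ m n)) 0 b ∧
      ∀ s, (S.x (m + 1) (n + 1)).Agree ((S.x m n).shift (S.c₂ m n)) 0 s → s ≤ b :=
  Int.exists_greatest_of_bdd ⟨_, fun _ hs => (S.lt_of_agree hs).1.le⟩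
    ⟨0, fun t h₁ h₂ => by omega⟩

/-- The length of the path, starting at `v m n` in the direction of the line of `x m n`, that is
common to the four `2`-cells around `v m n`. -/
noncomputable def mu (m n : ℤ) : ℤ := (S.exists_mu (m - 1) (n - 1)).choose

theorem mu_agree (m n : ℤ) : (S.x (m + 1) (n + 1)).Agree ((S.x m n).shift (S.c₂ m n)) 0
    (S.mu (m + 1) (n + 1)) := by
  have := (S.exists_mu (m + 1 - 1) (n + 1 - 1)).choose_spec.1
  rw [mu]
  simpa only [add_sub_cancel_right] using this

theorem le_mu {m n s : ℤ}
    (h : (S.x (m + 1) (n + 1)).Agree ((S.x m n).shift (S.c₂ m n)) 0 s) :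
    s ≤ S.mu (m + 1) (n + 1) := by
  have := (S.exists_mu (m + 1 - 1) (n + 1 - 1)).choose_spec.2 s
  rw [mu]
  simp only [add_sub_cancel_right] at this ⊢
  exact this h

theorem mu_nonneg (m n : ℤ) : 0 ≤ S.mu m n := by
  obtain ⟨m, rfl⟩ : ∃ k, m = k + 1 := ⟨m - 1, by ring⟩
  obtain ⟨n, rfl⟩ : ∃ k, n = k + 1 := ⟨n - 1, by ring⟩
  exact S.le_mu fun t h₁ h₂ => by omega

theorem mu_lt (m n : ℤ) : S.mu m n < S.c₁ m n := by
  obtain ⟨m, rfl⟩ : ∃ k, m = k + 1 := ⟨m - 1, by ring⟩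
  obtain ⟨n, rfl⟩ : ∃ k, n = k + 1 := ⟨n - 1, by ring⟩
  exact (S.lt_of_agree (S.mu_agree m n)).1

theorem mu_succ_lt (m n : ℤ) : S.mu (m + 1) n < S.c₁ m n := by
  obtain ⟨n, rfl⟩ : ∃ k, n = k + 1 := ⟨n - 1, by ring⟩
  exact (S.lt_of_agree (S.mu_agree m n)).2

/-- The length of the path, starting at `v m n` in the direction opposite to the line of `x m n`,
that is common to the four `2`-cells around `v m n`. -/
noncomputable def lam (m n : ℤ) : ℤ := S.transpose.mu n m

/-- The time up to which the line of `x m n` runs through the edge of the flat from `v m n` to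
`v (m + 1) n`. -/
noncomputable def R (m n : ℤ) : ℤ := S.c₁ m n - S.mu (m + 1) n

/-- The time up to which the line of `(x m n).rev` runs through the edge of the flat from `v m n` to
`v m (n + 1)`. -/
noncomputable def L (m n : ℤ) : ℤ := (S.x m n).len - S.c₃ m n - S.lam m (n + 1)

theorem transpose_R (m n : ℤ) : S.transpose.R n m = S.L m n := rfl

theorem lam_nonneg (m n : ℤ) : 0 ≤ S.lam m n := S.transpose.mu_nonneg n m

theorem lam_lt (m n : ℤ) : S.lam m n < (S.x m n).len - S.c₃ m n := S.transpose.mu_lt n m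

theorem lam_succ_lt (m n : ℤ) : S.lam m (n + 1) < (S.x m n).len - S.c₃ m n :=
  S.transpose.mu_succ_lt n m

theorem lam_agree (m n : ℤ) : (S.x (m + 1) (n + 1)).Agree ((S.x m n).shift (S.c₂ m n))
    (-S.lam (m + 1) (n + 1)) 0 := by
  have := (S.transpose.mu_agree n m).rev
  have h := this.trans ((rev_shift_rev_full _ _).agree _ _)
  change (S.x (m + 1) (n + 1)).rev.rev.Agree _ _ (-0) at h
  rwa [Flag.rev_rev, neg_zero] at h

/-- The four `2`-cells around a vertex of the flat have a path in common. -/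
theorem agree_c₂ (m n : ℤ) : (S.x (m + 1) (n + 1)).Agree ((S.x m n).shift (S.c₂ m n))
    (-S.lam (m + 1) (n + 1)) (S.mu (m + 1) (n + 1)) :=
  (S.lam_agree m n).union (S.mu_agree m n) le_rfl

/-- At negative times this is part of the common vertical side. At positive times the agreement is
obtained through the diagonally opposite cell. -/
theorem agree_c₁ (m n : ℤ) : (S.x (m + 1) n).Agree ((S.x m n).shift (S.c₁ m n)).rev
    (-S.lam (m + 1) n) (S.mu (m + 1) n) := by
  have h₁ := (S.vertical m n).mono (c := -S.lam (m + 1) n) (d := 0)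
    (by have := S.lam_lt (m + 1) n; omega) le_rfl
  refine h₁.union ?_ le_rfl
  obtain ⟨n, rfl⟩ : ∃ k, n = k + 1 := ⟨n - 1, by ring⟩
  exact (S.mu_agree m n).trans
    ((S.agree_c₁_c₂ m n).symm.mono le_rfl (S.mu_succ_lt m (n + 1)).le)

theorem agree_c₃ (m n : ℤ) : (S.x m (n + 1)).Agree ((S.x m n).shift (S.c₃ m n)).rev
    (-S.lam m (n + 1)) (S.mu m (n + 1)) := by
  have h₁ := (S.horizontal m n).mono (c := 0) (d := S.mu m (n + 1)) le_rfl (S.mu_lt _ _).le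
  refine Agree.union ?_ h₁ le_rfl
  obtain ⟨m, rfl⟩ : ∃ k, m = k + 1 := ⟨m - 1, by ring⟩
  refine (S.lam_agree m n).trans ((S.agree_c₃_c₂ m n).symm.mono ?_ le_rfl)
  have := S.lam_succ_lt (m + 1) n
  omega

variable (thin : X.IsThin)

-- A vertex on a horizontal side that also lies on a cell of the next column belongs to the overlap
-- at the right end: by `agree_of_onBoundary` that cell follows the side from the end back to this
-- vertex, and `mu` is maximal.
include thin in
theorem sub_le_mu {m n n' t : ℤ} (h₀ : 0 ≤ t) (h₁ : t ≤ S.c₁ m (n + 1))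
    (hn' : n' = n + 1 ∨ n' = n)
    (hu : X.OnBoundary ((S.x m (n + 1)).pt t) (S.x (m + 1) n').face) :
    S.c₁ m (n + 1) - t ≤ S.mu (m + 1) (n + 1) := by
  have hBC := S.agree_c₁_c₂ m n
  have l₁ := S.c₁_pos m (n + 1)
  have l₂ := S.c₁_lt m (n + 1)
  have l₃ := S.c₂_lt m (n + 1)
  have l₄ := S.c₃_lt m (n + 1)
  have k₁ := S.c₁_pos m n
  have k₂ := S.c₁_lt m n
  have k₃ := S.c₂_lt m n
  have k₄ := S.c₃_lt m n
  have heq := S.c₁_eq m n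
  have hB₀ : ((S.x m (n + 1)).shift (S.c₁ m (n + 1))).rev.pt 0 =
      ((S.x m n).shift (S.c₂ m n)).pt 0 := by
    rw [← S.pt_zero_c₁, ← S.pt_zero_c₂]
  set s := S.c₁ m (n + 1) - t with hs
  have hus : (S.x m (n + 1)).pt t = ((S.x m (n + 1)).shift (S.c₁ m (n + 1))).rev.pt s := by
    rw [pt_rev, pt_shift]
    congr 1
    omega
  have hus' : (S.x m (n + 1)).pt t = ((S.x m n).shift (S.c₂ m n)).pt s := by
    rw [hus]
    exact hBC.pt_eq hB₀ le_rfl (by omega) (by omega) (by omega)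
  apply S.le_mu
  rcases hn' with rfl | rfl
  · have hB := thin.agree_of_onBoundary (p := ((S.x m (n + 1)).shift (S.c₁ m (n + 1))).rev)
      (q := S.x (m + 1) (n + 1)) (s := s) (k := (S.x m (n + 1)).len - S.c₁ m (n + 1))
      ((S.vertical m (n + 1) (-1) (by have := S.c₃_lt (m + 1) (n + 1); omega) (by omega)).symm)
      (by omega) (by rw [len_rev, len_shift]; omega) (by omega) (by rw [len_rev, len_shift]; omega)
      (by rwa [← hus]) (fun h => by
        have e := S.pt_zero m (n + 1)
        rw [← pt_add_len] at e
        rw [pt_rev, pt_shift, neg_neg, show S.c₁ m (n + 1) + ((S.x m (n + 1)).len - S.c₁ m (n + 1))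
          = 0 + (S.x m (n + 1)).len by ring, e] at h
        have := S.inc _ _ _ _ h
        omega)
    exact hB.symm.trans (hBC.mono le_rfl (by omega))
  · have hD := thin.agree_of_onBoundary (p := (S.x m n').shift (S.c₂ m n'))
      (q := ((S.x (m + 1) n').shift (S.c₃ (m + 1) n')).rev) (s := s) (k := S.c₂ m n')
      ((S.agree_c₃_c₂ m n' (-1) (by have := S.c₃_lt (m + 1) n'; omega) (by omega)).symm)
      (by omega) (by rw [len_shift]; omega) (by omega) (by rw [len_shift]; omega)
      (by rwa [← hus']) (fun h => by
        rw [pt_shift, add_neg_cancel, S.pt_zero] at h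
        have := S.inc _ _ _ _ h
        omega)
    -- Beyond the top side of the cell `(m + 1, n')`, the agreement would place `v (m + 2) (n' + 1)`
    -- on the cell `(m, n')`.
    have hle : s ≤ S.c₁ (m + 1) (n' + 1) := by
      by_contra hlt
      have p₁ := S.c₁_pos (m + 1) (n' + 1)
      have e₁ := S.c₁_eq (m + 1) n'
      have h₀ : ((S.x m n').shift (S.c₂ m n')).pt 0 =
          ((S.x (m + 1) n').shift (S.c₃ (m + 1) n')).rev.pt 0 := by
        rw [← S.pt_zero_c₂, ← S.pt_zero_c₃]
      have h₂ := hD.pt_eq h₀ le_rfl (by omega) p₁.le (by omega)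
      rw [pt_rev, pt_shift, pt_shift, show S.c₃ (m + 1) n' + -S.c₁ (m + 1) (n' + 1) = S.c₂ (m + 1) n' by omega,
        S.pt_c₂] at h₂
      have h₃ := onBoundary_pt (S.x m n') (S.c₂ m n' + S.c₁ (m + 1) (n' + 1))
      rw [h₂] at h₃
      have := S.inc _ _ _ _ h₃
      omega
    exact ((S.horizontal (m + 1) n').mono le_rfl hle).trans hD.symm

theorem onBoundary_below {m n t : ℤ} (h₀ : 0 ≤ t) (h₁ : t ≤ S.c₁ m (n + 1)) :
    X.OnBoundary ((S.x m (n + 1)).pt t) (S.x m n).face := by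
  rw [(S.horizontal m n).pt_eq (S.pt_zero_c₃ m n) le_rfl (by omega) h₀ h₁]
  exact onBoundary_pt ((S.x m n).shift (S.c₃ m n)).rev t

-- The vertex also lies on the cell below, and `king` applied to that cell gives `n' ≤ n`. If `m' =
-- m + 1`, then `sub_le_mu` would put the vertex into the overlap at the right end, which begins
-- only at the time `R`.
include thin in
theorem le_of_onBoundary_of_nonneg {m n t : ℤ} (h₀ : 0 ≤ t) (h₁ : t < S.R m n) {m' n' : ℤ}
    (hu : X.OnBoundary ((S.x m n).pt t) (S.x m' n').face) : m' ≤ m ∧ n' ≤ n := by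
  obtain ⟨n, rfl⟩ : ∃ k, n = k + 1 := ⟨n - 1, by ring⟩
  have hm := S.mu_nonneg (m + 1) (n + 1)
  rw [R] at h₁
  have k₁ := S.king m n m' n' _ (S.onBoundary_below h₀ (by omega)) hu
  have k₂ := S.king _ _ _ _ _ hu (onBoundary_pt (S.x m (n + 1)) t)
  refine ⟨?_, k₁.2⟩
  by_contra hlt
  obtain rfl : m' = m + 1 := by omega
  have := S.sub_le_mu thin h₀ (by omega) (by omega) hu
  omega

include thin in
/-- The `2`-cell `x m n` is the last one, in both directions, of those that contain a given vertex of
the edges of the flat that start at `v m n`. -/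
theorem le_of_onBoundary {m n t : ℤ} (h₀ : -S.L m n < t) (h₁ : t < S.R m n) {m' n' : ℤ}
    (hu : X.OnBoundary ((S.x m n).pt t) (S.x m' n').face) : m' ≤ m ∧ n' ≤ n := by
  rcases le_or_gt 0 t with h | h
  · exact S.le_of_onBoundary_of_nonneg thin h h₁ hu
  · refine (S.transpose.le_of_onBoundary_of_nonneg thin (m := n) (n := m) (t := -t) (m' := n')
      (n' := m') (by omega) (by rw [transpose_R]; omega) ?_).symm
    change X.OnBoundary ((S.x m n).rev.pt (-t)) _
    rw [pt_rev, neg_neg]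
    exact hu

/-- If the overlaps at both ends of a horizontal side met, two cells whose columns differ by two
would have a common vertex, against `king`. -/
theorem mu_lt_R (m n : ℤ) : S.mu m n < S.R m n := by
  obtain ⟨m, rfl⟩ : ∃ k, m = k + 1 := ⟨m - 1, by ring⟩
  obtain ⟨n, rfl⟩ : ∃ k, n = k + 1 := ⟨n - 1, by ring⟩
  by_contra hlt
  have h₁ := S.mu_succ_lt (m + 1) (n + 1)
  have h₂ := S.mu_nonneg (m + 1 + 1) (n + 1)
  have h₃ := S.lam_nonneg (m + 1 + 1) (n + 1)
  have hR : S.R (m + 1) (n + 1) = S.c₁ (m + 1) (n + 1) - S.mu (m + 1 + 1) (n + 1) := rfl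
  have e₁ := (S.mu_agree m n).pt_eq (S.pt_zero_c₂ m n) (t := S.R (m + 1) (n + 1)) le_rfl (by omega)
    (by omega) (by omega)
  have e₂ := (S.agree_c₁ (m + 1) (n + 1)).pt_eq (S.pt_zero_c₁ (m + 1) (n + 1))
    (t := S.mu (m + 1 + 1) (n + 1)) (by omega) (by omega) (by omega) le_rfl
  rw [pt_rev, pt_shift, ← sub_eq_add_neg, ← hR] at e₂
  have b₁ := onBoundary_pt ((S.x m n).shift (S.c₂ m n)) (S.R (m + 1) (n + 1))
  have b₂ := onBoundary_pt (S.x (m + 1 + 1) (n + 1)) (S.mu (m + 1 + 1) (n + 1))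
  rw [← e₁] at b₁
  rw [e₂] at b₂
  have := S.king _ _ _ _ _ b₁ b₂
  omega

theorem lam_lt_L (m n : ℤ) : S.lam m n < S.L m n := S.transpose.mu_lt_R n m

end FlatSystem

end TwoComplex

end SmallCancellation

namespace SmallCancellation

namespace TwoComplex

variable {X : TwoComplex.{u}}

open unitInterval

/-! ### Maps out of a geometric realization -/

section Points

variable (X)

/-- The point of the realization given by a vertex. -/
def vpt (a : X.V) : X.Realization := Quot.mk _ (X.vertexPt a)

/-- The points of the realization given by a dart. -/
def dpt (d : X.Dart) (t : I) : X.Realization := Quot.mk _ (X.dartPt d t)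

/-- The points of the realization given by a triangle of a polygon. -/
def fpt (f : X.Face) (k : ZMod (X.len f)) (t r : I) : X.Realization := Quot.mk _ (X.facePt f k t r)

variable {X}

theorem dpt_zero (d : X.Dart) : X.dpt d 0 = X.vpt (X.src d) := Quot.sound (.src d)

theorem dpt_rev (d : X.Dart) (t : I) : X.dpt (X.rev d) t = X.dpt d (σ t) := by
  have : X.dpt d (σ t) = X.dpt (X.rev d) (σ (σ t)) := Quot.sound (.rev d (σ t))
  rw [this, symm_symm]

theorem dpt_one (d : X.Dart) : X.dpt d 1 = X.vpt (X.tgt d) := by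
  rw [← symm_zero, ← dpt_rev, dpt_zero, Graph.tgt]

theorem fpt_one (f : X.Face) (k : ZMod (X.len f)) (t : I) : X.fpt f k t 1 = X.dpt (X.side f k) t :=
  Quot.sound (.attach f k t)

theorem fpt_spoke (f : X.Face) (k : ZMod (X.len f)) (r : I) :
    X.fpt f k 1 r = X.fpt f (k + 1) 0 r := Quot.sound (.spoke f k r)

theorem fpt_zero (f : X.Face) (k k' : ZMod (X.len f)) (t t' : I) :
    X.fpt f k t 0 = X.fpt f k' t' 0 := Quot.sound (.centre f k k' t t')

theorem continuous_dpt (d : X.Dart) : Continuous (X.dpt d) := by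
  refine continuous_quot_mk.comp (continuous_inr.comp (continuous_inl.comp ?_))
  exact continuous_sigmaMk

theorem continuous_fpt (f : X.Face) (k : ZMod (X.len f)) :
    Continuous fun p : I × I => X.fpt f k p.1 p.2 := by
  refine continuous_quot_mk.comp (continuous_inr.comp (continuous_inr.comp ?_))
  have h := @continuous_sigmaMk (ZMod (X.len f)) (fun _ => I × I) _ k
  exact (@continuous_sigmaMk X.Face (fun f => Σ _ : ZMod (X.len f), I × I) _ f).comp h

theorem Realization.ind {P : X.Realization → Prop} (h₀ : ∀ a, P (X.vpt a))
    (h₁ : ∀ d t, P (X.dpt d t)) (h₂ : ∀ f k t r, P (X.fpt f k t r)) (z : X.Realization) : P z := by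
  induction z using Quot.ind with
  | mk z =>
    rcases z with ⟨a, ⟨⟩⟩ | ⟨d, t⟩ | ⟨f, k, t, r⟩
    · exact h₀ a
    · exact h₁ d t
    · exact h₂ f k t r

/-- Continuous maps out of the realization are given by compatible families of continuous maps out of
the cells. -/
theorem Realization.exists_lift {Y : Type*} [TopologicalSpace Y] (a : X.V → Y) (b : X.Dart → I → Y)
    (c : (f : X.Face) → ZMod (X.len f) → I → I → Y) (hb : ∀ d, Continuous (b d))
    (hc : ∀ f k, Continuous fun p : I × I => c f k p.1 p.2) (h₁ : ∀ d, b d 0 = a (X.src d))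
    (h₂ : ∀ d t, b d t = b (X.rev d) (σ t)) (h₃ : ∀ f k t, c f k t 1 = b (X.side f k) t)
    (h₄ : ∀ f k r, c f k 1 r = c f (k + 1) 0 r) (h₅ : ∀ f k k' t t', c f k t 0 = c f k' t' 0) :
    ∃ F : X.Realization → Y, Continuous F ∧ (∀ v, F (X.vpt v) = a v) ∧
      (∀ d t, F (X.dpt d t) = b d t) ∧ ∀ f k t r, F (X.fpt f k t r) = c f k t r := by
  let F : X.Cells → Y := Sum.elim (fun z => a z.1)
    (Sum.elim (fun z => b z.1 z.2) fun z => c z.1 z.2.1 z.2.2.1 z.2.2.2)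
  have hF : ∀ z w, X.Glue z w → F z = F w := by
    rintro z w (d | ⟨d, t⟩ | ⟨f, k, t⟩ | ⟨f, k, r⟩ | ⟨f, k, k', t, t'⟩)
    · exact h₁ d
    · exact h₂ d t
    · exact h₃ f k t
    · exact h₄ f k r
    · exact h₅ f k k' t t'
  refine ⟨Quot.lift F hF, continuous_quot_lift hF ?_, fun _ => rfl, fun _ _ => rfl,
    fun _ _ _ _ => rfl⟩
  refine continuous_sum_dom.2 ⟨continuous_sigma fun v => continuous_of_const fun _ _ => rfl, continuous_sum_dom.2
    ⟨continuous_sigma hb, continuous_sigma fun f => continuous_sigma fun k => hc f k⟩⟩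

end Points

end TwoComplex

/-! ### Subdivision of the unit interval -/

namespace Subinterval

open unitInterval

/-- The affine parametrization of the `t`-th one of `N` equal parts of the unit interval. -/
noncomputable def sub (N t : ℕ) (s : I) : I :=
  Set.projIcc (0 : ℝ) 1 zero_le_one (((t : ℝ) + s) / N)

theorem continuous_sub (N t : ℕ) : Continuous (sub N t) :=
  continuous_projIcc.comp ((continuous_const.add continuous_subtype_val).div_const _)

theorem coe_sub {N t : ℕ} (h : t < N) (s : I) : ((sub N t s : I) : ℝ) = ((t : ℝ) + s) / N := by
  have hN : (0 : ℝ) < N := by exact_mod_cast (Nat.zero_le t).trans_lt h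
  have ht : (t : ℝ) + 1 ≤ N := by exact_mod_cast h
  have hs := s.2
  refine congrArg Subtype.val (Set.projIcc_of_mem zero_le_one ⟨?_, ?_⟩)
  · exact div_nonneg (add_nonneg (Nat.cast_nonneg t) hs.1) hN.le
  · rw [div_le_one hN]
    linarith [hs.2]

theorem sub_zero_zero (N : ℕ) : sub N 0 0 = 0 := by
  simp [sub]

theorem sub_one {N t : ℕ} (h : t + 1 = N) : sub N t 1 = 1 := by
  subst h
  have hN : (t : ℝ) + 1 ≠ 0 := by positivity
  refine Subtype.ext ?_
  rw [coe_sub (by omega)]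
  push_cast
  exact div_self hN

theorem sub_succ_zero (N t : ℕ) : sub N (t + 1) 0 = sub N t 1 := by
  simp [sub]

theorem symm_sub {N t : ℕ} (h : t < N) (s : I) : σ (sub N t s) = sub N (N - 1 - t) (σ s) := by
  have hN : (N : ℝ) ≠ 0 := by
    have : N ≠ 0 := by omega
    exact_mod_cast this
  refine Subtype.ext ?_
  rw [coe_symm_eq, coe_sub h, coe_sub (by omega), coe_symm_eq, Nat.sub_sub,
    Nat.cast_sub (by omega)]
  field_simp
  push_cast
  ring

theorem exists_sub {N : ℕ} (hN : 0 < N) (x : I) : ∃ t < N, ∃ s, sub N t s = x := by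
  have hN' : (0 : ℝ) < N := by exact_mod_cast hN
  have hx := x.2
  rcases hx.2.eq_or_lt with h | h
  · refine ⟨N - 1, by omega, 1, ?_⟩
    rw [sub_one (by omega)]
    exact Subtype.ext h.symm
  · have h₀ : 0 ≤ (x : ℝ) * N := mul_nonneg hx.1 hN'.le
    have h₁ := Nat.floor_le h₀
    have h₂ := Nat.lt_floor_add_one ((x : ℝ) * N)
    have h₃ : ⌊(x : ℝ) * N⌋₊ < N := by
      rw [Nat.floor_lt h₀]
      nlinarith
    refine ⟨_, h₃, ⟨(x : ℝ) * N - ⌊(x : ℝ) * N⌋₊, by linarith, by linarith⟩, Subtype.ext ?_⟩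
    rw [coe_sub h₃]
    field_simp
    ring

theorem sub_eq_sub {N t t' : ℕ} (h : t < N) (h' : t' < N) {s s' : I}
    (he : sub N t s = sub N t' s') :
    (t = t' ∧ s = s') ∨ (t' = t + 1 ∧ s = 1 ∧ s' = 0) ∨ (t = t' + 1 ∧ s' = 1 ∧ s = 0) := by
  have hN : (0 : ℝ) < N := by exact_mod_cast (Nat.zero_le t).trans_lt h
  have he' : (t : ℝ) + s = t' + s' := by
    have := congrArg Subtype.val he
    rw [coe_sub h, coe_sub h'] at this
    field_simp at this
    exact this
  have hs := s.2
  have hs' := s'.2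
  rcases lt_trichotomy t t' with hlt | rfl | hlt
  · have h₁ : (t : ℝ) + 1 ≤ t' := by exact_mod_cast hlt
    have h₂ : (t' : ℝ) = t + 1 := by linarith [hs.2, hs'.1]
    refine .inr (.inl ⟨by exact_mod_cast h₂, Subtype.ext ?_, Subtype.ext ?_⟩)
    · change (s : ℝ) = 1
      linarith [hs.2, hs'.1]
    · change (s' : ℝ) = 0
      linarith [hs.2, hs'.1]
  · exact .inl ⟨rfl, Subtype.ext (by linarith)⟩
  · have h₁ : (t' : ℝ) + 1 ≤ t := by exact_mod_cast hlt
    have h₂ : (t : ℝ) = t' + 1 := by linarith [hs'.2, hs.1]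
    refine .inr (.inr ⟨by exact_mod_cast h₂, Subtype.ext ?_, Subtype.ext ?_⟩)
    · change (s' : ℝ) = 1
      linarith [hs'.2, hs.1]
    · change (s : ℝ) = 0
      linarith [hs'.2, hs.1]

/-- Concatenation of a finite sequence of paths that depend on a parameter. -/
theorem exists_concat {W Y : Type*} [TopologicalSpace W] [CompactSpace W] [T2Space W]
    [TopologicalSpace Y] {N : ℕ} (hN : 0 < N) (h : ℕ → I → W → Y)
    (hc : ∀ t < N, Continuous fun p : I × W => h t p.1 p.2)
    (hh : ∀ t, t + 1 < N → ∀ w, h t 1 w = h (t + 1) 0 w) :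
    ∃ H : I → W → Y, (Continuous fun p : I × W => H p.1 p.2) ∧
      ∀ t < N, ∀ s w, H (sub N t s) w = h t s w := by
  choose t ht s hs using exists_sub hN
  let H : I → W → Y := fun x w => h (t x) (s x) w
  have key : ∀ i < N, ∀ x w, H (sub N i x) w = h i x w := by
    intro i hi x w
    change h (t (sub N i x)) (s (sub N i x)) w = h i x w
    have h' := ht (sub N i x)
    have hs' := hs (sub N i x)
    generalize t (sub N i x) = j at h' hs' ⊢
    generalize s (sub N i x) = y at hs' ⊢
    rcases sub_eq_sub h' hi hs' with ⟨h₁, h₂⟩ | ⟨h₁, h₂, h₃⟩ | ⟨h₁, h₂, h₃⟩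
    · rw [h₁, h₂]
    · rw [h₂, h₃, hh _ (by omega), ← h₁]
    · rw [h₃, h₂, h₁, hh _ (by omega)]
  refine ⟨H, ?_, key⟩
  -- As a continuous surjection from a compact space to a Hausdorff space, `q` is a quotient map, so
  -- continuity can be checked on each part.
  let q : (Σ _ : Fin N, I × W) → I × W := fun z => (sub N z.1 z.2.1, z.2.2)
  have hq : Continuous q :=
    continuous_sigma fun i => ((continuous_sub N i).comp continuous_fst).prodMk continuous_snd
  have hsurj : Function.Surjective q := fun z =>
    ⟨⟨⟨t z.1, ht z.1⟩, s z.1, z.2⟩, Prod.ext (hs z.1) rfl⟩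
  refine (hq.isClosedMap.isQuotientMap hq hsurj).continuous_iff.2 (continuous_sigma fun i => ?_)
  refine (hc i i.2).congr fun z => ?_
  exact (key i i.2 z.1 z.2).symm

end Subinterval

end SmallCancellation

/-! ### The realization of a subdivided complex -/

namespace SmallCancellation

namespace TwoComplex

open unitInterval TwoComplex.Flag Subinterval

namespace Flag

variable {Z : TwoComplex.{u}}

theorem polyDart_snd (y : Z.Flag) (T : ℤ) : (y.polyDart T).2 = y.dir := by
  obtain ⟨f, i, b⟩ := y
  cases b <;> rfl

theorem polyDart_fst_succ_of_true {y : Z.Flag} (h : y.dir = true) (T : ℤ) :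
    (y.polyDart (T + 1)).1 = (y.polyDart T).1 + 1 := by
  rw [polyDart_succ, polygonNext, polyDart_snd, h]
  rfl

theorem polyDart_fst_succ_of_false {y : Z.Flag} (h : y.dir = false) (T : ℤ) :
    (y.polyDart (T + 1)).1 = (y.polyDart T).1 - 1 := by
  rw [polyDart_succ, polygonNext, polyDart_snd, h]
  rfl

theorem polyDart_fst_eq_iff (y : Z.Flag) {S T : ℤ} :
    (y.polyDart S).1 = (y.polyDart T).1 ↔ (y.len : ℤ) ∣ T - S := by
  obtain ⟨f, i, b⟩ := y
  cases b
  · rw [polyDart_false f i _ _ rfl, polyDart_false f i _ _ rfl]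
    refine (ZMod.intCast_eq_intCast_iff_dvd_sub _ _ _).trans ?_
    rw [show i - 1 - T - (i - 1 - S) = -(T - S) by ring, dvd_neg]
    exact Iff.rfl
  · rw [polyDart_true f i _ _ rfl, polyDart_true f i _ _ rfl]
    refine (ZMod.intCast_eq_intCast_iff_dvd_sub _ _ _).trans ?_
    rw [show i + T - (i + S) = T - S by ring]
    exact Iff.rfl

theorem exists_polyDart_fst (y : Z.Flag) (k : ZMod (Z.len y.face)) :
    ∃ T : ℕ, T < y.len ∧ (y.polyDart T).1 = k := by
  have : ∃ T : ℤ, (y.polyDart T).1 = k := by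
    obtain ⟨f, i, b⟩ := y
    obtain ⟨j, rfl⟩ := ZMod.intCast_surjective k
    cases b
    · exact ⟨i - 1 - j, congrArg Prod.fst (polyDart_false f i _ j (by ring))⟩
    · exact ⟨j - i, congrArg Prod.fst (polyDart_true f i _ j (by ring))⟩
  obtain ⟨T, rfl⟩ := this
  have hy := y.len_pos'
  have h₀ := Int.emod_nonneg T hy.ne'
  have h₁ := Int.emod_lt_of_pos T hy
  refine ⟨(T % y.len).toNat, by omega, (polyDart_fst_eq_iff y).2 ?_⟩
  rw [Int.toNat_of_nonneg h₀]
  exact Int.dvd_self_sub_emod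

/-- The points of the triangle over the side that is traversed at time `T`. -/
def tri (y : Z.Flag) (T : ℤ) (s r : I) : Z.Realization :=
  Z.fpt y.face (y.polyDart T).1 (if y.dir then s else σ s) r

theorem tri_one (y : Z.Flag) (T : ℤ) (s : I) : y.tri T s 1 = Z.dpt (y.line T) s := by
  rw [tri, fpt_one, line, attach, polyDart_snd]
  split_ifs
  · rfl
  · rw [dpt_rev]

theorem tri_zero (y : Z.Flag) (T T' : ℤ) (s s' : I) : y.tri T s 0 = y.tri T' s' 0 :=
  fpt_zero _ _ _ _ _

theorem tri_spoke (y : Z.Flag) (T : ℤ) (r : I) : y.tri T 1 r = y.tri (T + 1) 0 r := by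
  unfold tri
  split_ifs with h
  · rw [polyDart_fst_succ_of_true h, fpt_spoke]
  · rw [polyDart_fst_succ_of_false (by simpa using h), symm_zero, symm_one, fpt_spoke,
      sub_add_cancel]

theorem tri_add_len (y : Z.Flag) (T : ℤ) (s r : I) : y.tri (T + y.len) s r = y.tri T s r := by
  rw [tri, polyDart_add_len, tri]

theorem continuous_tri (y : Z.Flag) (T : ℤ) :
    Continuous fun p : I × I => y.tri T p.1 p.2 := by
  unfold tri
  split_ifs
  · exact continuous_fpt _ _
  · exact (continuous_fpt y.face (y.polyDart T).1).comp
      ((continuous_symm.comp continuous_fst).prodMk continuous_snd)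

end Flag

/-! ### Subdivisions -/

/-- `Z` is obtained from `M`, up to isomorphism, by subdividing the `1`-cells: the dart `δ` of `M`
corresponds to the edge path `D δ 0, …, D δ (N δ - 1)` in `Z`. -/
structure Subdivision (M : TwoComplex.{v}) (Z : TwoComplex.{u}) where
  N : M.Dart → ℕ
  D : M.Dart → ℕ → Z.Dart
  vtx : M.V → Z.V
  flag : M.Face → Z.Flag
  N_pos : ∀ δ, 0 < N δ
  N_rev : ∀ δ, N (M.rev δ) = N δ
  D_rev : ∀ δ t, t < N δ → D (M.rev δ) (N δ - 1 - t) = Z.rev (D δ t)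
  src_zero : ∀ δ, Z.src (D δ 0) = vtx (M.src δ)
  src_succ : ∀ δ t, t + 1 < N δ → Z.src (D δ (t + 1)) = Z.tgt (D δ t)
  face_bijective : Function.Bijective fun p => (flag p).face
  flag_path : ∀ p, (flag p).path (flag p).len =
    (M.boundaryPath p 0).flatMap fun δ => (List.range (N δ)).map (D δ)
  D_inj : ∀ δ δ' t t', t < N δ → t' < N δ' → D δ t = D δ' t' → δ = δ' ∧ t = t'
  -- The last alternative is an interior vertex of a `1`-cell, seen from the two directions.
  src_inj : ∀ δ δ' t t', t < N δ → t' < N δ' → Z.src (D δ t) = Z.src (D δ' t') →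
    (t = 0 ∧ t' = 0 ∧ M.src δ = M.src δ') ∨ (δ = δ' ∧ t = t') ∨ (δ' = M.rev δ ∧ t + t' = N δ)
  D_surj : ∀ d, ∃ δ, ∃ t < N δ, D δ t = d
  exists_src : ∀ a : M.V, ∃ δ, M.src δ = a
  exists_src' : ∀ a : Z.V, ∃ d, Z.src d = a

namespace Subdivision

theorem length_flatMap {α β : Type*} (N : α → ℕ) (D : α → ℕ → β) (s : ℕ → α) (n : ℕ) :
    (((List.range n).map s).flatMap fun δ => (List.range (N δ)).map (D δ)).length =
      ∑ i ∈ Finset.range n, N (s i) := by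
  induction n with
  | zero => rfl
  | succ n ih =>
    rw [List.range_succ, List.map_append, List.flatMap_append, List.length_append, ih,
      Finset.sum_range_succ]
    simp

theorem eq_of_flatMap {α β : Type*} (N : α → ℕ) (D : α → ℕ → β) (s : ℕ → α) (g : ℕ → β) (n : ℕ)
    (h : (List.range (∑ i ∈ Finset.range n, N (s i))).map g =
      ((List.range n).map s).flatMap fun δ => (List.range (N δ)).map (D δ)) {k t : ℕ} (hk : k < n)
    (ht : t < N (s k)) : g (∑ i ∈ Finset.range k, N (s i) + t) = D (s k) t := by
  induction n with
  | zero => omega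
  | succ n ih =>
    rw [List.range_succ, List.map_append, List.flatMap_append, Finset.sum_range_succ,
      List.range_add, List.map_append] at h
    obtain ⟨h₁, h₂⟩ := List.append_inj h (by rw [length_flatMap]; simp)
    rcases Nat.lt_succ_iff_lt_or_eq.1 hk with hk | rfl
    · exact ih h₁ hk
    · rw [List.map_map, List.map_singleton, List.flatMap_singleton] at h₂
      have := List.map_inj_left.1 h₂ t (List.mem_range.2 ht)
      exact this

theorem exists_index_of_lt (N : ℕ → ℕ) {n T : ℕ} (hT : T < ∑ i ∈ Finset.range n, N i) :
    ∃ k < n, ∃ t < N k, T = ∑ i ∈ Finset.range k, N i + t := by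
  induction n with
  | zero => simp at hT
  | succ n ih =>
    by_cases h : T < ∑ i ∈ Finset.range n, N i
    · obtain ⟨k, hk, h⟩ := ih h
      exact ⟨k, by omega, h⟩
    · rw [Finset.sum_range_succ] at hT
      exact ⟨n, by omega, T - ∑ i ∈ Finset.range n, N i, by omega, by omega⟩

theorem index_unique (N : ℕ → ℕ) {k k' t t' : ℕ} (ht : t < N k) (ht' : t' < N k')
    (h : ∑ i ∈ Finset.range k, N i + t = ∑ i ∈ Finset.range k', N i + t') : k = k' ∧ t = t' := by
  have mono : ∀ {k k'}, k < k' → ∑ i ∈ Finset.range k, N i + N k ≤ ∑ i ∈ Finset.range k', N i := by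
    intro k k' hk
    rw [← Finset.sum_range_succ]
    exact Finset.sum_le_sum_of_subset (Finset.range_subset_range.2 hk)
  rcases lt_trichotomy k k' with hk | rfl | hk
  · have := mono hk
    omega
  · exact ⟨rfl, by omega⟩
  · have := mono hk
    omega

variable {M : TwoComplex.{v}} {Z : TwoComplex.{u}} (S : Subdivision M Z)

/-- The time at which the `k`-th side of a `2`-cell begins. -/
def off (p : M.Face) (k : ℕ) : ℕ :=
  ∑ i ∈ Finset.range k, S.N (M.side p (i : ZMod (M.len p)))

theorem off_zero (p : M.Face) : S.off p 0 = 0 := rfl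

theorem off_succ (p : M.Face) (k : ℕ) :
    S.off p (k + 1) = S.off p k + S.N (M.side p (k : ZMod (M.len p))) :=
  Finset.sum_range_succ _ _

theorem boundaryPath_zero (p : M.Face) : M.boundaryPath p 0 =
    (List.range (M.len p)).map fun i : ℕ => M.side p (i : ZMod (M.len p)) :=
  List.map_congr_left fun i _ => by rw [zero_add]

theorem off_len (p : M.Face) : S.off p (M.len p) = (S.flag p).len := by
  have h := congrArg List.length (S.flag_path p)
  rw [boundaryPath_zero, length_flatMap] at h
  rw [off, ← h]
  simp [path]

theorem line_off (p : M.Face) {k t : ℕ} (hk : k < M.len p)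
    (ht : t < S.N (M.side p (k : ZMod (M.len p)))) :
    (S.flag p).line ((S.off p k + t : ℕ) : ℤ) = S.D (M.side p (k : ZMod (M.len p))) t := by
  have h := S.flag_path p
  rw [boundaryPath_zero, ← S.off_len] at h
  exact eq_of_flatMap S.N S.D _ (fun i => (S.flag p).line (i : ℤ)) _ h hk ht

theorem exists_off (p : M.Face) {T : ℕ} (hT : T < (S.flag p).len) : ∃ k < M.len p,
    ∃ t < S.N (M.side p (k : ZMod (M.len p))), T = S.off p k + t := by
  rw [← S.off_len] at hT
  exact exists_index_of_lt (fun i => S.N (M.side p (i : ZMod (M.len p)))) hT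

theorem off_add_lt (p : M.Face) {k t : ℕ} (hk : k < M.len p)
    (ht : t < S.N (M.side p (k : ZMod (M.len p)))) : S.off p k + t < (S.flag p).len := by
  rw [← S.off_len]
  have h : S.off p (k + 1) ≤ S.off p (M.len p) :=
    Finset.sum_le_sum_of_subset (Finset.range_subset_range.2 hk)
  rw [off_succ] at h
  omega

/-- The part `t` of the `k`-th side of a `2`-cell is followed by the part `t'` of the `k'`-th one. -/
theorem exists_next (p : M.Face) {k t : ℕ} (hk : k < M.len p)
    (ht : t < S.N (M.side p (k : ZMod (M.len p)))) : ∃ k' < M.len p,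
    ∃ t' < S.N (M.side p (k' : ZMod (M.len p))),
      (S.flag p).polyDart ((S.off p k' + t' : ℕ) : ℤ) =
        (S.flag p).polyDart (((S.off p k + t : ℕ) : ℤ) + 1) ∧
      ∀ r, M.fpt p (k : ZMod (M.len p)) (sub (S.N (M.side p (k : ZMod (M.len p)))) t 1) r =
        M.fpt p (k' : ZMod (M.len p)) (sub (S.N (M.side p (k' : ZMod (M.len p)))) t' 0) r := by
  by_cases h : t + 1 < S.N (M.side p (k : ZMod (M.len p)))
  · refine ⟨k, hk, t + 1, h, rfl, fun r => ?_⟩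
    rw [sub_succ_zero]
  have h' : t + 1 = S.N (M.side p (k : ZMod (M.len p))) := by omega
  by_cases hk' : k + 1 < M.len p
  · refine ⟨k + 1, hk', 0, S.N_pos _, ?_, fun r => ?_⟩
    · rw [off_succ, ← h']
      rfl
    · rw [sub_one h', sub_zero_zero, fpt_spoke, Nat.cast_succ]
  · have hk' : k + 1 = M.len p := by omega
    refine ⟨0, by omega, 0, S.N_pos _, ?_, fun r => ?_⟩
    · have h₁ := S.off_succ p k
      rw [hk', S.off_len] at h₁
      rw [← polyDart_add_len, off_zero]
      congr 1
      push_cast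
      omega
    · have h₂ : ((k : ZMod (M.len p)) + 1) = 0 := by
        rw [← Nat.cast_succ, Nat.succ_eq_add_one, hk', ZMod.natCast_self]
      rw [sub_one h', sub_zero_zero, fpt_spoke, h₂, Nat.cast_zero]

/-- The map from the realization of a complex to that of its subdivision. -/
theorem exists_refine : ∃ G : M.Realization → Z.Realization, Continuous G ∧
    (∀ a, G (M.vpt a) = Z.vpt (S.vtx a)) ∧
    (∀ δ, ∀ t < S.N δ, ∀ s, G (M.dpt δ (sub (S.N δ) t s)) = Z.dpt (S.D δ t) s) ∧
    ∀ (p : M.Face), ∀ k < M.len p, ∀ t < S.N (M.side p (k : ZMod (M.len p))), ∀ s r,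
      G (M.fpt p (k : ZMod (M.len p)) (sub (S.N (M.side p (k : ZMod (M.len p)))) t s) r) =
        (S.flag p).tri ((S.off p k + t : ℕ) : ℤ) s r := by
  have hb : ∀ δ, ∃ H : I → Unit → Z.Realization,
      (Continuous fun p : I × Unit => H p.1 p.2) ∧
      ∀ t < S.N δ, ∀ s w, H (sub (S.N δ) t s) w = Z.dpt (S.D δ t) s := fun δ =>
    exists_concat (S.N_pos δ) (fun t s _ => Z.dpt (S.D δ t) s)
      (fun t _ => (continuous_dpt _).comp continuous_fst)
      (fun t ht _ => by rw [dpt_one, dpt_zero, S.src_succ δ t ht])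
  have hc : ∀ (p : M.Face) (k : ZMod (M.len p)), ∃ H : I → I → Z.Realization,
      (Continuous fun p : I × I => H p.1 p.2) ∧
      ∀ t < S.N (M.side p k), ∀ s r, H (sub (S.N (M.side p k)) t s) r =
        (S.flag p).tri ((S.off p k.val + t : ℕ) : ℤ) s r := fun p k =>
    exists_concat (S.N_pos _) (fun t s r => (S.flag p).tri ((S.off p k.val + t : ℕ) : ℤ) s r)
      (fun t _ => continuous_tri _ _) (fun t _ r => by rw [tri_spoke]; rfl)
  choose b b_cont hb using hb
  choose c c_cont hc using hc
  obtain ⟨G, hG, h₀, h₁, h₂⟩ := Realization.exists_lift (X := M) (fun a => Z.vpt (S.vtx a))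
    (fun δ s => b δ s ()) (fun p k s r => c p k s r)
    (fun δ => (b_cont δ).comp (continuous_id.prodMk continuous_const)) c_cont
    (fun δ => by
      have := hb δ 0 (S.N_pos δ) 0 ()
      rw [sub_zero_zero, dpt_zero, S.src_zero] at this
      exact this)
    (fun δ s => by
      obtain ⟨t, ht, s, rfl⟩ := exists_sub (S.N_pos δ) s
      have h := hb (M.rev δ) (S.N δ - 1 - t) (by rw [S.N_rev]; omega) (σ s) ()
      rw [S.N_rev] at h
      rw [hb δ t ht, symm_sub ht, h, S.D_rev δ t ht, dpt_rev, symm_symm])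
    (fun p k s => by
      have : NeZero (M.len p) := ⟨(M.len_pos p).ne'⟩
      obtain ⟨t, ht, s, rfl⟩ := exists_sub (S.N_pos (M.side p k)) s
      have hk : ((k.val : ℕ) : ZMod (M.len p)) = k := ZMod.natCast_zmod_val k
      have h := S.line_off p (ZMod.val_lt k) (t := t) (by rwa [hk])
      rw [hk] at h
      rw [hc p k t ht, hb _ t ht, tri_one, h])
    (fun p k r => by
      have : NeZero (M.len p) := ⟨(M.len_pos p).ne'⟩
      have hN := S.N_pos (M.side p k)
      have hk : ((k.val : ℕ) : ZMod (M.len p)) = k := ZMod.natCast_zmod_val k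
      have h₁ := hc p k (S.N (M.side p k) - 1) (by omega) 1 r
      have h₂ := hc p (k + 1) 0 (S.N_pos _) 0 r
      have h₃ := S.off_succ p k.val
      have hlt := ZMod.val_lt k
      rw [hk] at h₃
      rw [sub_one (by omega), tri_spoke] at h₁
      rw [sub_zero_zero] at h₂
      rw [h₁, h₂]
      by_cases h : k.val + 1 < M.len p
      · have hv : (k + 1).val = k.val + 1 := by
          rw [← hk, ← Nat.cast_succ, ZMod.val_natCast, ZMod.val_natCast, Nat.mod_eq_of_lt h,
            Nat.mod_eq_of_lt hlt]
        rw [hv, h₃]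
        congr 1
        push_cast
        omega
      · have hlen : k.val + 1 = M.len p := by omega
        have hv : k + 1 = 0 := by
          rw [← hk, ← Nat.cast_succ, Nat.succ_eq_add_one, hlen, ZMod.natCast_self]
        rw [hlen, S.off_len] at h₃
        rw [hv, ZMod.val_zero, off_zero, ← tri_add_len (S.flag p) ((0 + 0 : ℕ) : ℤ)]
        congr 1
        push_cast
        omega)
    (fun p k k' s s' => by
      obtain ⟨t, ht, s, rfl⟩ := exists_sub (S.N_pos (M.side p k)) s
      obtain ⟨t', ht', s', rfl⟩ := exists_sub (S.N_pos (M.side p k')) s'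
      rw [hc p k t ht, hc p k' t' ht', tri_zero])
  refine ⟨G, hG, h₀, fun δ t ht s => (h₁ _ _).trans (hb δ t ht s _), fun p k hk t ht s r => ?_⟩
  rw [h₂, hc p _ t ht, ZMod.val_natCast, Nat.mod_eq_of_lt hk]

/-- The map from the realization of a subdivision to that of the original complex. -/
theorem exists_coarsen : ∃ F : Z.Realization → M.Realization, Continuous F ∧
    (∀ δ, ∀ t < S.N δ, F (Z.vpt (Z.src (S.D δ t))) = M.dpt δ (sub (S.N δ) t 0)) ∧
    (∀ δ, ∀ t < S.N δ, ∀ s, F (Z.dpt (S.D δ t) s) = M.dpt δ (sub (S.N δ) t s)) ∧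
    ∀ (p : M.Face), ∀ k < M.len p, ∀ t < S.N (M.side p (k : ZMod (M.len p))), ∀ s r,
      F ((S.flag p).tri ((S.off p k + t : ℕ) : ℤ) s r) =
        M.fpt p (k : ZMod (M.len p)) (sub (S.N (M.side p (k : ZMod (M.len p)))) t s) r := by
  -- Each dart is written as some `D δ t`, and each vertex is represented by a dart that starts
  -- there. By `D_inj` and `src_inj` the values do not depend on these choices.
  choose e τ hτ he using S.D_surj
  choose w hw using S.exists_src'
  let b : Z.Dart → I → M.Realization := fun d s => M.dpt (e d) (sub (S.N (e d)) (τ d) s)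
  let a : Z.V → M.Realization := fun u => b (w u) 0
  have hb : ∀ δ, ∀ t < S.N δ, ∀ s, b (S.D δ t) s = M.dpt δ (sub (S.N δ) t s) := by
    intro δ t ht s
    obtain ⟨h₁, h₂⟩ := S.D_inj _ _ _ _ (hτ (S.D δ t)) ht (he (S.D δ t))
    change M.dpt (e (S.D δ t)) (sub (S.N (e (S.D δ t))) (τ (S.D δ t)) s) = _
    rw [h₁, h₂]
  have b_rev : ∀ d s, b (Z.rev d) s = b d (σ s) := by
    intro d s
    obtain ⟨δ, t, ht, rfl⟩ := S.D_surj d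
    have h := hb (M.rev δ) (S.N δ - 1 - t) (by rw [S.N_rev]; omega) s
    rw [S.N_rev] at h
    rw [← S.D_rev δ t ht, h, hb δ t ht, dpt_rev, ← symm_symm (sub _ t (σ s)), symm_sub ht, symm_symm]
  have ha : ∀ δ, ∀ t < S.N δ, a (Z.src (S.D δ t)) = M.dpt δ (sub (S.N δ) t 0) := by
    intro δ t ht
    change b (w (Z.src (S.D δ t))) 0 = _
    have h := hw (Z.src (S.D δ t))
    generalize w (Z.src (S.D δ t)) = d at h
    obtain ⟨δ', t', ht', rfl⟩ := S.D_surj d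
    rw [hb δ' t' ht']
    rcases S.src_inj _ _ _ _ ht' ht h with ⟨rfl, rfl, h'⟩ | ⟨rfl, rfl⟩ | ⟨rfl, h'⟩
    · rw [sub_zero_zero, sub_zero_zero, dpt_zero, dpt_zero, h']
    · rfl
    · rw [S.N_rev] at ht
      rw [dpt_rev, S.N_rev, symm_sub ht, symm_zero, ← sub_succ_zero]
      congr 2
      omega
  have hface : ∀ x : (Σ f : Z.Face, ZMod (Z.len f)), ∃ (p : M.Face) (k t : ℕ), k < M.len p ∧
      t < S.N (M.side p (k : ZMod (M.len p))) ∧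
      x = ⟨(S.flag p).face, ((S.flag p).polyDart ((S.off p k + t : ℕ) : ℤ)).1⟩ := by
    rintro ⟨f, i⟩
    obtain ⟨p, rfl⟩ := S.face_bijective.2 f
    obtain ⟨T, hT, rfl⟩ := exists_polyDart_fst (S.flag p) i
    obtain ⟨k, hk, t, ht, rfl⟩ := S.exists_off p hT
    exact ⟨p, k, t, hk, ht, rfl⟩
  choose q κ θ hκ hθ hq using hface
  -- The triangles are parametrized in the direction of the polygon; the parameter is reflected when
  -- the flag runs the other way.
  let c : (f : Z.Face) → ZMod (Z.len f) → I → I → M.Realization := fun f i s r =>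
    M.fpt (q ⟨f, i⟩) (κ ⟨f, i⟩ : ZMod (M.len (q ⟨f, i⟩)))
      (sub (S.N (M.side (q ⟨f, i⟩) (κ ⟨f, i⟩ : ZMod (M.len (q ⟨f, i⟩))))) (θ ⟨f, i⟩)
        (if (S.flag (q ⟨f, i⟩)).dir then s else σ s)) r
  have hc : ∀ (p : M.Face), ∀ k < M.len p, ∀ t < S.N (M.side p (k : ZMod (M.len p))), ∀ s r,
      c (S.flag p).face ((S.flag p).polyDart ((S.off p k + t : ℕ) : ℤ)).1 s r =
        M.fpt p (k : ZMod (M.len p)) (sub (S.N (M.side p (k : ZMod (M.len p)))) t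
          (if (S.flag p).dir then s else σ s)) r := by
    intro p k hk t ht s r
    change (fun x : (Σ f : Z.Face, ZMod (Z.len f)) => M.fpt (q x) (κ x : ZMod (M.len (q x)))
      (sub (S.N (M.side (q x) (κ x : ZMod (M.len (q x))))) (θ x)
        (if (S.flag (q x)).dir then s else σ s)) r) ⟨_, _⟩ = _
    generalize hx : (⟨(S.flag p).face, ((S.flag p).polyDart ((S.off p k + t : ℕ) : ℤ)).1⟩ :
      (Σ f : Z.Face, ZMod (Z.len f))) = x
    have h₁ := hκ x
    have h₂ := hθ x
    have h₃ := hx.trans (hq x)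
    beta_reduce
    generalize q x = p' at h₁ h₂ h₃ ⊢
    generalize κ x = k' at h₁ h₂ h₃ ⊢
    generalize θ x = t' at h₁ h₂ h₃ ⊢
    obtain rfl : p = p' := S.face_bijective.1 (congrArg Sigma.fst h₃)
    have h₄ := eq_of_heq (Sigma.mk.inj h₃).2
    have h₅ : S.off p k + t = S.off p k' + t' := by
      have h₆ := S.off_add_lt p hk ht
      have h₇ := S.off_add_lt p h₁ h₂
      have := Int.eq_zero_of_abs_lt_dvd ((polyDart_fst_eq_iff _).1 h₄) (abs_lt.2 ⟨by omega, by omega⟩)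
      omega
    obtain ⟨rfl, rfl⟩ :=
      index_unique (fun i => S.N (M.side p (i : ZMod (M.len p)))) ht h₂ h₅
    rfl
  have c_cont : ∀ f i, Continuous fun p : I × I => c f i p.1 p.2 := by
    intro f i
    refine (continuous_fpt _ _).comp
      (((continuous_sub _ _).comp ?_).prodMk continuous_snd)
    split_ifs
    · exact continuous_fst
    · exact continuous_symm.comp continuous_fst
  obtain ⟨F, hF, h₀, h₁, h₂⟩ := Realization.exists_lift (X := Z) a b c
    (fun d => (continuous_dpt _).comp (continuous_sub _ _)) c_cont
    (fun d => by
      obtain ⟨δ, t, ht, rfl⟩ := S.D_surj d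
      rw [hb δ t ht, ha δ t ht])
    (fun d s => by rw [b_rev, symm_symm])
    (fun f i s => by
      obtain ⟨p, rfl⟩ := S.face_bijective.2 f
      obtain ⟨T, hT, rfl⟩ := exists_polyDart_fst (S.flag p) i
      obtain ⟨k, hk, t, ht, rfl⟩ := S.exists_off p hT
      have h := S.line_off p hk ht
      rw [hc p k hk t ht, fpt_one, ← hb _ t ht, ← h, line, attach, polyDart_snd]
      split_ifs
      · rfl
      · rw [b_rev, symm_symm])
    (fun f i r => by
      obtain ⟨p, rfl⟩ := S.face_bijective.2 f
      -- For a backward flag the side `i + 1` is traversed just before the side `i`, so the time is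
      -- taken from `i + 1`.
      cases hd : (S.flag p).dir
      · obtain ⟨T, hT, hi⟩ := exists_polyDart_fst (S.flag p) (i + 1)
        obtain ⟨k, hk, t, ht, rfl⟩ := S.exists_off p hT
        obtain ⟨k', hk', t', ht', h, h'⟩ := S.exists_next p hk ht
        have e₁ := hc p k hk t ht 0 r
        have e₂ := hc p k' hk' t' ht' 1 r
        rw [h, polyDart_fst_succ_of_false hd, hi] at e₂
        rw [hi] at e₁
        simp only [add_sub_cancel_right, hd, Bool.false_eq_true, if_false, symm_one,
          symm_zero] at e₁ e₂
        rw [e₁, h']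
        exact e₂
      · obtain ⟨T, hT, rfl⟩ := exists_polyDart_fst (S.flag p) i
        obtain ⟨k, hk, t, ht, rfl⟩ := S.exists_off p hT
        obtain ⟨k', hk', t', ht', h, h'⟩ := S.exists_next p hk ht
        have e₁ := hc p k hk t ht 1 r
        have e₂ := hc p k' hk' t' ht' 0 r
        rw [h, polyDart_fst_succ_of_true hd] at e₂
        simp only [hd, if_true] at e₁ e₂
        rw [e₁, h']
        exact e₂.symm)
    (fun f i i' s s' => by
      obtain ⟨p, rfl⟩ := S.face_bijective.2 f
      obtain ⟨T, hT, rfl⟩ := exists_polyDart_fst (S.flag p) i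
      obtain ⟨T', hT', rfl⟩ := exists_polyDart_fst (S.flag p) i'
      obtain ⟨k, hk, t, ht, rfl⟩ := S.exists_off p hT
      obtain ⟨k', hk', t', ht', rfl⟩ := S.exists_off p hT'
      rw [hc p k hk t ht, hc p k' hk' t' ht']
      exact fpt_zero _ _ _ _ _)
  refine ⟨F, hF, fun δ t ht => (h₀ _).trans (ha δ t ht), fun δ t ht s => (h₁ _ _).trans (hb δ t ht s),
    fun p k hk t ht s r => ?_⟩
  rw [tri, h₂, hc p k hk t ht]
  split_ifs
  · rfl
  · rw [symm_symm]

include S in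
/-- The realizations of a complex and of a subdivision are homeomorphic. -/
theorem nonempty_homeomorph : Nonempty (Z.Realization ≃ₜ M.Realization) := by
  obtain ⟨G, hG, g₀, g₁, g₂⟩ := S.exists_refine
  obtain ⟨F, hF, f₀, f₁, f₂⟩ := S.exists_coarsen
  refine ⟨⟨⟨F, G, fun z => ?_, fun z => ?_⟩, hF, hG⟩⟩
  · induction z using Realization.ind with
    | h₀ u =>
      obtain ⟨d, rfl⟩ := S.exists_src' u
      obtain ⟨δ, t, ht, rfl⟩ := S.D_surj d
      rw [f₀ δ t ht, g₁ δ t ht, dpt_zero]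
    | h₁ d s =>
      obtain ⟨δ, t, ht, rfl⟩ := S.D_surj d
      rw [f₁ δ t ht, g₁ δ t ht]
    | h₂ f i s r =>
      obtain ⟨p, rfl⟩ := S.face_bijective.2 f
      obtain ⟨T, hT, rfl⟩ := exists_polyDart_fst (S.flag p) i
      obtain ⟨k, hk, t, ht, rfl⟩ := S.exists_off p hT
      have h : Z.fpt (S.flag p).face ((S.flag p).polyDart ((S.off p k + t : ℕ) : ℤ)).1 s r =
          (S.flag p).tri ((S.off p k + t : ℕ) : ℤ) (if (S.flag p).dir then s else σ s) r := by
        rw [tri]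
        split_ifs
        · rfl
        · rw [symm_symm]
      rw [h, f₂ p k hk t ht, g₂ p k hk t ht]
  · induction z using Realization.ind with
    | h₀ a =>
      obtain ⟨δ, rfl⟩ := S.exists_src a
      rw [g₀, ← S.src_zero, f₀ δ 0 (S.N_pos δ), sub_zero_zero, dpt_zero]
    | h₁ δ s =>
      obtain ⟨t, ht, s, rfl⟩ := exists_sub (S.N_pos δ) s
      rw [g₁ δ t ht, f₁ δ t ht]
    | h₂ p k s r =>
      have : NeZero (M.len p) := ⟨(M.len_pos p).ne'⟩
      obtain ⟨k, hk, rfl⟩ : ∃ j < M.len p, (j : ZMod (M.len p)) = k :=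
        ⟨k.val, ZMod.val_lt k, ZMod.natCast_zmod_val k⟩
      obtain ⟨t, ht, s, rfl⟩ := exists_sub (S.N_pos (M.side p k)) s
      rw [g₂ p k hk t ht, f₂ p k hk t ht]

end Subdivision

end TwoComplex

end SmallCancellation

/-! ### The union of a flat system as a subdivision of a model plane -/

namespace SmallCancellation

namespace TwoComplex

open TwoComplex.Flag

namespace Flag

variable {Z : TwoComplex.{u}}

/-- The path that the line of a flag runs through between two times. -/
def seg (x : Z.Flag) (a b : ℤ) : List Z.Dart := (x.shift a).path (b - a).toNat

theorem seg_append (x : Z.Flag) {a b c : ℤ} (h₁ : a ≤ b) (h₂ : b ≤ c) :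
    x.seg a b ++ x.seg b c = x.seg a c := by
  have h := path_add (x.shift a) (b - a).toNat (c - b).toNat
  rw [shift_shift, Int.toNat_of_nonneg (by omega), add_sub_cancel] at h
  rw [seg, seg, ← h, seg]
  congr 1
  omega

theorem seg_congr {x y : Z.Flag} {a b : ℤ} (h : x.Agree y a b) : x.seg a b = y.seg a b := by
  refine List.map_congr_left fun i hi => ?_
  have := List.mem_range.1 hi
  rw [line_shift, line_shift]
  exact h _ (by omega) (by omega)

theorem seg_shift (x : Z.Flag) (s a b : ℤ) : (x.shift s).seg a b = x.seg (s + a) (s + b) := by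
  rw [seg, seg, shift_shift]
  congr 1
  omega

theorem seg_add_len (x : Z.Flag) (a b : ℤ) : x.seg (a + x.len) (b + x.len) = x.seg a b := by
  unfold seg
  rw [show b + x.len - (a + x.len) = b - a by ring]
  refine List.map_congr_left fun i _ => ?_
  rw [line_shift, line_shift, ← line_add_len x (a + i)]
  congr 1
  ring

end Flag

variable {Z : TwoComplex.{u}}

namespace FlatSystem

variable (S : FlatSystem Z)

/-- The vertices of the flat where the four `2`-cells around it have no edge in common. -/
def collapsed : Set (ℤ × ℤ) := {p | S.mu p.1 p.2 + S.lam p.1 p.2 = 0}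

/-- The `2`-cell on whose line an edge of the model is found. -/
def base : ModelEdge S.collapsed → ℤ × ℤ
  | .x i j => (i, j)
  | .y i j => (i, j)
  | .z i j _ => (i, j)

/-- The time at which an edge of the model begins. -/
noncomputable def lo : ModelEdge S.collapsed → ℤ
  -- The times from `-L` to `-lam`, from `-lam` to `mu`, and from `mu` to `R` are those of the
  -- `y`-edge, the `z`-edge and the `x`-edge at `(i, j)`.
  | .x i j => S.mu i j
  | .y i j => -S.L i j
  | .z i j _ => -S.lam i j

/-- The time at which an edge of the model ends. -/
noncomputable def hi : ModelEdge S.collapsed → ℤ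
  | .x i j => S.R i j
  | .y i j => -S.lam i j
  | .z i j _ => S.mu i j

/-- The direction in which an edge of the model is traversed. -/
def fwd : ModelEdge S.collapsed → Bool
  | .x _ _ => true
  -- The positive direction of a `y`-edge leads from `-lam` to `-L`, and that of a `z`-edge from
  -- `mu` to `-lam`; both run against the line.
  | .y _ _ => false
  | .z _ _ _ => false

/-- The line of a `2`-cell. -/
def ln (p : ℤ × ℤ) : Z.Flag := S.x p.1 p.2

theorem lo_lt_hi (e : ModelEdge S.collapsed) : S.lo e < S.hi e := by
  cases e with
  | x i j => exact S.mu_lt_R i j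
  | y i j =>
    have := S.lam_lt_L i j
    simp only [lo, hi]
    omega
  | z i j h =>
    have h₁ : ¬ S.mu i j + S.lam i j = 0 := h
    have := S.mu_nonneg i j
    have := S.lam_nonneg i j
    simp only [lo, hi]
    omega

theorem le_lo (e : ModelEdge S.collapsed) : -S.L (S.base e).1 (S.base e).2 ≤ S.lo e := by
  cases e with
  | x i j =>
    have := S.mu_nonneg i j
    have := S.lam_nonneg i j
    have := S.lam_lt_L i j
    simp only [lo, base]
    omega
  | y i j => exact le_rfl
  | z i j h =>
    have := S.lam_lt_L i j
    simp only [lo, base]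
    omega

theorem hi_le (e : ModelEdge S.collapsed) : S.hi e ≤ S.R (S.base e).1 (S.base e).2 := by
  cases e with
  | x i j => exact le_rfl
  | y i j =>
    have := S.mu_nonneg i j
    have := S.lam_nonneg i j
    have := S.mu_lt_R i j
    simp only [hi, base]
    omega
  | z i j h => exact (S.mu_lt_R i j).le

/-- The three half-open time intervals at the same base are disjoint. -/
theorem edge_unique {e e' : ModelEdge S.collapsed} (h : S.base e = S.base e') {τ : ℤ}
    (h₁ : S.lo e ≤ τ) (h₂ : τ < S.hi e) (h₁' : S.lo e' ≤ τ) (h₂' : τ < S.hi e') : e = e' := by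
  cases e with
  | x i j =>
    have h₃ := S.mu_nonneg i j
    have h₄ := S.lam_nonneg i j
    cases e' <;> obtain ⟨rfl, rfl⟩ := Prod.ext_iff.1 h <;> simp only [lo, hi, base] at * <;>
      first | rfl | omega
  | y i j =>
    have h₃ := S.mu_nonneg i j
    have h₄ := S.lam_nonneg i j
    cases e' <;> obtain ⟨rfl, rfl⟩ := Prod.ext_iff.1 h <;> simp only [lo, hi, base] at * <;>
      first | rfl | omega
  | z i j _ =>
    cases e' <;> obtain ⟨rfl, rfl⟩ := Prod.ext_iff.1 h <;> simp only [lo, hi, base] at * <;>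
      first | rfl | omega

/-- The ends of the edges of the model are not in the interior of an edge. -/
theorem not_interior {e : ModelEdge S.collapsed} {τ : ℤ}
    (hτ : τ = S.mu (S.base e).1 (S.base e).2 ∨ τ = -S.lam (S.base e).1 (S.base e).2)
    (h₁ : S.lo e < τ) (h₂ : τ < S.hi e) : False := by
  cases e with
  | x i j =>
    have h₃ := S.mu_nonneg i j
    have h₄ := S.lam_nonneg i j
    simp only [lo, hi, base] at *
    omega
  | y i j =>
    have h₃ := S.mu_nonneg i j
    have h₄ := S.lam_nonneg i j
    simp only [lo, hi, base] at *
    omega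
  | z i j _ =>
    simp only [lo, hi, base] at *
    omega

/-- The flag along whose line a dart of the model is found. -/
noncomputable def dartFlag (δ : ModelEdge S.collapsed × Bool) : Z.Flag :=
  if δ.2 = S.fwd δ.1 then (S.ln (S.base δ.1)).shift (S.lo δ.1)
  else ((S.ln (S.base δ.1)).shift (S.hi δ.1)).rev

/-- The number of darts that make up a dart of the model. -/
noncomputable def num (δ : ModelEdge S.collapsed × Bool) : ℕ := (S.hi δ.1 - S.lo δ.1).toNat

theorem num_eq (δ : ModelEdge S.collapsed × Bool) : (S.num δ : ℤ) = S.hi δ.1 - S.lo δ.1 :=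
  Int.toNat_of_nonneg (by have := S.lo_lt_hi δ.1; omega)

/-- The time, on the line of the `2`-cell, at which the `t`-th vertex of a dart is found. -/
noncomputable def time (δ : ModelEdge S.collapsed × Bool) (t : ℤ) : ℤ :=
  if δ.2 = S.fwd δ.1 then S.lo δ.1 + t else S.hi δ.1 - t

theorem src_dartFlag (δ : ModelEdge S.collapsed × Bool) (t : ℤ) :
    Z.src ((S.dartFlag δ).line t) = (S.ln (S.base δ.1)).pt (S.time δ t) := by
  change (S.dartFlag δ).pt t = _
  unfold dartFlag time
  split_ifs
  · rw [pt_shift]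
  · rw [pt_rev, pt_shift, sub_eq_add_neg]

theorem dartFlag_line (δ : ModelEdge S.collapsed × Bool) {t : ℕ} (ht : t < S.num δ) :
    ∃ τ, S.lo δ.1 ≤ τ ∧ τ < S.hi δ.1 ∧
      ((δ.2 = S.fwd δ.1 ∧ τ = S.lo δ.1 + t ∧
        (S.dartFlag δ).line t = (S.ln (S.base δ.1)).line τ) ∨
      (δ.2 ≠ S.fwd δ.1 ∧ τ = S.hi δ.1 - 1 - t ∧
        (S.dartFlag δ).line t = Z.rev ((S.ln (S.base δ.1)).line τ))) := by
  have h := S.num_eq δ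
  by_cases hd : δ.2 = S.fwd δ.1
  · refine ⟨S.lo δ.1 + t, by omega, by omega, .inl ⟨hd, rfl, ?_⟩⟩
    rw [dartFlag, if_pos hd, line_shift]
  · refine ⟨S.hi δ.1 - 1 - t, by omega, by omega, .inr ⟨hd, rfl, ?_⟩⟩
    rw [dartFlag, if_neg hd, line_rev, line_shift]
    congr 2
    ring

theorem dartFlag_rev (δ : ModelEdge S.collapsed × Bool) {t : ℕ} (ht : t < S.num δ) :
    (S.dartFlag (δ.1, !δ.2)).line ((S.num δ - 1 - t : ℕ) : ℤ) =
      Z.rev ((S.dartFlag δ).line t) := by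
  obtain ⟨e, b⟩ := δ
  have h : (S.num (e, b) : ℤ) = S.hi e - S.lo e := S.num_eq (e, b)
  unfold dartFlag
  by_cases hd : b = S.fwd e
  · have hd' : (!b) ≠ S.fwd e := by rw [hd]; simp
    rw [if_neg hd', if_pos hd, line_rev, line_shift, line_shift]
    refine congrArg (fun τ => Z.rev ((S.ln (S.base e)).line τ)) ?_
    dsimp only
    omega
  · have hd' : (!b) = S.fwd e := by
      revert hd
      cases b <;> cases S.fwd e <;> simp
    rw [if_pos hd', if_neg hd, line_rev, line_shift, line_shift, Z.rev_rev]
    refine congrArg (S.ln (S.base e)).line ?_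
    dsimp only
    omega

/-- The times from `-L` to `R` span less than a turn, with one unit to spare. Hence thinness
recovers a time from its vertex, also when both ends of a dart are compared. -/
theorem R_add_L_lt (m n : ℤ) : S.R m n + S.L m n + 1 < (S.x m n).len := by
  have h₁ := S.mu_nonneg (m + 1) n
  have h₂ := S.lam_nonneg m (n + 1)
  have h₃ := S.c₁_lt m n
  have h₄ := S.c₂_lt m n
  unfold R L
  omega

variable (thin : Z.IsThin)

include thin

/-- By `le_of_onBoundary` each of the two cells is the last one that contains the common vertex, so
they are the same cell. -/
theorem pt_inj {p q : ℤ × ℤ} {σ τ : ℤ} (h₁ : -S.L p.1 p.2 < σ) (h₂ : σ < S.R p.1 p.2)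
    (h₁' : -S.L q.1 q.2 < τ) (h₂' : τ < S.R q.1 q.2) (h : (S.ln p).pt σ = (S.ln q).pt τ) :
    p = q ∧ σ = τ := by
  have hp : Z.OnBoundary ((S.ln p).pt σ) (S.x q.1 q.2).face := by
    rw [h]
    exact onBoundary_pt _ _
  have hq : Z.OnBoundary ((S.ln q).pt τ) (S.x p.1 p.2).face := by
    rw [← h]
    exact onBoundary_pt _ _
  have k₁ := S.le_of_onBoundary thin h₁ h₂ hp
  have k₂ := S.le_of_onBoundary thin h₁' h₂' hq
  obtain rfl : p = q := Prod.ext (by omega) (by omega)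
  have hl : (S.R p.1 p.2 + S.L p.1 p.2 + 1 < (S.ln p).len) := S.R_add_L_lt p.1 p.2
  exact ⟨rfl, thin.eq_of_pt_eq _ h (by omega) (by omega)⟩

/-- `le_of_onBoundary` does not cover the time `-L` itself; there the end of the dart is used
instead of its beginning. -/
theorem le_of_line_mem {p q : ℤ × ℤ} {σ : ℤ} (h₁ : -S.L p.1 p.2 ≤ σ) (h₂ : σ < S.R p.1 p.2)
    (h : Z.OnBoundary ((S.ln p).pt σ) (S.ln q).face)
    (h' : Z.OnBoundary ((S.ln p).pt (σ + 1)) (S.ln q).face) : q.1 ≤ p.1 ∧ q.2 ≤ p.2 := by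
  rcases h₁.eq_or_lt with h₃ | h₃
  · have := S.lam_lt_L p.1 p.2
    have := S.lam_nonneg p.1 p.2
    have := S.mu_lt_R p.1 p.2
    have := S.mu_nonneg p.1 p.2
    exact S.le_of_onBoundary thin (by omega) (by omega) h'
  · exact S.le_of_onBoundary thin h₃ h₂ h

/-- Equal or opposite darts have the same end points, which forces the same cell. Opposite
directions would then require `σ = τ + 1` and `σ + 1 = τ`. -/
theorem line_inj {p q : ℤ × ℤ} {σ τ : ℤ} (h₁ : -S.L p.1 p.2 ≤ σ) (h₂ : σ < S.R p.1 p.2)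
    (h₁' : -S.L q.1 q.2 ≤ τ) (h₂' : τ < S.R q.1 q.2)
    (h : (S.ln p).line σ = (S.ln q).line τ ∨ (S.ln p).line σ = Z.rev ((S.ln q).line τ)) :
    p = q ∧ σ = τ ∧ (S.ln p).line σ = (S.ln q).line τ := by
  have hpt : ((S.ln p).pt σ = (S.ln q).pt τ ∧ (S.ln p).pt (σ + 1) = (S.ln q).pt (τ + 1)) ∨
      ((S.ln p).pt σ = (S.ln q).pt (τ + 1) ∧ (S.ln p).pt (σ + 1) = (S.ln q).pt τ) := by
    rcases h with h | h
    · exact .inl ⟨congrArg Z.src h,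
        (tgt_line _ _).symm.trans ((congrArg Z.tgt h).trans (tgt_line _ _))⟩
    · refine .inr ⟨(congrArg Z.src h).trans (tgt_line _ _), ?_⟩
      refine (tgt_line _ _).symm.trans ((congrArg Z.tgt h).trans ?_)
      rw [Graph.tgt, Z.rev_rev]
      rfl
  have k₁ := S.le_of_line_mem thin (q := q) h₁ h₂
    (by rcases hpt with ⟨h, -⟩ | ⟨h, -⟩ <;> rw [h] <;> exact onBoundary_pt _ _)
    (by rcases hpt with ⟨-, h⟩ | ⟨-, h⟩ <;> rw [h] <;> exact onBoundary_pt _ _)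
  have k₂ := S.le_of_line_mem thin (q := p) h₁' h₂'
    (by rcases hpt with ⟨h, -⟩ | ⟨-, h⟩ <;> rw [← h] <;> exact onBoundary_pt _ _)
    (by rcases hpt with ⟨-, h⟩ | ⟨h, -⟩ <;> rw [← h] <;> exact onBoundary_pt _ _)
  obtain rfl : p = q := Prod.ext (by omega) (by omega)
  have hl : (S.R p.1 p.2 + S.L p.1 p.2 + 1 < (S.ln p).len) := S.R_add_L_lt p.1 p.2
  rcases hpt with ⟨h₃, -⟩ | ⟨h₃, h₄⟩
  · obtain rfl := thin.eq_of_pt_eq _ h₃ (by omega) (by omega)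
    exact ⟨rfl, rfl, rfl⟩
  · have e₁ := thin.eq_of_pt_eq _ h₃ (by omega) (by omega)
    have e₂ := thin.eq_of_pt_eq _ h₄ (by omega) (by omega)
    omega

theorem dart_inj {δ δ' : ModelEdge S.collapsed × Bool} {t t' : ℕ} (ht : t < S.num δ)
    (ht' : t' < S.num δ') (h : (S.dartFlag δ).line t = (S.dartFlag δ').line t') :
    δ = δ' ∧ t = t' := by
  obtain ⟨σ, h₁, h₂, hσ⟩ := S.dartFlag_line δ ht
  obtain ⟨τ, h₁', h₂', hτ⟩ := S.dartFlag_line δ' ht'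
  have l₁ := S.le_lo δ.1
  have l₂ := S.hi_le δ.1
  have l₁' := S.le_lo δ'.1
  have l₂' := S.hi_le δ'.1
  obtain ⟨hb, rfl, hl⟩ := S.line_inj thin (l₁.trans h₁) (h₂.trans_le l₂) (l₁'.trans h₁')
    (h₂'.trans_le l₂') (p := S.base δ.1) (q := S.base δ'.1) (by
      rcases hσ with ⟨-, -, e⟩ | ⟨-, -, e⟩ <;> rcases hτ with ⟨-, -, e'⟩ | ⟨-, -, e'⟩
      · exact .inl (e.symm.trans (h.trans e'))
      · exact .inr (e.symm.trans (h.trans e'))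
      · right
        have := e.symm.trans (h.trans e')
        rw [← this, Z.rev_rev]
      · left
        exact Z.revPerm.injective (e.symm.trans (h.trans e')))
  obtain ⟨e, b⟩ := δ
  obtain ⟨e', b'⟩ := δ'
  obtain rfl : e = e' := S.edge_unique hb h₁ h₂ h₁' h₂'
  rcases hσ with ⟨d, r, e₁⟩ | ⟨d, r, e₁⟩ <;> rcases hτ with ⟨d', r', e₂⟩ | ⟨d', r', e₂⟩ <;>
    dsimp only at r r'
  · exact ⟨Prod.ext rfl (d.trans d'.symm), by omega⟩
  · exact absurd (e₂.symm.trans (h.symm.trans e₁)) (Z.rev_ne _)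
  · exact absurd (e₁.symm.trans (h.trans e₂)) (Z.rev_ne _)
  · refine ⟨Prod.ext rfl ?_, by omega⟩
    change b = b'
    simp only at d d'
    revert d d'
    cases b <;> cases b' <;> cases S.fwd e <;> simp

omit thin in
/-- The vertex of the flat system that corresponds to a vertex of the model. -/
noncomputable def vtx (a : ModelVertex S.collapsed) : Z.V :=
  (S.x a.1.1 a.1.2.1).pt (if a.1.2.2 then -S.lam a.1.1 a.1.2.1 else S.mu a.1.1 a.1.2.1)

omit thin in
theorem vtx_modelVertex (i j : ℤ) (b : Bool) : S.vtx (modelVertex S.collapsed i j b) =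
    (S.x i j).pt (if b then -S.lam i j else S.mu i j) := by
  unfold modelVertex
  by_cases h : (i, j) ∈ S.collapsed
  · have h' : S.mu i j + S.lam i j = 0 := h
    have := S.mu_nonneg i j
    have := S.lam_nonneg i j
    rw [dif_pos h]
    change (S.x i j).pt (S.mu i j) = _
    refine congrArg (S.x i j).pt ?_
    cases b
    · rfl
    · change S.mu i j = -S.lam i j
      omega
  · rw [dif_neg h]
    rfl

omit thin in
theorem vtx_eq (a : ModelVertex S.collapsed) : ∃ τ, S.vtx a = (S.ln (a.1.1, a.1.2.1)).pt τ ∧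
    (τ = S.mu a.1.1 a.1.2.1 ∨ τ = -S.lam a.1.1 a.1.2.1) ∧ -S.L a.1.1 a.1.2.1 < τ ∧
    τ < S.R a.1.1 a.1.2.1 ∧ (a.1.2.2 = true → τ = -S.lam a.1.1 a.1.2.1) ∧
    (a.1.2.2 = false → τ = S.mu a.1.1 a.1.2.1) := by
  obtain ⟨⟨i, j, b⟩, ha⟩ := a
  have := S.lam_lt_L i j
  have := S.lam_nonneg i j
  have := S.mu_lt_R i j
  have := S.mu_nonneg i j
  refine ⟨_, rfl, ?_⟩
  cases b
  · change (S.mu i j = S.mu i j ∨ S.mu i j = -S.lam i j) ∧ -S.L i j < S.mu i j ∧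
      S.mu i j < S.R i j ∧ (false = true → S.mu i j = -S.lam i j) ∧
      (false = false → S.mu i j = S.mu i j)
    exact ⟨.inl rfl, by omega, by omega, nofun, fun _ => rfl⟩
  · change (-S.lam i j = S.mu i j ∨ -S.lam i j = -S.lam i j) ∧ -S.L i j < -S.lam i j ∧
      -S.lam i j < S.R i j ∧ (true = true → -S.lam i j = -S.lam i j) ∧
      (true = false → -S.lam i j = S.mu i j)
    exact ⟨.inr rfl, by omega, by omega, fun _ => rfl, nofun⟩

/-- Two vertices of the model over `(i, j)` could coincide only if the overlap were trivial, but
then the upper one has been removed. -/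
theorem vtx_injective : Function.Injective S.vtx := by
  intro a a' h
  obtain ⟨σ, e, -, h₁, h₂, h₃, h₄⟩ := S.vtx_eq a
  obtain ⟨τ, e', -, h₁', h₂', h₃', h₄'⟩ := S.vtx_eq a'
  obtain ⟨hp, rfl⟩ := S.pt_inj thin (p := (_, _)) (q := (_, _)) h₁ h₂ h₁' h₂'
    (e.symm.trans (h.trans e'))
  obtain ⟨⟨i, j, b⟩, ha⟩ := a
  obtain ⟨⟨i', j', b'⟩, ha'⟩ := a'
  obtain ⟨rfl, rfl⟩ := Prod.mk.inj hp
  have key : S.mu i j = -S.lam i j → (i, j) ∈ S.collapsed := fun h => by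
    change S.mu i j + S.lam i j = 0
    omega
  refine Subtype.ext ?_
  cases b <;> cases b'
  · rfl
  · have := ha' (key ((h₄ rfl).symm.trans (h₃' rfl)))
    simp at this
  · have := ha (key ((h₄' rfl).symm.trans (h₃ rfl)))
    simp at this
  · rfl

-- The ends at the times `R` and `-L` belong to the next vertex of the model; `agree_c₁` and
-- `agree_c₃` move them to the line of the neighbouring cell.
omit thin in
theorem src_dartFlag_zero (δ : ModelEdge S.collapsed × Bool) :
    Z.src ((S.dartFlag δ).line 0) = S.vtx (modelEnd S.collapsed δ.1 δ.2) := by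
  rw [src_dartFlag]
  obtain ⟨e, b⟩ := δ
  cases e with
  | x i j =>
    cases b
    · refine Eq.trans ?_ (S.vtx_modelVertex (i + 1) j false).symm
      have h := (S.agree_c₁ i j).pt_eq (S.pt_zero_c₁ i j) (t := S.mu (i + 1) j)
        (by have := S.lam_nonneg (i + 1) j; omega) (S.mu_nonneg _ _)
        (by have := S.lam_nonneg (i + 1) j; have := S.mu_nonneg (i + 1) j; omega) le_rfl
      rw [pt_rev, pt_shift, ← sub_eq_add_neg] at h
      change (S.x i j).pt (S.R i j - 0) = (S.x (i + 1) j).pt (S.mu (i + 1) j)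
      rw [sub_zero, h, R]
    · refine Eq.trans ?_ (S.vtx_modelVertex i j false).symm
      change (S.x i j).pt (S.mu i j + 0) = (S.x i j).pt (S.mu i j)
      rw [add_zero]
  | y i j =>
    cases b
    · refine Eq.trans ?_ (S.vtx_modelVertex i (j + 1) true).symm
      have h := (S.agree_c₃ i j).pt_eq (S.pt_zero_c₃ i j) (t := -S.lam i (j + 1))
        (by have := S.lam_nonneg i (j + 1); omega) (S.mu_nonneg _ _) le_rfl
        (by have := S.lam_nonneg i (j + 1); have := S.mu_nonneg i (j + 1); omega)
      rw [pt_rev, pt_shift, neg_neg] at h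
      change (S.x i j).pt (-S.L i j + 0) = (S.x i (j + 1)).pt (-S.lam i (j + 1))
      rw [h, ← pt_add_len, L]
      congr 1
      ring
    · refine Eq.trans ?_ (S.vtx_modelVertex i j true).symm
      change (S.x i j).pt (-S.lam i j - 0) = (S.x i j).pt (-S.lam i j)
      rw [sub_zero]
  | z i j h =>
    cases b
    · refine Eq.trans ?_ (S.vtx_modelVertex i j true).symm
      change (S.x i j).pt (-S.lam i j + 0) = (S.x i j).pt (-S.lam i j)
      rw [add_zero]
    · refine Eq.trans ?_ (S.vtx_modelVertex i j false).symm
      change (S.x i j).pt (S.mu i j - 0) = (S.x i j).pt (S.mu i j)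
      rw [sub_zero]

omit thin in
theorem time_interior (δ : ModelEdge S.collapsed × Bool) {t : ℕ} (h₀ : 0 < t) (ht : t < S.num δ) :
    S.lo δ.1 < S.time δ t ∧ S.time δ t < S.hi δ.1 := by
  have h := S.num_eq δ
  unfold time
  split_ifs <;> omega

theorem src_vtx_ne (δ : ModelEdge S.collapsed × Bool) {t : ℕ} (h₀ : 0 < t) (ht : t < S.num δ)
    (a : ModelVertex S.collapsed) : Z.src ((S.dartFlag δ).line t) ≠ S.vtx a := by
  intro h
  rw [src_dartFlag] at h
  obtain ⟨h₁, h₂⟩ := S.time_interior δ h₀ ht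
  have l₁ := S.le_lo δ.1
  have l₂ := S.hi_le δ.1
  obtain ⟨τ, e, hτ, h₃, h₄, -⟩ := S.vtx_eq a
  obtain ⟨hp, hs⟩ := S.pt_inj thin (p := S.base δ.1) (q := (a.1.1, a.1.2.1))
    (l₁.trans_lt h₁) (h₂.trans_le l₂) h₃ h₄ (h.trans e)
  refine S.not_interior ?_ h₁ h₂
  rw [hp, hs]
  exact hτ

theorem src_inj {δ δ' : ModelEdge S.collapsed × Bool} {t t' : ℕ} (ht : t < S.num δ)
    (ht' : t' < S.num δ')
    (h : Z.src ((S.dartFlag δ).line t) = Z.src ((S.dartFlag δ').line t')) :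
    (t = 0 ∧ t' = 0 ∧ modelEnd S.collapsed δ.1 δ.2 = modelEnd S.collapsed δ'.1 δ'.2) ∨
      (δ = δ' ∧ t = t') ∨ (δ' = (δ.1, !δ.2) ∧ t + t' = S.num δ) := by
  rcases Nat.eq_zero_or_pos t with rfl | h₀ <;> rcases Nat.eq_zero_or_pos t' with rfl | h₀'
  · refine .inl ⟨rfl, rfl, S.vtx_injective thin ?_⟩
    rw [← src_dartFlag_zero, ← src_dartFlag_zero]
    exact h
  · exact absurd (h.symm.trans (S.src_dartFlag_zero δ)) (S.src_vtx_ne thin δ' h₀' ht' _)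
  · exact absurd (h.trans (S.src_dartFlag_zero δ')) (S.src_vtx_ne thin δ h₀ ht _)
  · right
    rw [src_dartFlag, src_dartFlag] at h
    obtain ⟨h₁, h₂⟩ := S.time_interior δ h₀ ht
    obtain ⟨h₁', h₂'⟩ := S.time_interior δ' h₀' ht'
    obtain ⟨hb, hτ⟩ := S.pt_inj thin ((S.le_lo δ.1).trans_lt h₁) (h₂.trans_le (S.hi_le δ.1))
      ((S.le_lo δ'.1).trans_lt h₁') (h₂'.trans_le (S.hi_le δ'.1)) h
    obtain ⟨e, b⟩ := δ
    obtain ⟨e', b'⟩ := δ'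
    rw [← hτ] at h₁' h₂'
    obtain rfl : e = e' := S.edge_unique hb h₁.le h₂ h₁'.le h₂'
    have hn := S.num_eq (e, b)
    unfold time at hτ
    simp only at hτ hn
    by_cases hd : b = S.fwd e <;> by_cases hd' : b' = S.fwd e
    · rw [if_pos hd, if_pos hd'] at hτ
      exact .inl ⟨Prod.ext rfl (hd.trans hd'.symm), by omega⟩
    · rw [if_pos hd, if_neg hd'] at hτ
      refine .inr ⟨Prod.ext rfl ?_, by omega⟩
      change b' = !b
      rw [← hd] at hd'
      revert hd'
      cases b <;> cases b' <;> simp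
    · rw [if_neg hd, if_pos hd'] at hτ
      refine .inr ⟨Prod.ext rfl ?_, by omega⟩
      change b' = !b
      rw [← hd'] at hd
      revert hd
      cases b <;> cases b' <;> simp
    · rw [if_neg hd, if_neg hd'] at hτ
      refine .inl ⟨Prod.ext rfl ?_, by omega⟩
      change b = b'
      revert hd hd'
      cases b <;> cases b' <;> cases S.fwd e <;> simp

omit thin

/-- The path that corresponds to a dart of the model. -/
noncomputable def dartPath (δ : ModelEdge S.collapsed × Bool) : List Z.Dart :=
  (List.range (S.num δ)).map fun t : ℕ => (S.dartFlag δ).line t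

theorem dartPath_fwd (e : ModelEdge S.collapsed) (b : Bool) (h : b = S.fwd e) :
    S.dartPath (e, b) = (S.ln (S.base e)).seg (S.lo e) (S.hi e) := by
  rw [dartPath, dartFlag, if_pos h]
  rfl

theorem dartPath_bwd (e : ModelEdge S.collapsed) (b : Bool) (h : b ≠ S.fwd e) :
    S.dartPath (e, b) = (S.ln (S.base e)).rev.seg (-S.hi e) (-S.lo e) := by
  rw [dartPath, dartFlag, if_neg h]
  simp only [Flag.rev_shift]
  rw [seg, show -S.lo e - -S.hi e = S.hi e - S.lo e by ring]
  rfl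

theorem vertical_up (i j : ℤ) : (modelVertical S.collapsed i j true).flatMap S.dartPath =
    (S.x i j).rev.seg (-S.mu i j) (S.lam i j) := by
  unfold modelVertical
  split_ifs with h
  · have h' : S.mu i j + S.lam i j = 0 := h
    rw [seg, show (S.lam i j - -S.mu i j) = 0 by omega]
    rfl
  · rw [List.flatMap_singleton, S.dartPath_bwd _ _ (by simp [fwd])]
    change (S.x i j).rev.seg (-S.mu i j) (- -S.lam i j) = _
    rw [neg_neg]

theorem vertical_down (i j : ℤ) : (modelVertical S.collapsed i j false).flatMap S.dartPath =
    (S.x i j).seg (-S.lam i j) (S.mu i j) := by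
  unfold modelVertical
  split_ifs with h
  · have h' : S.mu i j + S.lam i j = 0 := h
    rw [seg, show (S.mu i j - -S.lam i j) = 0 by omega]
    rfl
  · rw [List.flatMap_singleton, S.dartPath_fwd _ _ (by simp [fwd])]
    rfl

/-- The boundary path of a `2`-cell, as a subdivision of a boundary path of the model. -/
theorem seg_eq_flatMap (p : ℤ × ℤ) :
    (S.ln p).seg (S.mu p.1 p.2) (S.mu p.1 p.2 + (S.ln p).len) =
      (modelWord S.collapsed p).flatMap S.dartPath := by
  obtain ⟨m, n⟩ := p
  have r₁ := S.mu_lt_R m n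
  have r₂ := S.lam_lt_L (m + 1) n
  have r₃ := S.mu_lt_R m (n + 1)
  have r₄ := S.lam_lt_L m n
  have q₁ := S.mu_nonneg m n
  have q₂ := S.mu_nonneg (m + 1) n
  have q₃ := S.mu_nonneg m (n + 1)
  have q₄ := S.mu_nonneg (m + 1) (n + 1)
  have s₁ := S.lam_nonneg m n
  have s₂ := S.lam_nonneg (m + 1) n
  have s₃ := S.lam_nonneg m (n + 1)
  have s₄ := S.lam_nonneg (m + 1) (n + 1)
  have hR : S.R m n = S.c₁ m n - S.mu (m + 1) n := rfl
  have hR' : S.R m (n + 1) = S.c₁ m (n + 1) - S.mu (m + 1) (n + 1) := rfl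
  have hL : S.L m n = (S.x m n).len - S.c₃ m n - S.lam m (n + 1) := rfl
  have hL' : S.L (m + 1) n =
    (S.x (m + 1) n).len - S.c₃ (m + 1) n - S.lam (m + 1) (n + 1) := rfl
  have e₁ := S.c₁_eq m n
  have e₂ := S.len_sub m n
  set y := S.x m n with hy
  -- The turn from `mu` to `len + mu` is cut at `R`, `c₁ + lam`, `c₂ - lam`, `c₂ + mu`, `c₃ - mu`,
  -- `c₃ + lam` and `len - lam`, with `mu` and `lam` taken at the respective corner of the unit
  -- square. The eight parts match the eight entries of `modelWord`; those for vertical edges may be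
  -- empty.
  have w₁ : S.dartPath (.x m n, true) = y.seg (S.mu m n) (S.R m n) := S.dartPath_fwd _ _ rfl
  have w₂ : (S.x (m + 1) n).rev.seg (-S.mu (m + 1) n) (S.lam (m + 1) n) =
      y.seg (S.R m n) (S.c₁ m n + S.lam (m + 1) n) := by
    have h := (S.agree_c₁ m n).rev
    rw [Flag.rev_rev, neg_neg] at h
    rw [seg_congr h, seg_shift, hR, sub_eq_add_neg]
  have w₃ : S.dartPath (.y (m + 1) n, true) =
      y.seg (S.c₁ m n + S.lam (m + 1) n) (S.c₂ m n - S.lam (m + 1) (n + 1)) := by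
    have h := (S.vertical m n).rev
    rw [Flag.rev_rev, neg_zero] at h
    rw [S.dartPath_bwd _ _ (by simp [fwd])]
    change (S.x (m + 1) n).rev.seg (- -S.lam (m + 1) n) (- -S.L (m + 1) n) = _
    rw [neg_neg, neg_neg, seg_congr (h.mono s₂ (by omega)), seg_shift]
    congr 1
    omega
  have w₄ : (S.x (m + 1) (n + 1)).seg (-S.lam (m + 1) (n + 1)) (S.mu (m + 1) (n + 1)) =
      y.seg (S.c₂ m n - S.lam (m + 1) (n + 1)) (S.c₂ m n + S.mu (m + 1) (n + 1)) := by
    rw [seg_congr (S.agree_c₂ m n), seg_shift, sub_eq_add_neg]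
  have w₅ : S.dartPath (.x m (n + 1), false) =
      y.seg (S.c₂ m n + S.mu (m + 1) (n + 1)) (S.c₃ m n - S.mu m (n + 1)) := by
    have h := (S.horizontal m n).rev
    rw [Flag.rev_rev, neg_zero] at h
    rw [S.dartPath_bwd _ _ (by simp [fwd])]
    change (S.x m (n + 1)).rev.seg (-S.R m (n + 1)) (-S.mu m (n + 1)) = _
    rw [seg_congr (h.mono (by omega) (by omega)), seg_shift]
    congr 1
    omega
  have w₆ : (S.x m (n + 1)).rev.seg (-S.mu m (n + 1)) (S.lam m (n + 1)) =
      y.seg (S.c₃ m n - S.mu m (n + 1)) (S.c₃ m n + S.lam m (n + 1)) := by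
    have h := (S.agree_c₃ m n).rev
    rw [Flag.rev_rev, neg_neg] at h
    rw [seg_congr h, seg_shift, sub_eq_add_neg]
  have w₇ : S.dartPath (.y m n, false) =
      y.seg (S.c₃ m n + S.lam m (n + 1)) (-S.lam m n + y.len) := by
    rw [S.dartPath_fwd (.y m n) false rfl]
    change y.seg (-S.L m n) (-S.lam m n) = _
    rw [← seg_add_len]
    congr 1
    omega
  have w₈ : y.seg (-S.lam m n) (S.mu m n) = y.seg (-S.lam m n + y.len) (S.mu m n + y.len) :=
    (seg_add_len _ _ _).symm
  simp only [modelWord, List.flatMap_append, List.flatMap_singleton, vertical_up, vertical_down]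
  rw [w₁, w₂, w₃, w₄, w₅, w₆, w₇, w₈, seg_append _ (by omega) (by omega),
    seg_append _ (by omega) (by omega), seg_append _ (by omega) (by omega),
    seg_append _ (by omega) (by omega), seg_append _ (by omega) (by omega),
    seg_append _ (by omega) (by omega), seg_append _ (by omega) (by omega)]
  rfl

theorem face_injective : Function.Injective fun p => (S.ln p).face := by
  intro p q h
  have key : ∀ p q : ℤ × ℤ, (S.ln p).face = (S.ln q).face → q.1 ≤ p.1 ∧ q.2 ≤ p.2 := by
    intro p q h
    have h₁ := onBoundary_pt (S.ln p) 0
    rw [h, show (S.ln p).pt 0 = S.v p.1 p.2 from S.pt_zero _ _] at h₁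
    have := S.inc _ _ _ _ h₁
    omega
  have h₁ := key p q h
  have h₂ := key q p h.symm
  exact Prod.ext (by omega) (by omega)

theorem boundaryPath_modelPlane (A : Set (ℤ × ℤ)) (p : ℤ × ℤ) :
    (modelPlane A).boundaryPath p 0 = modelWord A p := by
  have : NeZero (modelWord A p).length := ⟨(modelWord_length_pos A p).ne'⟩
  refine List.ext_getElem ?_ fun i h₁ h₂ => ?_
  · simp only [boundaryPath, List.length_map, List.length_range]
    rfl
  · simp only [boundaryPath, List.getElem_map, List.getElem_range]
    have h : ((0 : ZMod (modelWord A p).length) + (i : ZMod (modelWord A p).length)).val = i := by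
      rw [zero_add, ZMod.val_natCast]
      exact Nat.mod_eq_of_lt h₂
    change cyclicGet (modelWord A p) (modelWord_length_pos A p) (0 + (i : ZMod (modelWord A p).length)) = _
    unfold cyclicGet
    simp only [h, List.get_eq_getElem]
    rfl

/-- A complex that is the union of the `2`-cells of a flat system is a subdivision of a model
plane. -/
noncomputable def subdivision (hface : ∀ f, ∃ p, (S.ln p).face = f)
    (hdart : Z.EveryEdgeInFace) (hvert : ∀ a, ∃ d, Z.src d = a) :
    Subdivision (modelPlane S.collapsed) Z :=
  have hpath : ∀ p : ℤ × ℤ, ((S.ln p).shift (S.mu p.1 p.2)).path (S.ln p).len =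
      ((modelPlane S.collapsed).boundaryPath p 0).flatMap S.dartPath := fun p => by
    rw [boundaryPath_modelPlane, ← seg_eq_flatMap, seg, add_sub_cancel_left, Int.toNat_natCast]
  { N := S.num
    D := fun δ t => (S.dartFlag δ).line t
    vtx := S.vtx
    flag := fun p => (S.ln p).shift (S.mu p.1 p.2)
    N_pos := fun δ => by
      have := S.num_eq δ
      have := S.lo_lt_hi δ.1
      omega
    N_rev := fun δ => rfl
    D_rev := fun δ t ht => S.dartFlag_rev δ ht
    src_zero := S.src_dartFlag_zero
    src_succ := fun δ t _ => by
      push_cast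
      exact (S.dartFlag δ).src_line_succ t
    face_bijective := ⟨S.face_injective, hface⟩
    flag_path := hpath
    D_inj := fun δ δ' t t' ht ht' h => S.dart_inj thin ht ht' h
    src_inj := fun δ δ' t t' ht ht' h => S.src_inj thin ht ht' h
    D_surj := fun d => by
      -- By periodicity every dart of the line occurs in the turn described by `hpath`.
      have key : ∀ p : ℤ × ℤ, ∀ T : ℤ, ∃ δ, ∃ t < S.num δ,
          (S.dartFlag δ).line (t : ℕ) = (S.ln p).line T := by
        intro p T
        have hmem : (S.ln p).line T ∈ ((S.ln p).shift (S.mu p.1 p.2)).path (S.ln p).len := by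
          have hp := (S.ln p).len_pos'
          have h₀ := Int.emod_nonneg (T - S.mu p.1 p.2) hp.ne'
          have h₁ := Int.emod_lt_of_pos (T - S.mu p.1 p.2) hp
          refine List.mem_map.2 ⟨((T - S.mu p.1 p.2) % (S.ln p).len).toNat,
            List.mem_range.2 (by omega), ?_⟩
          rw [line_shift, Int.toNat_of_nonneg h₀]
          refine line_congr _ ?_
          have := Int.dvd_self_sub_emod (x := T - S.mu p.1 p.2) (m := (S.ln p).len)
          rw [show S.mu p.1 p.2 + (T - S.mu p.1 p.2) % (S.ln p).len - T =
            -(T - S.mu p.1 p.2 - (T - S.mu p.1 p.2) % (S.ln p).len) by ring]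
          exact dvd_neg.2 this
        rw [hpath] at hmem
        obtain ⟨δ, -, h⟩ := List.mem_flatMap.1 hmem
        obtain ⟨t, ht, h⟩ := List.mem_map.1 h
        exact ⟨δ, t, List.mem_range.1 ht, h⟩
      obtain ⟨f, hf⟩ := hdart d
      obtain ⟨p, rfl⟩ := hface f
      obtain ⟨y, hy, rfl⟩ := exists_of_attach hf
      obtain ⟨n, hn⟩ := exists_shift_corner (x := S.ln p) (y := y) hy.symm
      rcases twin_or_twin_rev hn with h | h
      · obtain ⟨δ, t, ht, e⟩ := key p n
        refine ⟨δ, t, ht, e.trans ?_⟩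
        rw [← h.full.1, line_shift, add_zero]
      -- The reversed flag starts along the reverse of the dart that precedes the time `n`.
      · obtain ⟨δ, t, ht, e⟩ := key p (n + -1)
        refine ⟨(δ.1, !δ.2), S.num δ - 1 - t, by change _ < S.num δ; omega,
          (S.dartFlag_rev δ ht).trans ?_⟩
        rw [e, ← h.full.1, line_rev, line_shift, sub_zero]
    exists_src := fun a => by
      obtain ⟨⟨i, j, b⟩, ha⟩ := a
      cases b
      · refine ⟨(.x i j, true), ?_⟩
        change modelVertex S.collapsed i j false = _
        unfold modelVertex
        split_ifs <;> rfl
      · have h : (i, j) ∉ S.collapsed := fun h => by simpa using ha h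
        refine ⟨(.y i j, true), ?_⟩
        change modelVertex S.collapsed i j true = _
        unfold modelVertex
        rw [dif_neg h]
    exists_src' := hvert }

end FlatSystem

end TwoComplex

end SmallCancellation

namespace SmallCancellation

namespace TwoComplex

/-! ### Properties inherited by subcomplexes -/

namespace Subcomplex

open TwoComplex.Flag

variable {X : TwoComplex.{u}} (E : X.Subcomplex)

theorem val_attach (f : E.cx.Face) (s : (polygon (E.cx.len f)).Dart) :
    (E.cx.attach f s).1 = X.attach f.1 s := by
  obtain ⟨k, b⟩ := s
  cases b <;> rfl

/-- The inclusion of a subcomplex. -/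
def incl : Hom E.cx X where
  onV := Subtype.val
  onDart := Subtype.val
  onFace := Subtype.val
  src_onDart := fun _ => rfl
  rev_onDart := fun _ => rfl
  face_iso := fun f => ⟨⟨.refl _, .refl _, fun _ => rfl, fun _ => rfl⟩,
    fun s => (E.val_attach f s).symm⟩

theorem onBoundary_iff {a : E.cx.V} {f : E.cx.Face} :
    E.cx.OnBoundary a f ↔ X.OnBoundary a.1 f.1 :=
  ⟨fun ⟨k, h⟩ => ⟨k, congrArg Subtype.val h⟩, fun ⟨k, h⟩ => ⟨k, Subtype.ext h⟩⟩

theorem isLift_val {f : E.cx.Face} {q : List (polygon (E.cx.len f)).Dart} {p : List E.cx.Dart}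
    (h : E.cx.IsLift f q p) : X.IsLift f.1 q (p.map E.incl.onDart) := by
  refine ⟨h.1, ?_⟩
  rw [← h.2, List.map_map]
  exact List.map_congr_left fun s _ => (E.val_attach f s).symm

theorem isPieceIn_val {A : Set E.cx.Face} {p : List E.cx.Dart} (h : E.cx.IsPieceIn A p) :
    X.IsPieceIn (E.incl.onFace '' A) (p.map E.incl.onDart) := by
  obtain ⟨hp, f₁, h₁, f₂, h₂, q₁, q₂, l₁, l₂, h⟩ := h
  refine ⟨fun h => hp (List.map_eq_nil_iff.1 h), f₁.1, ⟨f₁, h₁, rfl⟩, f₂.1, ⟨f₂, h₂, rfl⟩,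
    q₁, q₂, E.isLift_val l₁, E.isLift_val l₂, ?_⟩
  rintro ⟨g, hq, hg⟩
  refine h ⟨g, hq, fun s => Subtype.ext ?_⟩
  exact (E.val_attach f₂ _).trans ((hg s).trans (E.val_attach f₁ s).symm)

theorem isC {n : ℕ} (hC : X.IsC n) : E.cx.IsC n := by
  intro f k l hl h
  have := hC f.1 k (l.map (List.map E.incl.onDart)) (fun c hc => by
    obtain ⟨c, hc', rfl⟩ := List.mem_map.1 hc
    obtain ⟨h₀, f₁, -, f₂, -, h⟩ := E.isPieceIn_val (hl c hc')
    exact ⟨h₀, f₁, trivial, f₂, trivial, h⟩) (by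
    rw [← List.map_flatten, h, boundaryPath, List.map_map]
    rfl)
  rwa [List.length_map] at this

/-- A map to the subcomplex is also a map to `X` with the same image. Since a reduced map refers to
pieces of the image only, it stays reduced. -/
theorem isT {n : ℕ} (hT : X.IsT n) : E.cx.IsT n := by
  intro D φ hφ
  refine hT D
    { onV := fun a => (φ.onV a).1
      onDart := fun d => (φ.onDart d).1
      onFace := fun f => (φ.onFace f).1
      src_onDart := fun d => congrArg Subtype.val (φ.src_onDart d)
      rev_onDart := fun d => congrArg Subtype.val (φ.rev_onDart d)
      face_iso := fun f => by
        obtain ⟨g, hg⟩ := φ.face_iso f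
        exact ⟨g, fun s => (E.val_attach _ _).symm.trans (congrArg Subtype.val (hg s))⟩ } ?_
  intro p hp
  have h := E.isPieceIn_val (hφ p hp)
  rwa [List.map_map, ← Set.range_comp] at h

/-- A flag of a subcomplex as a flag of the ambient complex. -/
def flag (x : E.cx.Flag) : X.Flag := ⟨x.face.1, x.pos, x.dir⟩

theorem exists_flag {x : X.Flag} (h : x.face ∈ E.faces) : ∃ y, E.flag y = x :=
  ⟨⟨⟨x.face, h⟩, x.pos, x.dir⟩, rfl⟩

theorem line_flag (x : E.cx.Flag) (t : ℤ) : (E.flag x).line t = (x.line t).1 := by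
  obtain ⟨f, i, b⟩ := x
  refine Eq.trans ?_ (E.val_attach f _).symm
  cases b <;> rfl

theorem vert_flag (x : E.cx.Flag) : (E.flag x).vert = x.vert.1 :=
  congrArg X.src (E.line_flag x 0)

theorem corner_flag (x : E.cx.Flag) : (E.flag x).corner = (x.corner.1.1, x.corner.2) := rfl

theorem corner_inj {x y : E.cx.Flag} (h : (E.flag x).corner = (E.flag y).corner) :
    x.corner = y.corner := by
  rw [corner_flag, corner_flag] at h
  obtain ⟨h₁, h₂⟩ := Prod.mk.inj h
  exact Prod.ext (Subtype.ext h₁) h₂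

theorem isThin (thin : X.IsThin) : E.cx.IsThin where
  corner_eq := fun {x y} hf hv => E.corner_inj <| thin.corner_eq (congrArg Subtype.val hf) <| by
    rw [vert_flag, vert_flag, hv]
  matches_of_vert := fun {x y x' y'} hx hy hv hv' hne => by
    obtain ⟨z, w, n, h₁, h₂, h₃, h₄, h₅⟩ := thin.matches_of_vert
      (x := E.flag x) (y := E.flag y) (x' := E.flag x') (y' := E.flag y')
      (congrArg Subtype.val hx) (congrArg Subtype.val hy)
      (by rw [vert_flag, vert_flag, hv]) (by rw [vert_flag, vert_flag, hv'])
      (by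
        rw [vert_flag, vert_flag]
        exact fun h => hne (Subtype.ext h))
    obtain ⟨z, rfl⟩ := E.exists_flag (x := z) (by
      rw [show z.face = x.face.1 from congrArg Prod.fst h₁]
      exact x.face.2)
    obtain ⟨w, rfl⟩ := E.exists_flag (x := w) (by
      rw [show w.face = y.face.1 from congrArg Prod.fst h₂]
      exact y.face.2)
    refine ⟨z, w, n, E.corner_inj h₁, E.corner_inj h₂, E.corner_inj h₃, E.corner_inj h₄,
      fun t ht ht' => Subtype.ext ?_, fun t ht ht' => Subtype.ext ?_⟩
    · rw [← line_flag, ← line_flag]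
      exact h₅.1 t ht ht'
    · rw [← vert_flag, ← vert_flag]
      exact h₅.2 t ht ht'

end Subcomplex

/-! ### Gallery distance -/

/-- A chain that is shortest among all chains is in particular minimal among those formed from its
own cells, so it is a gallery. -/
theorem IsCellChain.galleryDist_eq {X : TwoComplex.{u}} {f g : X.Face} {l : List X.Face}
    (h : X.IsCellChain f g l) (hmin : ∀ l', X.IsCellChain f g l' → l.length ≤ l'.length) :
    X.galleryDist f g = l.length := by
  refine le_antisymm (sInf_le ⟨l, ⟨h, fun l' h' _ => hmin l' h'⟩, rfl⟩) (le_sInf ?_)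
  rintro _ ⟨l', h', rfl⟩
  exact_mod_cast hmin l' h'.1

theorem IsCellChain.val {X : TwoComplex.{u}} {E : X.Subcomplex} {f g : E.cx.Face}
    {l : List E.cx.Face} (h : E.cx.IsCellChain f g l) :
    X.IsCellChain f.1 g.1 (l.map E.incl.onFace) := by
  obtain ⟨h₁, h₂, h₃, h₄⟩ := h
  refine ⟨h₁.map Subtype.val_injective, ?_, ?_, List.isChain_map_of_isChain _ ?_ h₄⟩
  · rw [List.head?_map, h₂]
    rfl
  · rw [List.getLast?_map, h₃]
    rfl
  · rintro a b ⟨v, hv, hv'⟩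
    exact ⟨v.1, E.onBoundary_iff.1 hv, E.onBoundary_iff.1 hv'⟩

theorem Meets.edist_le {X : TwoComplex.{u}} {f g : X.Face} (h : X.Meets f g) :
    (quadrization X).edist (.inr f) (.inr g) ≤ 2 := by
  obtain ⟨a, h₁, h₂⟩ := h
  have e₁ : (quadrization X).edist (.inr f) (.inl a) = 1 := SimpleGraph.edist_eq_one_iff_adj.2 h₁
  have e₂ : (quadrization X).edist (.inl a) (.inr g) = 1 := SimpleGraph.edist_eq_one_iff_adj.2 h₂
  refine (SimpleGraph.edist_triangle (v := Sum.inl a)).trans ?_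
  rw [e₁, e₂]
  norm_num

theorem edist_le_of_isChain {X : TwoComplex.{u}} {g : X.Face} (l : List X.Face) :
    ∀ f, (f :: l).IsChain X.Meets → (f :: l).getLast? = some g →
      (quadrization X).edist (.inr f) (.inr g) ≤ ((2 * l.length : ℕ) : ℕ∞) := by
  induction l with
  | nil =>
    intro f _ h
    obtain rfl : f = g := by simpa using h
    simp
  | cons f' l ih =>
    intro f hl h
    rw [List.isChain_cons_cons] at hl
    have h₁ := ih f' hl.2 (by rwa [List.getLast?_cons_cons] at h)
    refine (SimpleGraph.edist_triangle (v := Sum.inr f')).trans ((add_le_add hl.1.edist_le h₁).trans ?_)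
    rw [List.length_cons]
    norm_cast
    omega

theorem IsCellChain.edist_le {X : TwoComplex.{u}} {f g : X.Face} {l : List X.Face}
    (h : X.IsCellChain f g l) :
    (quadrization X).edist (.inr f) (.inr g) ≤ ((2 * (l.length - 1) : ℕ) : ℕ∞) ∧
      0 < l.length := by
  obtain ⟨-, h₂, h₃, h₄⟩ := h
  cases l with
  | nil => simp at h₂
  | cons f' l =>
    obtain rfl : f' = f := by simpa using h₂
    exact ⟨edist_le_of_isChain l _ h₄ h₃, by simp⟩

end TwoComplex

/-! ### Distances in the grid -/

theorem squareGrid_adj {p q : ℤ × ℤ} :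
    squareGrid.Adj p q ↔ (p.1 - q.1).natAbs + (p.2 - q.2).natAbs = 1 := by
  rw [squareGrid, SimpleGraph.boxProd_adj, SimpleGraph.hasse_adj, SimpleGraph.hasse_adj]
  simp only [Order.covBy_iff_add_one_eq]
  omega

theorem natAbs_add_le_of_squareGrid_edist_le {p q : ℤ × ℤ} {n : ℕ} (h : squareGrid.edist p q ≤ n) :
    (p.1 - q.1).natAbs + (p.2 - q.2).natAbs ≤ n := by
  obtain ⟨w, hw⟩ := SimpleGraph.exists_walk_of_edist_ne_top
    (ne_top_of_le_ne_top (ENat.natCast_ne_top n) h)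
  rw [← hw] at h
  have hn : w.length ≤ n := by exact_mod_cast h
  clear h hw
  induction w generalizing n with
  | nil => simp
  | cons ha w ih =>
    have h₁ := ih (n := n - 1) (by simp at hn; omega)
    have h₂ := squareGrid_adj.1 ha
    rw [SimpleGraph.Walk.length_cons] at hn
    omega

end SmallCancellation

/-! ### From a flat in the quadrization to a quasi-flat -/

namespace SmallCancellation

namespace IsFlat

variable {X : TwoComplex.{u}} {e : ℤ × ℤ → X.V ⊕ X.Face} (he : IsFlat (quadrization X) e)

include he

theorem adj_iff (p q : ℤ × ℤ) : (quadrization X).Adj (e p) (e q) ↔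
    (p.1 - q.1).natAbs + (p.2 - q.2).natAbs = 1 := by
  rw [← SimpleGraph.edist_eq_one_iff_adj, he p q, SimpleGraph.edist_eq_one_iff_adj, squareGrid_adj]

theorem injective : Function.Injective e := fun p q h => by
  rw [← SimpleGraph.edist_eq_zero_iff (G := squareGrid), ← he p q, h, SimpleGraph.edist_self]

theorem isRight_of_adj {p q : ℤ × ℤ} (h : (p.1 - q.1).natAbs + (p.2 - q.2).natAbs = 1) :
    (e q).isRight = !(e p).isRight := by
  have := (he.adj_iff p q).2 h
  cases hp : e p <;> cases hq : e q <;> rw [hp, hq] at this <;> first | rfl | exact this.elim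

theorem isRight_fst (a b : ℤ) : (e (a, b)).isRight = ((e (0, b)).isRight == decide (Even a)) := by
  induction a using Int.induction_on with
  | zero => simp
  | succ a ih =>
    rw [he.isRight_of_adj (p := ((a : ℤ), b)) (by simp), ih]
    simp only [Int.even_add_one]
    cases (e (0, b)).isRight <;> by_cases h : Even (a : ℤ) <;> simp [h]
  | pred a ih =>
    rw [he.isRight_of_adj (p := (-(a : ℤ), b)) (by simp), ih]
    simp only [Int.even_sub_one]
    cases (e (0, b)).isRight <;> by_cases h : Even (-(a : ℤ)) <;> simp [h]

theorem isRight_snd (b : ℤ) : (e (0, b)).isRight = ((e (0, 0)).isRight == decide (Even b)) := by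
  induction b using Int.induction_on with
  | zero => simp
  | succ b ih =>
    rw [he.isRight_of_adj (p := (0, (b : ℤ))) (by simp), ih]
    simp only [Int.even_add_one]
    cases (e (0, 0)).isRight <;> by_cases h : Even (b : ℤ) <;> simp [h]
  | pred b ih =>
    rw [he.isRight_of_adj (p := (0, -(b : ℤ))) (by simp), ih]
    simp only [Int.even_sub_one]
    cases (e (0, 0)).isRight <;> by_cases h : Even (-(b : ℤ)) <;> simp [h]

/-- The `2`-cells are found at the points of the grid where the sum of the coordinates has a certain
parity. -/
theorem exists_isRight_iff : ∃ c : ℤ, ∀ a b, (e (a + c, b)).isRight = true ↔ Even (a + b) := by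
  cases h : (e (0, 0)).isRight
  · refine ⟨1, fun a b => ?_⟩
    rw [he.isRight_fst, he.isRight_snd, h]
    have h₃ : Even (a + 1) ↔ ¬ Even a := Int.even_add_one
    by_cases h₁ : Even a <;> by_cases h₂ : Even b <;> simp [Int.even_add (m := a) (n := b), h₁, h₂, h₃]
  · refine ⟨0, fun a b => ?_⟩
    rw [he.isRight_fst, he.isRight_snd, h]
    by_cases h₁ : Even a <;> by_cases h₂ : Even b <;> simp [Int.even_add, h₁, h₂]

/-- The `2`-cells and the vertices of a flat, arranged as the squares and the vertices of a grid. -/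
theorem exists_grid : ∃ (F : ℤ → ℤ → X.Face) (v : ℤ → ℤ → X.V) (c : ℤ),
    (∀ m n, e (m - n + c, m + n) = .inr (F m n)) ∧
    (∀ m n, e (m - n + c, m + n - 1) = .inl (v m n)) ∧
    ∀ f, Sum.inr f ∈ Set.range e ↔ ∃ m n, F m n = f := by
  -- In the grid rotated by 45 degrees, the cell `F m n` has `v m n` below, `v (m + 1) n` to the
  -- right, `v (m + 1) (n + 1)` above and `v m (n + 1)` to the left; `c` adjusts the parity.
  obtain ⟨c, hc⟩ := he.exists_isRight_iff
  have hF : ∀ m n : ℤ, ∃ f, e (m - n + c, m + n) = .inr f := fun m n =>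
    Sum.isRight_iff.1 ((hc _ _).2 ⟨m, by ring⟩)
  have hv : ∀ m n : ℤ, ∃ v, e (m - n + c, m + n - 1) = .inl v := fun m n => by
    refine Sum.isLeft_iff.1 (Sum.not_isRight.1 fun h => ?_)
    obtain ⟨k, hk⟩ := (hc _ _).1 h
    omega
  choose F hF using hF
  choose v hv using hv
  refine ⟨F, v, c, hF, hv, fun f => ⟨?_, ?_⟩⟩
  · rintro ⟨⟨a, b⟩, h⟩
    have := hc (a - c) b
    rw [sub_add_cancel, h] at this
    obtain ⟨k, hk⟩ := this.1 rfl
    refine ⟨k, b - k, (Sum.inr_injective : Function.Injective (Sum.inr : _ → X.V ⊕ X.Face)) ?_⟩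
    rw [← hF, ← h, show k - (b - k) + c = a by omega, show k + (b - k) = b by omega]
  · rintro ⟨m, n, rfl⟩
    exact ⟨_, hF m n⟩

end IsFlat

namespace TwoComplex

variable {X : TwoComplex.{u}} {F : ℤ → ℤ → X.Face} {v : ℤ → ℤ → X.V}

/-- The chain of `2`-cells along which a king moves from one square to another. -/
theorem exists_isCellChain (inc : ∀ m n m' n', X.OnBoundary (v m' n') (F m n) ↔
      (m' = m ∨ m' = m + 1) ∧ (n' = n ∨ n' = n + 1))
    (hF : ∀ m n m' n', F m n = F m' n' → m = m' ∧ n = n') (m n m' n' : ℤ) :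
    ∃ l, X.IsCellChain (F m n) (F m' n') l ∧
      l.length = max (m' - m).natAbs (n' - n).natAbs + 1 := by
  set N := max (m' - m).natAbs (n' - n).natAbs with hN
  -- After `i` moves, each coordinate of the displacement is the total one clamped to the interval
  -- from `-i` to `i`.
  let G : ℕ → X.Face := fun i =>
    F (m + max (min (m' - m) i) (-i)) (n + max (min (n' - n) i) (-i))
  refine ⟨(List.range (N + 1)).map G, ⟨?_, ?_, ?_, ?_⟩, by simp⟩
  · refine List.Nodup.map_on (fun i hi j hj h => ?_) List.nodup_range
    have := hF _ _ _ _ h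
    have := List.mem_range.1 hi
    have := List.mem_range.1 hj
    omega
  · rw [List.range_succ_eq_map, List.map_cons, List.head?_cons]
    refine congrArg some (congrArg₂ F ?_ ?_) <;> simp
  · rw [List.range_succ, List.map_append, List.map_singleton, List.getLast?_concat]
    exact congrArg some (congrArg₂ F (by omega) (by omega))
  · rw [List.isChain_iff_getElem]
    intro i hi
    rw [List.getElem_map, List.getElem_map, List.getElem_range, List.getElem_range]
    set a := m + max (min (m' - m) i) (-i) with ha
    set b := n + max (min (n' - n) i) (-i) with hb
    set a' := m + max (min (m' - m) (i + 1 : ℕ)) (-(i + 1 : ℕ)) with ha'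
    set b' := n + max (min (n' - n) (i + 1 : ℕ)) (-(i + 1 : ℕ)) with hb'
    -- The indices of consecutive cells differ by at most one, so the vertex with the larger
    -- coordinates lies on both.
    exact ⟨v (max a a') (max b b'), (inc _ _ _ _).2 (by omega), (inc _ _ _ _).2 (by omega)⟩

end TwoComplex

-- The incidences and distances of the flat supply the hypotheses of `exists_flatSystem` inside the
-- subcomplex. The lower bound for chains in `X` also applies to chains in the subcomplex, while the
-- king's walk exists in both; this makes the gallery distances equal.
open TwoComplex in
theorem IsFlat.isQuasiFlat {X : TwoComplex.{u}} {e : ℤ × ℤ → X.V ⊕ X.Face}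
    (he : IsFlat (quadrization X) e) (hC : X.IsC 4) (hT : X.IsT 4) (thin : X.IsThin) :
    IsQuasiFlat X (flatSubcomplex X e) := by
  obtain ⟨F, v, c, hF, hv, hr⟩ := he.exists_grid
  have inc : ∀ m n m' n', X.OnBoundary (v m' n') (F m n) ↔
      (m' = m ∨ m' = m + 1) ∧ (n' = n ∨ n' = n + 1) := fun m n m' n' => by
    have h := he.adj_iff (m' - n' + c, m' + n' - 1) (m - n + c, m + n)
    rw [hF, hv] at h
    refine h.trans ?_
    dsimp only
    omega
  -- In the rotated coordinates the grid distance is `|Δm - Δn| + |Δm + Δn| = 2 max (|Δm|, |Δn|)`.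
  have dist : ∀ m n m' n' : ℤ, ∀ k : ℕ,
      (quadrization X).edist (.inr (F m n)) (.inr (F m' n')) ≤ ((2 * k : ℕ) : ℕ∞) →
      max (m' - m).natAbs (n' - n).natAbs ≤ k := fun m n m' n' k h => by
    rw [← hF, ← hF, he] at h
    have := natAbs_add_le_of_squareGrid_edist_le h
    dsimp only at this
    omega
  have hFi : ∀ m n m' n', F m n = F m' n' → m = m' ∧ n = n' := fun m n m' n' h => by
    have h := he.injective ((hF m n).trans ((congrArg Sum.inr h).trans (hF m' n').symm))
    rw [Prod.mk.injEq] at h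
    omega
  set E := flatSubcomplex X e with hE
  let F' : ℤ → ℤ → E.cx.Face := fun m n => ⟨F m n, (hr _).2 ⟨m, n, rfl⟩⟩
  let v' : ℤ → ℤ → E.cx.V := fun m n =>
    ⟨v m n, F m n, (hr _).2 ⟨m, n, rfl⟩, (inc _ _ _ _).2 ⟨.inl rfl, .inl rfl⟩⟩
  have hface : ∀ f : E.cx.Face, ∃ m n, F' m n = f := fun f => by
    obtain ⟨m, n, h⟩ := (hr _).1 f.2
    exact ⟨m, n, Subtype.ext h⟩
  have inc' : ∀ m n m' n', E.cx.OnBoundary (v' m' n') (F' m n) ↔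
      (m' = m ∨ m' = m + 1) ∧ (n' = n ∨ n' = n + 1) := fun m n m' n' =>
    E.onBoundary_iff.trans (inc m n m' n')
  have hFi' : ∀ m n m' n', F' m n = F' m' n' → m = m' ∧ n = n' := fun m n m' n' h =>
    hFi _ _ _ _ (congrArg Subtype.val h)
  have thin' := E.isThin thin
  obtain ⟨S, hS⟩ := thin'.exists_flatSystem F' v' inc' (fun m n m' n' h => by
      have h := he.injective
        ((hv m n).trans ((congrArg (fun a => Sum.inl a.1) h).trans (hv m' n').symm))
      rw [Prod.mk.injEq] at h
      omega)
    -- Cells with a common vertex are at distance at most two in the quadrization, so `dist` applies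
    -- with `k = 1`.
    (fun m n m' n' u h h' => by
      have := dist m n m' n' 1
        (Meets.edist_le ⟨u.1, E.onBoundary_iff.1 h, E.onBoundary_iff.1 h'⟩)
      omega)
  have sub := S.subdivision thin'
    (fun f => by
      obtain ⟨m, n, rfl⟩ := hface f
      exact ⟨(m, n), hS m n⟩)
    (fun d => by
      obtain ⟨f, hf, s, hs⟩ := d.2
      exact ⟨⟨f, hf⟩, s, Subtype.ext ((E.val_attach ⟨f, hf⟩ s).trans hs)⟩)
    (fun a => by
      obtain ⟨f, hf, k, hk⟩ := a.2
      exact ⟨E.cx.side ⟨f, hf⟩ k, Subtype.ext hk⟩)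
  refine ⟨⟨E.isC hC, E.isT hT, S.collapsed, sub.nonempty_homeomorph⟩, fun f g => ?_⟩
  obtain ⟨m, n, rfl⟩ := hface f
  obtain ⟨m', n', rfl⟩ := hface g
  have low : ∀ l, X.IsCellChain (F m n) (F m' n') l →
      max (m' - m).natAbs (n' - n).natAbs + 1 ≤ l.length := fun l hl => by
    have h := hl.edist_le
    have := dist _ _ _ _ _ h.1
    omega
  obtain ⟨l, hl, hl'⟩ := exists_isCellChain inc hFi m n m' n'
  obtain ⟨k, hk, hk'⟩ := exists_isCellChain inc' hFi' m n m' n'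
  refine (hk.galleryDist_eq fun k' h => ?_).trans
    ((congrArg Nat.cast (hk'.trans hl'.symm)).trans
      (hl.galleryDist_eq fun l' h => hl'.trans_le (low l' h)).symm)
  have := low _ h.val
  rw [List.length_map] at this
  exact hk'.trans_le this

end SmallCancellation

theorem lemma7p7 (X : SmallCancellation.TwoComplex.{u})
    (hX : X.IsSimplyConnected) (hC : X.IsC 4) (hT : X.IsT 4) (hedge : X.EveryEdgeInFace)
    (e : ℤ × ℤ → X.V ⊕ X.Face)
    (he : SmallCancellation.IsFlat (SmallCancellation.quadrization X) e) :
    SmallCancellation.IsQuasiFlat X (SmallCancellation.flatSubcomplex X e) :=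
  he.isQuasiFlat hC hT
    (SmallCancellation.TwoComplex.isThin hX hC (SmallCancellation.TwoComplex.noTriangle hC hT) hedge)
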